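/- Let $S_n$ denote the symmetric group on $n$ points. All generating sets are multisets. A multiset $S$ in a finite group $H$ is called a $1/4$-spectral generating set for $H$ if it is symmetric (every $g$ occurs with the same multiplicity as $g^{-1}$), it generates $H$, and $\mathrm{Cay}(H,S)$ is a $1/4$-spectral expander, that is, $\|Mv\|\le\frac14\|v\|$ for every $v\in\mathbb{C}^{H}$ with $\sum_{x}v(x)=0$, where $(Mv)(x)=\frac1{|S|}\sum_{a\in S}v(xa)$ and sizes and sums are taken with multiplicity. There are a deterministic algorithm, a polynomial $p$ and a constant $c>0$ with the following property. Let $n\ge 0$ and $r\ge 1$, let $G\le S_n$, and let $G=G_0\ge G_1\ge\dots\ge G_r=\{1\}$ be a normal series (every $G_i$ is normal in $G$). For each $0\le i<r$ let $B_i$ be a finite list of elements of $G_i$ whose images in $G_i/G_{i+1}$, counted with multiplicity, form a $1/4$-spectral generating set for $G_i/G_{i+1}$, and let $s=\max_i|B_i|$. Then, given $n$, $r$ and the lists $B_0,\dots,B_{r-1}$ of permutations, the algorithm computes a $1/4$-spectral generating set $B$ for $G$ with $$|B|=c^{\log_2 r}\,s .$$ Its running time (on a random access machine with addition and subtraction at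 unit cost) is at most $p(n+s+r)$; if moreover all inclusions $G_{i+1}\subset G_i$ are proper, it is at most $p(n+s)$. -/

import Mathlib

/-! ### Random access machines

Deterministic random access programs with unit cost.  The memory consists of numbered banks, each
of which is an array of natural numbers with random (indirect) access; a program mentions only
finitely many banks.  The arithmetic operations are addition and truncated subtraction; there is no
multiplication, so unit-cost time is polynomially related to Turing machine time. -/

namespace RAM

/-- `m b j` is the content of cell `j` of bank `b`. -/
abbrev Memory : Type := ℕ → ℕ → ℕ

inductive Expr : Type
  | const (k : ℕ) : Expr
  | read (b : ℕ) (addr : Expr) : Expr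
  | add (e₁ e₂ : Expr) : Expr
  | monus (e₁ e₂ : Expr) : Expr

def Expr.eval (m : Memory) : Expr → ℕ
  | .const k => k
  | .read b a => m b (a.eval m)
  | .add e₁ e₂ => e₁.eval m + e₂.eval m
  | .monus e₁ e₂ => e₁.eval m - e₂.eval m

/-- The number of elementary operations performed in evaluating an expression. -/
def Expr.cost : Expr → ℕ
  | .const _ => 1
  | .read _ a => a.cost + 1
  | .add e₁ e₂ => e₁.cost + e₂.cost + 1
  | .monus e₁ e₂ => e₁.cost + e₂.cost + 1

inductive Prog : Type
  | skip : Prog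
  /-- `write b addr val` stores the value of `val` in the cell `addr` of bank `b`. -/
  | write (b : ℕ) (addr val : Expr) : Prog
  | seq (p q : Prog) : Prog
  /-- Execute `p` if the value of `e` is nonzero, and `q` otherwise. -/
  | branch (e : Expr) (p q : Prog) : Prog
  /-- Execute `p` repeatedly, as long as the value of `e` is nonzero. -/
  | loop (e : Expr) (p : Prog) : Prog

/-- The memory after writing `v` to cell `j` of bank `b`. -/
def Memory.set (m : Memory) (b j v : ℕ) : Memory :=
  fun b' j' => if b' = b ∧ j' = j then v else m b' j'

/-- `Exec p m m' t`: started in memory `m`, the program `p` halts with memory `m'` after exactly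
`t` steps. -/
inductive Exec : Prog → Memory → Memory → ℕ → Prop
  | skip (m : Memory) : Exec .skip m m 1
  | write (m : Memory) (b : ℕ) (a v : Expr) :
      Exec (.write b a v) m (m.set b (a.eval m) (v.eval m)) (a.cost + v.cost + 1)
  | seq {p q : Prog} {m m' m'' : Memory} {t t' : ℕ} :
      Exec p m m' t → Exec q m' m'' t' → Exec (.seq p q) m m'' (t + t')
  | branch_true {e : Expr} {p q : Prog} {m m' : Memory} {t : ℕ} :
      e.eval m ≠ 0 → Exec p m m' t → Exec (.branch e p q) m m' (e.cost + 1 + t)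
  | branch_false {e : Expr} {p q : Prog} {m m' : Memory} {t : ℕ} :
      e.eval m = 0 → Exec q m m' t → Exec (.branch e p q) m m' (e.cost + 1 + t)
  | loop_done {e : Expr} {p : Prog} {m : Memory} :
      e.eval m = 0 → Exec (.loop e p) m m (e.cost + 1)
  | loop_step {e : Expr} {p : Prog} {m m' m'' : Memory} {t t' : ℕ} :
      e.eval m ≠ 0 → Exec p m m' t → Exec (.loop e p) m' m'' t' →
      Exec (.loop e p) m m'' (e.cost + 1 + t + t')

/-- The initial memory for the input word `w`: the word is written in bank `0`, and every other
cell contains `0`. -/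
def initMemory (w : List ℕ) : Memory :=
  fun b j => if b = 0 then w.getD j 0 else 0

/-- The output word, written from cell `0` on in bank `1`, is `w`. -/
def HasOutput (m : Memory) (w : List ℕ) : Prop :=
  ∀ j, ∀ h : j < w.length, m 1 j = w[j]

/-- On input `w` the program halts after exactly `t` steps, with output `w'`. -/
def Computes (p : Prog) (w w' : List ℕ) (t : ℕ) : Prop :=
  ∃ m : Memory, Exec p (initMemory w) m t ∧ HasOutput m w'

end RAM

/-! ### Expanding generating multisets -/

/-- The normalized adjacency operator of the Cayley graph `Cay(G, S)` of a multiset `S`, on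
functions on the vertices: every vertex `x` is joined to `x * a` for all `a ∈ S`. -/
noncomputable def cayleyOp {G : Type*} [Group G] (S : Multiset G) (f : G → ℂ) : G → ℂ :=
  fun x => (Multiset.card S : ℂ)⁻¹ * (S.map fun a => f (x * a)).sum

/-- `Cay(G, S)` is a `lam`-spectral expander: its normalized adjacency operator `M` satisfies
`‖M v‖ ≤ lam * ‖v‖` for all vectors `v` orthogonal to the constant vectors. -/
def IsSpectralExpander {G : Type*} [Group G] [Finite G] (lam : ℝ) (S : Multiset G) : Prop :=
  letI : Fintype G := Fintype.ofFinite G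
  ∀ f : G → ℂ, ∑ x, f x = 0 →
    ‖(WithLp.toLp 2 (cayleyOp S f) : EuclideanSpace ℂ G)‖
      ≤ lam * ‖(WithLp.toLp 2 f : EuclideanSpace ℂ G)‖

/-- A symmetric multiset (each element has the same multiplicity as its inverse) which generates
`G` and for which the undirected Cayley graph is a `lam`-spectral expander. -/
structure IsExpandingGenerating {G : Type*} [Group G] [Finite G] (lam : ℝ) (S : Multiset G) :
    Prop where
  symmetric : S.map (fun g => g⁻¹) = S
  generates : Subgroup.closure {g : G | g ∈ S} = ⊤
  expander : IsSpectralExpander lam S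

/-! ### Normal series of permutation groups -/

/-- A normal series `G = G_0 ≥ G_1 ≥ ... ≥ G_r = 1` of length `r`, all of whose terms are normal
in `G`. -/
structure NormalSeries {n : ℕ} (G : Subgroup (Equiv.Perm (Fin n))) (r : ℕ) where
  term : Fin (r + 1) → Subgroup (Equiv.Perm (Fin n))
  term_zero : term 0 = G
  term_last : term (Fin.last r) = ⊥
  succ_le : ∀ i : Fin r, term i.succ ≤ term i.castSucc
  normal : ∀ i, ((term i).subgroupOf G).Normal

namespace NormalSeries

variable {n r : ℕ} {G : Subgroup (Equiv.Perm (Fin n))}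

theorem term_le (𝒢 : NormalSeries G r) (i : Fin (r + 1)) : 𝒢.term i ≤ G := by
  have h : Antitone 𝒢.term := Fin.antitone_iff_succ_le.2 𝒢.succ_le
  exact (h (Fin.zero_le i)).trans 𝒢.term_zero.le

instance factor_normal (𝒢 : NormalSeries G r) (i : Fin r) :
    ((𝒢.term i.succ).subgroupOf (𝒢.term i.castSucc)).Normal := by
  refine ⟨fun x hx g => ?_⟩
  have h := (𝒢.normal i.succ).conj_mem ⟨x.1, 𝒢.term_le _ x.2⟩
    (by simpa [Subgroup.mem_subgroupOf] using hx) ⟨g.1, 𝒢.term_le _ g.2⟩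
  simpa [Subgroup.mem_subgroupOf] using h

/-- The factor group `G_i / G_{i+1}`. -/
abbrev Factor (𝒢 : NormalSeries G r) (i : Fin r) : Type :=
  𝒢.term i.castSucc ⧸ (𝒢.term i.succ).subgroupOf (𝒢.term i.castSucc)

/-- The multiset in `G_i / G_{i+1}` that is given by a list of coset representatives in `G_i`. -/
def cosets (𝒢 : NormalSeries G r) (i : Fin r) (L : List (𝒢.term i.castSucc)) :
    Multiset (𝒢.Factor i) :=
  (L.map fun b => (QuotientGroup.mk b : 𝒢.Factor i) : List (𝒢.Factor i))

/-- All inclusions in the series are proper. -/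
def IsProper (𝒢 : NormalSeries G r) : Prop :=
  ∀ i : Fin r, 𝒢.term i.succ < 𝒢.term i.castSucc

end NormalSeries

/-! ### Encodings -/

/-- A permutation as the word of its values. -/
def encodePerm {n : ℕ} (σ : Equiv.Perm (Fin n)) : List ℕ :=
  List.ofFn fun i => (σ i : ℕ)

/-- A list of permutations: its length, followed by the words of the permutations. -/
def encodeOutput {n : ℕ} (L : List (Equiv.Perm (Fin n))) : List ℕ :=
  L.length :: L.flatMap encodePerm

/-- A sequence of `r` lists of permutations of `n` points: the numbers `n` and `r`, the lengths of
the `r` lists, and the words of all permutations in the lists, in order. -/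
def encodeInput {n r : ℕ} (L : Fin r → List (Equiv.Perm (Fin n))) : List ℕ :=
  n :: r :: (List.ofFn (fun i => (L i).length) ++
    (List.ofFn fun i => (L i).flatMap encodePerm).flatten)

/-! The given lists together already generate `G` with a spectral gap of order `1/r`. Bring every
list to the common length `s` by periodic repetition and concatenate. Averaging over the terms of
the normal series splits the functions of mean zero orthogonally into `r` layers. Normality makes
every right translation by `G` preserve the layers. On layer `i` the block of `B i` contracts by
`5/8`, and the other blocks have norm at most `1`, so the average contracts by `1 - 3/(8r)`
(`spectralBound_blocks`).

The gap is amplified to a constant by derandomized squaring. A family is indexed by the `K * K`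
vertices of a Gabber–Galil graph, and its members at the two ends of each walk of length `32` are
multiplied. By `norm_sum_iterate_adjNat_le` such walks act as `15/16` of the full average plus
`1/16` of a contraction, so a bound `λ` becomes `15/16 λ² + 1/16` (`SpectralBound.square`), while
the family grows only by the constant factor `8 ^ 32`. Four squarings double the gap until the bound
falls to `1/8` (`squareBound_iterate_four_le`). Hence `O(log r)` squarings suffice and the size is
`s` times a power of `r`.

Finally inverses are added, the result is repeated periodically, and identity elements fill it up to
the exact length `s * r ^ 2000`, which is `c ^ log₂ r * s` for `c = 2 ^ 2000`. The rounding costs at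
most the step from `1/8` to `1/4` (`SpectralBound.symmetrized`). For `r = 1` the input list itself
is the answer.

The expansion of the Gabber–Galil graph (`sum_norm_adj_sq_le`) is proved on the Fourier side. Shears
act there as shears, the unit translations damp frequencies, and a Schur test with weights `5/4`,
`1`, `4/5` bounds the norm of the 8-regular adjacency operator by `7.3`.

The algorithm is an explicit program, verified by an invariant rule for loops and a frame rule for
memory banks. Every number that governs a loop is polynomially bounded, so multiplication by
repeated addition is affordable. If the series is proper, then `2 ^ r ≤ n!` gives `r ≤ n ^ 2`, which
removes `r` from the time bound. -/

/-! ### Running time and correctness of structured programs -/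

namespace RAM

/-- Started in memory `m`, the program `p` halts with memory `m'` after at most `T` steps. -/
def Runs (p : Prog) (m m' : Memory) (T : ℕ) : Prop := ∃ t ≤ T, Exec p m m' t

/-- Whether a program mentions a write to the bank `b`. -/
def Prog.wr : Prog → ℕ → Bool
  | .skip, _ => false
  | .write b' _ _, b => b == b'
  | .seq p q, b => p.wr b || q.wr b
  | .branch _ p q, b => p.wr b || q.wr b
  | .loop _ p, b => p.wr b

theorem Exec.frame {p : Prog} {m m' : Memory} {t : ℕ} (h : Exec p m m' t) {b : ℕ}
    (hb : p.wr b = false) : m' b = m b := by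
  induction h with
  | skip => rfl
  | write m b' a v =>
    have : b ≠ b' := by simpa [Prog.wr] using hb
    funext j
    simp [Memory.set, this]
  | seq _ _ ih₁ ih₂ =>
    simp only [Prog.wr, Bool.or_eq_false_iff] at hb
    rw [ih₂ hb.2, ih₁ hb.1]
  | branch_true _ _ ih =>
    simp only [Prog.wr, Bool.or_eq_false_iff] at hb
    exact ih hb.1
  | branch_false _ _ ih =>
    simp only [Prog.wr, Bool.or_eq_false_iff] at hb
    exact ih hb.2
  | loop_done => rfl
  | loop_step _ _ _ ih₁ ih₂ => rw [ih₂ hb, ih₁ (by simpa [Prog.wr] using hb)]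

/-- Since `Prog.wr` is a computable syntactic check, the side condition for a concrete program and
bank is closed by `rfl`. This is how unchanged variables are tracked throughout. -/
theorem Runs.frame {p : Prog} {m m' : Memory} {T : ℕ} (h : Runs p m m' T) (b : ℕ)
    (hb : p.wr b = false) : m' b = m b := h.choose_spec.2.frame hb

theorem Runs.mono {p : Prog} {m m' : Memory} {T T' : ℕ} (h : Runs p m m' T) (hT : T ≤ T') :
    Runs p m m' T' := ⟨h.choose, h.choose_spec.1.trans hT, h.choose_spec.2⟩

theorem Runs.seq {p q : Prog} {m m' m'' : Memory} {T T' : ℕ} (h : Runs p m m' T)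
    (h' : Runs q m' m'' T') : Runs (.seq p q) m m'' (T + T') := by
  obtain ⟨t, ht, e⟩ := h
  obtain ⟨t', ht', e'⟩ := h'
  exact ⟨t + t', by omega, e.seq e'⟩

theorem Runs.write {b : ℕ} {a v : Expr} (m : Memory) {j x T : ℕ} (hj : a.eval m = j)
    (hx : v.eval m = x) (hT : a.cost + v.cost + 1 ≤ T) :
    Runs (.write b a v) m (m.set b j x) T := by
  subst hj hx
  exact ⟨_, hT, .write m b a v⟩

theorem Runs.skip (m : Memory) : Runs .skip m m 1 := ⟨1, le_rfl, .skip m⟩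

theorem Runs.branch_true {e : Expr} {p q : Prog} {m m' : Memory} {T : ℕ} (he : e.eval m ≠ 0)
    (h : Runs p m m' T) : Runs (.branch e p q) m m' (e.cost + 1 + T) := by
  obtain ⟨t, ht, h⟩ := h
  exact ⟨_, by omega, .branch_true he h⟩

theorem Runs.branch_false {e : Expr} {p q : Prog} {m m' : Memory} {T : ℕ} (he : e.eval m = 0)
    (h : Runs q m m' T) : Runs (.branch e p q) m m' (e.cost + 1 + T) := by
  obtain ⟨t, ht, h⟩ := h
  exact ⟨_, by omega, .branch_false he h⟩

theorem Memory.set_same (m : Memory) (b j v : ℕ) : m.set b j v b j = v := by simp [Memory.set]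

theorem Memory.set_bank (m : Memory) {b b' : ℕ} (j v : ℕ) (h : b' ≠ b) :
    m.set b j v b' = m b' := by
  funext j'
  simp [Memory.set, h]

theorem Memory.set_addr (m : Memory) (b b' : ℕ) {j j' : ℕ} (v : ℕ) (h : j' ≠ j) :
    m.set b j v b' j' = m b' j' := by simp [Memory.set, h]

/-- The loop rule: `I k` is an invariant after `k` rounds. -/
theorem loop_runs {e : Expr} {p : Prog} {m₀ : Memory} (N T : ℕ) (I : ℕ → Memory → Prop)
    (hstep : ∀ k < N, ∀ m : Memory, (∀ b, p.wr b = false → m b = m₀ b) → I k m →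
      e.eval m ≠ 0 ∧ ∃ m', Runs p m m' T ∧ I (k + 1) m')
    (hend : ∀ m : Memory, (∀ b, p.wr b = false → m b = m₀ b) → I N m → e.eval m = 0)
    (h0 : I 0 m₀) :
    ∃ m', Runs (.loop e p) m₀ m' (N * (e.cost + 1 + T) + e.cost + 1) ∧ I N m' := by
  have key : ∀ d k, k + d = N → ∀ m : Memory, (∀ b, p.wr b = false → m b = m₀ b) → I k m →
      ∃ m', Runs (.loop e p) m m' (d * (e.cost + 1 + T) + e.cost + 1) ∧ I N m' := by
    intro d
    induction d with
    | zero =>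
      intro k hk m hm hI
      obtain rfl : k = N := by omega
      exact ⟨m, ⟨_, by omega, .loop_done (hend m hm hI)⟩, hI⟩
    | succ d ih =>
      intro k hk m hm hI
      obtain ⟨he, m₁, h₁, hI₁⟩ := hstep k (by omega) m hm hI
      obtain ⟨m₂, ⟨t₂, ht₂, h₂⟩, hI₂⟩ := ih (k + 1) (by omega) m₁
        (fun b hb => (h₁.frame b hb).trans (hm b hb)) hI₁
      obtain ⟨t₁, ht₁, h₁⟩ := h₁
      refine ⟨m₂, ⟨_, ?_, .loop_step he h₁ h₂⟩, hI₂⟩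
      rw [add_mul, one_mul]
      omega
  exact key N 0 (by omega) m₀ (fun _ _ => rfl) h0

/-- The value of the scalar variable that is stored in bank `b`. -/
abbrev V (b : ℕ) : Expr := .read b (.const 0)

theorem eval_V (m : Memory) (b : ℕ) : (V b).eval m = m b 0 := rfl

/-- Assignment to the scalar variable that is stored in bank `b`. -/
abbrev setv (b : ℕ) (e : Expr) : Prog := .write b (.const 0) e

theorem Runs.setv {b : ℕ} {v : Expr} (m : Memory) {x T : ℕ} (hx : v.eval m = x)
    (hT : v.cost + 2 ≤ T) : Runs (setv b v) m (m.set b 0 x) T :=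
  Runs.write m rfl hx (by simp only [Expr.cost]; omega)

/-- A counting loop. -/
def forP (c : ℕ) (N : Expr) (body : Prog) : Prog :=
  .seq (setv c (.const 0))
    (.loop (.monus N (V c)) (.seq body (setv c (.add (V c) (.const 1)))))

/-- The bound `N` is evaluated again before every round, so `hN` asks for its value in all memories
reachable by the body. By `hI` the invariant ignores the counter. The summand `200` absorbs the cost
of the test and of the increment. -/
theorem forP_runs {c : ℕ} {N : Expr} {body : Prog} {m₀ : Memory} (n T : ℕ)
    (I : ℕ → Memory → Prop) (hc : body.wr c = false) (hcost : N.cost ≤ 100)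
    (hN : ∀ m : Memory, (∀ b, body.wr b = false → b ≠ c → m b = m₀ b) → N.eval m = n)
    (hI : ∀ k m v, I k m → I k (Memory.set m c 0 v))
    (hstep : ∀ k < n, ∀ m : Memory, (∀ b, body.wr b = false → b ≠ c → m b = m₀ b) → m c 0 = k →
      I k m → ∃ m', Runs body m m' T ∧ I (k + 1) m')
    (h0 : I 0 m₀) :
    ∃ m', Runs (forP c N body) m₀ m' (n * (T + 200) + 200) ∧ I n m' := by
  have hwr : ∀ b, (Prog.seq body (RAM.setv c (.add (V c) (.const 1)))).wr b = false →
      body.wr b = false ∧ b ≠ c := by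
    intro b hb
    simpa [Prog.wr] using hb
  have hfr : ∀ m : Memory, (∀ b, (Prog.seq body (RAM.setv c (.add (V c) (.const 1)))).wr b = false →
      m b = m₀.set c 0 0 b) → ∀ b, body.wr b = false → b ≠ c → m b = m₀ b := by
    intro m hm b hb hbc
    rw [hm b (by simp [Prog.wr, hb, hbc]), Memory.set_bank _ _ _ hbc]
  obtain ⟨m', h', hI'⟩ := loop_runs (e := .monus N (V c))
    (p := .seq body (RAM.setv c (.add (V c) (.const 1)))) (m₀ := m₀.set c 0 0) n (T + 6)
    (fun k m => m c 0 = k ∧ I k m)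
    (by
      rintro k hk m hm ⟨hck, hIk⟩
      refine ⟨?_, ?_⟩
      · rw [Expr.eval, hN m (hfr m hm), eval_V]; omega
      · obtain ⟨m₁, h₁, hI₁⟩ := hstep k hk m (hfr m hm) hck hIk
        refine ⟨_, (h₁.seq (Runs.setv m₁ rfl le_rfl)).mono (by simp [Expr.cost]), ?_, hI _ _ _ hI₁⟩
        rw [Memory.set_same, Expr.eval, eval_V, h₁.frame c hc, hck, Expr.eval])
    (by
      rintro m hm ⟨hck, -⟩
      rw [Expr.eval, hN m (hfr m hm), eval_V]; omega)
    ⟨Memory.set_same _ _ _ _, hI _ _ _ h0⟩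
  refine ⟨m', ((Runs.setv m₀ rfl le_rfl).seq h').mono ?_, hI'.2⟩
  simp only [Expr.cost]
  have : n * (N.cost + (1 + 1) + 1 + 1 + (T + 6)) ≤ n * (T + 200) :=
    Nat.mul_le_mul_left _ (by omega)
  omega

theorem forP_wr (c : ℕ) (N : Expr) (body : Prog) (b : ℕ) :
    (forP c N body).wr b = (b == c || body.wr b) := by
  simp only [forP, Prog.wr]
  cases (b == c) <;> cases body.wr b <;> rfl

/-- Multiplication: `d := x * y`. -/
def mulP (d c : ℕ) (x y : Expr) : Prog :=
  .seq (setv d (.const 0)) (forP c x (setv d (.add (V d) y)))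

/-- Repeated addition takes time linear in the value `X`, not in its number of digits. This is
harmless as long as all factors are polynomially bounded. -/
theorem mulP_runs {d c : ℕ} {x y : Expr} {m₀ : Memory} (X Y : ℕ) (hdc : d ≠ c)
    (hx : ∀ m : Memory, (∀ b, b ≠ d → b ≠ c → m b = m₀ b) → x.eval m = X)
    (hy : ∀ m : Memory, (∀ b, b ≠ d → b ≠ c → m b = m₀ b) → y.eval m = Y)
    (hcx : x.cost ≤ 100) (hcy : y.cost ≤ 100) :
    ∃ m', Runs (mulP d c x y) m₀ m' (500 * (X + 1)) ∧ m' d 0 = X * Y := by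
  have hfr : ∀ m : Memory, (∀ b, (RAM.setv d (.add (V d) y)).wr b = false → b ≠ c →
      m b = m₀.set d 0 0 b) → ∀ b, b ≠ d → b ≠ c → m b = m₀ b := by
    intro m hm b hbd hbc
    rw [hm b (by simp [Prog.wr, hbd]) hbc, Memory.set_bank _ _ _ hbd]
  obtain ⟨m', h', hI⟩ := forP_runs (c := c) (N := x) (body := RAM.setv d (.add (V d) y))
    (m₀ := m₀.set d 0 0) X 200 (fun k m => m d 0 = k * Y) (by simp [Prog.wr, hdc.symm]) hcx
    (fun m hm => hx m (hfr m hm))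
    (fun k m v h => by rwa [Memory.set_bank _ _ _ hdc])
    (by
      intro k hk m hm hck hI
      refine ⟨_, Runs.setv m rfl (by simp [Expr.cost]; omega), ?_⟩
      rw [Memory.set_same, Expr.eval, eval_V, hI, hy m (hfr m hm), add_mul, one_mul])
    (by rw [Memory.set_same, zero_mul])
  refine ⟨m', ((Runs.setv m₀ rfl le_rfl).seq h').mono ?_, hI⟩
  simp only [Expr.cost]
  omega

/-- Division with remainder: `q := v / k` and `d := v % k`. -/
def divmodP (q d : ℕ) (v k : Expr) : Prog :=
  .seq (setv d v) (.seq (setv q (.const 0))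
    (.loop (.monus (.add (V d) (.const 1)) k)
      (.seq (setv d (.monus (V d) k)) (setv q (.add (V q) (.const 1))))))

theorem divmodP_runs {q d : ℕ} {v k : Expr} {m₀ : Memory} (x y : ℕ) (hqd : q ≠ d) (hy0 : 0 < y)
    (hv : v.eval m₀ = x)
    (hk : ∀ m : Memory, (∀ b, b ≠ q → b ≠ d → m b = m₀ b) → k.eval m = y)
    (hcv : v.cost ≤ 100) (hck : k.cost ≤ 100) :
    ∃ m', Runs (divmodP q d v k) m₀ m' (500 * (x + 1)) ∧ m' q 0 = x / y ∧ m' d 0 = x % y := by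
  have hfr : ∀ m : Memory, (∀ b, (Prog.seq (RAM.setv d (.monus (V d) k))
      (RAM.setv q (.add (V q) (.const 1)))).wr b = false → m b = (m₀.set d 0 x).set q 0 0 b) →
      ∀ b, b ≠ q → b ≠ d → m b = m₀ b := by
    intro m hm b hbq hbd
    rw [hm b (by simp [Prog.wr, hbd, hbq]), Memory.set_bank _ _ _ hbq, Memory.set_bank _ _ _ hbd]
  have hdiv : x / y ≤ x := Nat.div_le_self _ _
  obtain ⟨m', h', hI⟩ := loop_runs (e := .monus (.add (V d) (.const 1)) k)
    (p := .seq (RAM.setv d (.monus (V d) k)) (RAM.setv q (.add (V q) (.const 1))))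
    (m₀ := (m₀.set d 0 x).set q 0 0) (x / y) 200
    (fun j m => m q 0 = j ∧ m d 0 + j * y = x)
    (by
      rintro j hj m hm ⟨h1, h2⟩
      have hky := hk m (hfr m hm)
      have hjy : (j + 1) * y ≤ x := (Nat.mul_le_mul_right y hj).trans (Nat.div_mul_le_self x y)
      rw [add_mul, one_mul] at hjy
      refine ⟨?_, _, ((Runs.setv m rfl le_rfl).seq (Runs.setv _ rfl le_rfl)).mono ?_, ?_, ?_⟩
      · simp only [Expr.eval, hky]; omega
      · simp only [Expr.cost]; omega
      · simp only [Expr.eval, Memory.set_same, Memory.set_bank _ _ _ hqd, h1]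
      · rw [Memory.set_bank _ _ _ hqd.symm, Memory.set_same]
        simp only [Expr.eval, hky, add_mul, one_mul]
        omega)
    (by
      rintro m hm ⟨h1, h2⟩
      have hky := hk m (hfr m hm)
      have := Nat.lt_div_mul_add (a := x) hy0
      simp only [Expr.eval, hky]
      omega)
    ⟨Memory.set_same _ _ _ _, by
      rw [Memory.set_bank _ _ _ hqd.symm, Memory.set_same, zero_mul, add_zero]⟩
  refine ⟨m', ((Runs.setv m₀ hv le_rfl).seq ((Runs.setv _ rfl le_rfl).seq h')).mono ?_, hI.1, ?_⟩
  · simp only [Expr.cost]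
    have : x / y * (1 + 1 + 1 + 1 + k.cost + 1 + 1 + 200) ≤ x * 400 :=
      Nat.mul_le_mul hdiv (by omega)
    omega
  · have := Nat.div_add_mod x y
    have := hI.2
    rw [mul_comm] at this
    omega

/-- Copy a segment of length `len` from one bank to another. -/
def copyP (c dst : ℕ) (dpos : Expr) (src : ℕ) (spos len : Expr) : Prog :=
  forP c len (.write dst (.add dpos (V c)) (.read src (.add spos (V c))))

theorem copyP_runs {c dst src : ℕ} {dpos spos len : Expr} {m₀ : Memory} (D S n : ℕ)
    (hcd : c ≠ dst) (hcs : c ≠ src) (hds : dst ≠ src)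
    (hD : ∀ m : Memory, (∀ b, b ≠ dst → b ≠ c → m b = m₀ b) → dpos.eval m = D)
    (hS : ∀ m : Memory, (∀ b, b ≠ dst → b ≠ c → m b = m₀ b) → spos.eval m = S)
    (hn : ∀ m : Memory, (∀ b, b ≠ dst → b ≠ c → m b = m₀ b) → len.eval m = n)
    (hcD : dpos.cost ≤ 100) (hcS : spos.cost ≤ 100) (hcn : len.cost ≤ 100) :
    ∃ m', Runs (copyP c dst dpos src spos len) m₀ m' (500 * (n + 1)) ∧
      (∀ a < n, m' dst (D + a) = m₀ src (S + a)) ∧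
      ∀ j, (j < D ∨ D + n ≤ j) → m' dst j = m₀ dst j := by
  have hfr : ∀ m : Memory, (∀ b, (Prog.write dst (.add dpos (V c))
      (.read src (.add spos (V c)))).wr b = false → b ≠ c → m b = m₀ b) →
      ∀ b, b ≠ dst → b ≠ c → m b = m₀ b :=
    fun m hm b hbd hbc => hm b (by simp [Prog.wr, hbd]) hbc
  obtain ⟨m', h', hI⟩ := forP_runs (c := c) (N := len)
    (body := .write dst (.add dpos (V c)) (.read src (.add spos (V c)))) (m₀ := m₀) n 250
    (fun k m => (∀ a < k, m dst (D + a) = m₀ src (S + a)) ∧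
      ∀ j, (j < D ∨ D + k ≤ j) → m dst j = m₀ dst j)
    (by simp [Prog.wr, hcd]) hcn (fun m hm => hn m (hfr m hm))
    (fun k m v h => by rwa [Memory.set_bank _ _ _ hcd.symm])
    (by
      rintro k hk m hm hck ⟨h1, h2⟩
      refine ⟨_, Runs.write (j := D + k) (x := m₀ src (S + k)) m ?_ ?_ ?_, ?_, ?_⟩
      · simp only [Expr.eval, hD m (hfr m hm), hck]
      · simp only [Expr.eval, hS m (hfr m hm), hck, hfr m hm src hds.symm hcs.symm]
      · simp only [Expr.cost]; omega
      · intro a ha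
        rcases Nat.lt_succ_iff_lt_or_eq.1 ha with ha | rfl
        · rw [Memory.set_addr _ _ _ _ (by omega), h1 a ha]
        · rw [Memory.set_same]
      · intro j hj
        rw [Memory.set_addr _ _ _ _ (by omega), h2 j (by omega)])
    ⟨by simp, by simp⟩
  exact ⟨m', h'.mono (by omega), hI⟩

/-- Repeat periodically a segment of length `len` up to length `tot`. -/
def extendP (c b : ℕ) (pos len tot : Expr) : Prog :=
  forP c (.monus tot len) (.write b (.add pos (.add len (V c))) (.read b (.add pos (V c))))

/-- The loop copies cell `k` to cell `l + k` and soon reads cells that it has written itself, which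
makes the word periodic. By `hl` the source always precedes the destination. -/
theorem extendP_runs {c b : ℕ} {pos len tot : Expr} {m₀ : Memory} (D l n : ℕ) (f : ℕ → ℕ)
    (hcb : c ≠ b) (hl : 0 < n → 0 < l) (hln : l ≤ n)
    (hD : ∀ m : Memory, (∀ b', b' ≠ b → b' ≠ c → m b' = m₀ b') → pos.eval m = D)
    (hL : ∀ m : Memory, (∀ b', b' ≠ b → b' ≠ c → m b' = m₀ b') → len.eval m = l)
    (hn : ∀ m : Memory, (∀ b', b' ≠ b → b' ≠ c → m b' = m₀ b') → tot.eval m = n)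
    (hcD : pos.cost ≤ 40) (hcL : len.cost ≤ 40) (hcn : tot.cost ≤ 40)
    (hf : ∀ a < l, m₀ b (D + a) = f a) :
    ∃ m', Runs (extendP c b pos len tot) m₀ m' (500 * (n + 1)) ∧
      (∀ a < n, m' b (D + a) = f (a % l)) ∧ ∀ j < D, m' b j = m₀ b j := by
  have hfr : ∀ m : Memory, (∀ b', (Prog.write b (.add pos (.add len (V c)))
      (.read b (.add pos (V c)))).wr b' = false → b' ≠ c → m b' = m₀ b') →
      ∀ b', b' ≠ b → b' ≠ c → m b' = m₀ b' :=
    fun m hm b hbd hbc => hm b (by simp [Prog.wr, hbd]) hbc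
  obtain ⟨m', h', hI⟩ := forP_runs (c := c) (N := .monus tot len)
    (body := .write b (.add pos (.add len (V c))) (.read b (.add pos (V c)))) (m₀ := m₀)
    (n - l) 250
    (fun k m => (∀ a < l + k, m b (D + a) = f (a % l)) ∧ ∀ j < D, m b j = m₀ b j)
    (by simp [Prog.wr, hcb]) (by simp only [Expr.cost]; omega)
    (fun m hm => by simp only [Expr.eval, hn m (hfr m hm), hL m (hfr m hm)])
    (fun k m v h => by rwa [Memory.set_bank _ _ _ hcb.symm])
    (by
      rintro k hk m hm hck ⟨h1, h2⟩
      refine ⟨_, Runs.write (j := D + (l + k)) (x := f (k % l)) m ?_ ?_ ?_, ?_, ?_⟩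
      · simp only [Expr.eval, hD m (hfr m hm), hL m (hfr m hm), hck]
      · simp only [Expr.eval, hD m (hfr m hm), hck, h1 k (by have := hl (by omega); omega)]
      · simp only [Expr.cost]; omega
      · intro a ha
        rcases Nat.lt_or_ge a (l + k) with ha' | ha'
        · rw [Memory.set_addr _ _ _ _ (by omega), h1 a ha']
        · obtain rfl : a = l + k := by omega
          rw [Memory.set_same, Nat.add_mod_left]
      · intro j hj
        rw [Memory.set_addr _ _ _ _ (by omega), h2 j hj])
    ⟨fun a ha => by rw [add_zero] at ha; rw [hf a ha, Nat.mod_eq_of_lt ha], fun _ _ => rfl⟩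
  have hT : (n - l) * (250 + 200) + 200 ≤ 500 * (n + 1) := by
    have : ∀ x ≤ n, x * (250 + 200) + 200 ≤ 500 * (n + 1) := fun x hx => by omega
    exact this _ (Nat.sub_le n l)
  have h1 := hI.1
  rw [Nat.add_sub_cancel' hln] at h1
  have h2 := h'.mono hT
  exact ⟨m', h2, h1, hI.2⟩

end RAM

/-! ### The input -/

namespace RAM

/-- The word of all values of a sequence of permutations. -/
def flat (n : ℕ) (S : ℕ → Equiv.Perm (Fin n)) (a : ℕ) : ℕ :=
  if h : 0 < n then S (a / n) ⟨a % n, Nat.mod_lt a h⟩ else 0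

theorem flat_mul_add {n : ℕ} (S : ℕ → Equiv.Perm (Fin n)) (v : ℕ) (i : Fin n) :
    flat n S (v * n + i) = S v i := by
  have h : 0 < n := i.pos
  have h1 : (v * n + i) / n = v := by
    rw [mul_comm, Nat.mul_add_div h, Nat.div_eq_of_lt i.2, add_zero]
  have h2 : (v * n + i) % n = i := by
    rw [mul_comm, Nat.mul_add_mod, Nat.mod_eq_of_lt i.2]
  simp [flat, h, h1, h2]

theorem flat_lt {n : ℕ} (hn : 0 < n) (S : ℕ → Equiv.Perm (Fin n)) (a : ℕ) : flat n S a < n := by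
  simp [flat, hn]

theorem flat_congr {n : ℕ} {S S' : ℕ → Equiv.Perm (Fin n)} {a a' : ℕ}
    (h : S (a / n) = S' (a' / n)) (h' : a % n = a' % n) : flat n S a = flat n S' a' := by
  unfold flat
  split_ifs with hn
  · simp only [h, h']
  · rfl

/-- The data of the input, laid out in bank `0`. -/
structure Input (m : Memory) (n r : ℕ) (len : ℕ → ℕ) (b : ℕ → ℕ → Equiv.Perm (Fin n)) : Prop where
  points : m 0 0 = n
  factors : m 0 1 = r
  length : ∀ i < r, m 0 (2 + i) = len i
  entry : ∀ i < r, ∀ a < len i * n,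
    m 0 (2 + r + ∑ j ∈ Finset.range i, len j * n + a) = flat n (b i) a

theorem Input.frame {m m' : Memory} {n r : ℕ} {len : ℕ → ℕ} {b : ℕ → ℕ → Equiv.Perm (Fin n)}
    (h : Input m n r len b) (h0 : m' 0 = m 0) : Input m' n r len b := by
  constructor <;> rw [h0]
  exacts [h.points, h.factors, h.length, h.entry]

/-- The scalar variables that hold the parameters of the input. -/
structure Params (m : Memory) (n r s : ℕ) : Prop where
  n : m 2 0 = n
  r : m 3 0 = r
  s : m 4 0 = s

theorem Params.frame {m m' : Memory} {n r s : ℕ} (h : Params m n r s) (h2 : m' 2 = m 2)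
    (h3 : m' 3 = m 3) (h4 : m' 4 = m 4) : Params m' n r s :=
  ⟨by rw [h2, h.n], by rw [h3, h.r], by rw [h4, h.s]⟩

/-- Read the parameters. -/
def paramsP : Prog :=
  .seq (setv 2 (.read 0 (.const 0))) (.seq (setv 3 (.read 0 (.const 1)))
    (.seq (setv 4 (.const 0))
      (forP 20 (V 3) (.branch (.monus (.read 0 (.add (.const 2) (V 20))) (V 4))
        (setv 4 (.read 0 (.add (.const 2) (V 20)))) .skip))))

theorem paramsP_runs {m₀ : Memory} {n r : ℕ} {len : ℕ → ℕ} {b : ℕ → ℕ → Equiv.Perm (Fin n)}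
    (h : Input m₀ n r len b) :
    ∃ m', Runs paramsP m₀ m' (r * 300 + 300) ∧ Params m' n r ((Finset.range r).sup len) := by
  set m₁ := ((m₀.set 2 0 n).set 3 0 r).set 4 0 0 with hm₁
  have e2 : m₁ 2 0 = n := by simp [hm₁, Memory.set]
  have e3 : m₁ 3 0 = r := by simp [hm₁, Memory.set]
  have e4 : m₁ 4 0 = 0 := by simp [hm₁, Memory.set]
  have e0 : m₁ 0 = m₀ 0 := by
    rw [hm₁, Memory.set_bank _ _ _ (by decide), Memory.set_bank _ _ _ (by decide),
      Memory.set_bank _ _ _ (by decide)]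
  obtain ⟨m', h', hI⟩ := forP_runs (c := 20) (N := V 3) (body := .branch
      (.monus (.read 0 (.add (.const 2) (V 20))) (V 4))
        (setv 4 (.read 0 (.add (.const 2) (V 20)))) .skip) (m₀ := m₁) r 100
    (fun k m => m 4 0 = (Finset.range k).sup len) rfl (by decide)
    (fun m hm => by rw [eval_V, hm 3 rfl (by decide), e3])
    (fun k m v h => by rwa [Memory.set_bank _ _ _ (by decide)])
    (by
      intro k hk m hm hc hI
      have hlen : m 0 (2 + k) = len k := by rw [hm 0 rfl (by decide), e0, h.length k hk]
      rw [Finset.range_add_one, Finset.sup_insert]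
      by_cases hlt : (Finset.range k).sup len < len k
      · refine ⟨_, (Runs.branch_true ?_ (Runs.setv m (x := len k) ?_ le_rfl)).mono (by decide), ?_⟩
        · simp only [Expr.eval, hc, hlen, hI]; omega
        · simp only [Expr.eval, hc, hlen]
        · rw [Memory.set_same]; exact (sup_eq_left.2 hlt.le).symm
      · refine ⟨_, (Runs.branch_false ?_ (Runs.skip m)).mono (by decide), ?_⟩
        · simp only [Expr.eval, hc, hlen, hI]; omega
        · rw [hI]; exact (sup_eq_right.2 (not_lt.1 hlt)).symm)
    e4
  refine ⟨m', ((Runs.setv m₀ (x := n) ?_ le_rfl).seq ((Runs.setv _ (x := r) ?_ le_rfl).seq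
    ((Runs.setv _ (x := 0) rfl le_rfl).seq h'))).mono ?_, ?_, ?_, hI⟩
  · simp only [Expr.eval, h.points]
  · simp only [Expr.eval]
    rw [Memory.set_bank _ _ _ (by decide), h.factors]
  · simp only [Expr.cost]; omega
  · rw [h'.frame 2 rfl, e2]
  · rw [h'.frame 3 rfl, e3]

/-- Load the lists of generators, extended periodically to the same length; the empty list is
replaced by the list of one identity element. -/
def loadP : Prog :=
  .seq (setv 16 (.const 0)) (.seq (setv 17 (.add (.const 2) (V 3)))
    (forP 20 (V 3) (.seq (setv 18 (.read 0 (.add (.const 2) (V 20))))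
      (.seq (.branch (V 18)
          (.seq (mulP 19 21 (V 18) (V 2)) (.seq (copyP 21 6 (V 16) 0 (V 17) (V 19))
            (setv 17 (.add (V 17) (V 19)))))
          (.seq (forP 21 (V 2) (.write 6 (.add (V 16) (V 21)) (V 21))) (setv 19 (V 2))))
        (.seq (extendP 21 6 (V 16) (V 19) (V 5)) (setv 16 (.add (V 16) (V 5))))))))

theorem mod_mul_div (a l n : ℕ) : a % (l * n) / n = a / n % l := by
  rw [mul_comm]; exact Nat.mod_mul_right_div_self a n l

theorem identityP_runs {m₀ : Memory} {n D : ℕ} (h2 : m₀ 2 0 = n) (hD : m₀ 16 0 = D) :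
    ∃ m', Runs (forP 21 (V 2) (.write 6 (.add (V 16) (V 21)) (V 21))) m₀ m' (n * 300 + 200) ∧
      (∀ a < n, m' 6 (D + a) = a) ∧ ∀ j < D, m' 6 j = m₀ 6 j := by
  obtain ⟨m', h', hI⟩ := forP_runs (c := 21) (N := V 2)
    (body := .write 6 (.add (V 16) (V 21)) (V 21)) (m₀ := m₀) n 100
    (fun k m => (∀ a < k, m 6 (D + a) = a) ∧ ∀ j < D, m 6 j = m₀ 6 j) rfl (by decide)
    (fun m hm => by rw [eval_V, hm 2 rfl (by decide), h2])
    (fun k m v h => by rwa [Memory.set_bank _ _ _ (by decide)])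
    (by
      rintro k hk m hm hc ⟨h3, h4⟩
      refine ⟨_, Runs.write (j := D + k) (x := k) m ?_ ?_ (by decide), ?_, ?_⟩
      · simp only [Expr.eval, hc, hm 16 rfl (by decide), hD]
      · simp only [Expr.eval, hc]
      · intro a ha
        by_cases hak : a = k
        · rw [hak, Memory.set_same]
        · rw [Memory.set_addr _ _ _ _ (by omega), h3 a (by omega)]
      · intro j hj
        rw [Memory.set_addr _ _ _ _ (by omega), h4 j hj])
    ⟨by simp, by simp⟩
  exact ⟨m', h', hI⟩

/-- Banks `16` and `17` hold the next writing position in bank `6` and the next reading position in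
the input. Each list fills exactly `s * n` cells, so the block of a vertex can be found by division.
-/
theorem loadP_runs {m₀ : Memory} {n r s Z : ℕ} {len : ℕ → ℕ} {b : ℕ → ℕ → Equiv.Perm (Fin n)}
    (h : Input m₀ n r len b) (hp : Params m₀ n r s) (h5 : m₀ 5 0 = s * n) (hs : 0 < s)
    (hlen : ∀ i < r, len i ≤ s) (hb : ∀ i < r, len i = 0 → b i 0 = 1) (hn : n ≤ Z) (hsZ : s ≤ Z)
    (hsn : s * n ≤ Z) :
    ∃ m', Runs loadP m₀ m' (r * (3000 * (Z + 1)) + 300) ∧ ∀ a < r * s * n,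
      m' 6 a = flat n (fun v => b (v / s) ((v % s) % max 1 (len (v / s)))) a := by
  set m₁ := (m₀.set 16 0 0).set 17 0 (2 + r) with hm₁
  have e16 : m₁ 16 0 = 0 := by simp [hm₁, Memory.set]
  have e17 : m₁ 17 0 = 2 + r := by simp [hm₁, Memory.set]
  have eb : ∀ b, b ≠ 16 → b ≠ 17 → m₁ b = m₀ b := by
    intro b h16 h17
    rw [hm₁, Memory.set_bank _ _ _ h17, Memory.set_bank _ _ _ h16]
  set f : ℕ → ℕ := flat n (fun v => b (v / s) ((v % s) % max 1 (len (v / s)))) with hf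
  have hfb : ∀ i, ∀ a < s * n, f (i * (s * n) + a) = flat n (b i) (a % (max 1 (len i) * n)) := by
    intro i a ha
    have hn : 0 < n := Nat.pos_of_ne_zero (by rintro rfl; simp at ha)
    have h1 : (i * (s * n) + a) / n = i * s + a / n := by
      rw [← mul_assoc, mul_comm, Nat.mul_add_div hn]
    have h2 : a / n < s := Nat.div_lt_of_lt_mul (by rwa [mul_comm])
    refine flat_congr ?_ ?_
    · rw [h1, mod_mul_div, mul_comm i s, Nat.mul_add_div hs, Nat.div_eq_of_lt h2, add_zero,
        Nat.mul_add_mod, Nat.mod_eq_of_lt h2]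
    · rw [← mul_assoc, mul_comm, Nat.mul_add_mod, mul_comm, Nat.mod_mul_right_mod]
  obtain ⟨m', h', hI⟩ := forP_runs (c := 20) (N := V 3) (body := .seq
      (setv 18 (.read 0 (.add (.const 2) (V 20))))
      (.seq (.branch (V 18)
          (.seq (mulP 19 21 (V 18) (V 2)) (.seq (copyP 21 6 (V 16) 0 (V 17) (V 19))
            (setv 17 (.add (V 17) (V 19)))))
          (.seq (forP 21 (V 2) (.write 6 (.add (V 16) (V 21)) (V 21))) (setv 19 (V 2))))
        (.seq (extendP 21 6 (V 16) (V 19) (V 5)) (setv 16 (.add (V 16) (V 5)))))) (m₀ := m₁)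
    r (2000 * (Z + 1))
    (fun k m => m 16 0 = k * (s * n) ∧ m 17 0 = 2 + r + ∑ j ∈ Finset.range k, len j * n ∧
      ∀ a < k * (s * n), m 6 a = f a) rfl (by decide)
    (fun m hm => by rw [eval_V, hm 3 rfl (by decide), eb 3 (by decide) (by decide), hp.r])
    (fun k m v h => by
      rwa [Memory.set_bank _ _ _ (by decide), Memory.set_bank _ _ _ (by decide),
        Memory.set_bank _ _ _ (by decide)])
    (by
      rintro k hk m hm hc ⟨h16, h17, h6⟩
      have f2 : m 2 0 = n := by
        rw [hm 2 rfl (by decide), eb 2 (by decide) (by decide), hp.n]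
      have f5 : m 5 0 = s * n := by
        rw [hm 5 rfl (by decide), eb 5 (by decide) (by decide), h5]
      have f0 : m 0 = m₀ 0 := by
        rw [hm 0 rfl (by decide), eb 0 (by decide) (by decide)]
      have hl := hlen k hk
      have r1 : Runs (setv 18 (.read 0 (.add (.const 2) (V 20)))) m (m.set 18 0 (len k)) 10 :=
        Runs.setv m (by simp only [Expr.eval, hc, f0, h.length k hk]) (by decide)
      set ma := m.set 18 0 (len k) with hma
      have ea : ∀ b, b ≠ 18 → ma b = m b := fun b hb => Memory.set_bank _ _ _ hb
      have e18 : ma 18 0 = len k := Memory.set_same _ _ _ _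
      have r2 : ∃ mb, Runs (.branch (V 18)
          (.seq (mulP 19 21 (V 18) (V 2)) (.seq (copyP 21 6 (V 16) 0 (V 17) (V 19))
            (setv 17 (.add (V 17) (V 19)))))
          (.seq (forP 21 (V 2) (.write 6 (.add (V 16) (V 21)) (V 21))) (setv 19 (V 2)))) ma mb
          (1000 * (Z + 1) + 100) ∧ mb 19 0 = max 1 (len k) * n ∧
          mb 17 0 = 2 + r + ∑ j ∈ Finset.range (k + 1), len j * n ∧
          (∀ a < max 1 (len k) * n, mb 6 (k * (s * n) + a) = flat n (b k) a) ∧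
          ∀ j < k * (s * n), mb 6 j = m 6 j := by
        -- An empty list is loaded as one identity permutation. This accounts for the `max 1 (len
        -- k)` in the period.
        rcases Nat.eq_zero_or_pos (len k) with h0 | h0
        · obtain ⟨mc, rc, hc1, hc2⟩ := identityP_runs (m₀ := ma) (n := n) (D := k * (s * n))
            (by rw [ea 2 (by decide), f2]) (by rw [ea 16 (by decide), h16])
          refine ⟨_, (Runs.branch_false (by rw [eval_V, e18, h0])
            (rc.seq (Runs.setv mc (x := n) ?_ le_rfl))).mono ?_, ?_, ?_, ?_, ?_⟩
          · rw [eval_V, rc.frame 2 rfl, ea 2 (by decide), f2]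
          · simp only [Expr.cost]; omega
          · rw [Memory.set_same, h0]; simp
          · rw [Memory.set_bank _ _ _ (by decide), rc.frame 17 rfl, ea 17 (by decide), h17,
              Finset.sum_range_succ, h0, zero_mul, add_zero]
          · intro a ha
            rw [h0] at ha
            replace ha : a < n := by simpa using ha
            rw [Memory.set_bank _ _ _ (by decide), hc1 a ha]
            have := flat_mul_add (b k) 0 ⟨a, ha⟩
            rw [hb k hk h0] at this
            simpa using this.symm
          · intro j hj
            rw [Memory.set_bank _ _ _ (by decide), hc2 j hj, ea 6 (by decide)]
        · have hmax : max 1 (len k) = len k := max_eq_right h0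
          have hln : len k * n ≤ Z := (Nat.mul_le_mul_right n hl).trans hsn
          obtain ⟨mc, rc, hc1⟩ := mulP_runs (d := 19) (c := 21) (x := V 18) (y := V 2) (m₀ := ma)
            (len k) n (by decide)
            (fun m' hm' => by rw [eval_V, hm' 18 (by decide) (by decide), e18])
            (fun m' hm' => by rw [eval_V, hm' 2 (by decide) (by decide), ea 2 (by decide), f2])
            (by decide) (by decide)
          obtain ⟨md, rd, hd1, hd2⟩ := copyP_runs (c := 21) (dst := 6) (src := 0) (dpos := V 16)
            (spos := V 17) (len := V 19) (m₀ := mc) (k * (s * n))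
            (2 + r + ∑ j ∈ Finset.range k, len j * n) (len k * n) (by decide) (by decide)
            (by decide)
            (fun m' hm' => by rw [eval_V, hm' 16 (by decide) (by decide), rc.frame 16 rfl,
              ea 16 (by decide), h16])
            (fun m' hm' => by rw [eval_V, hm' 17 (by decide) (by decide), rc.frame 17 rfl,
              ea 17 (by decide), h17])
            (fun m' hm' => by rw [eval_V, hm' 19 (by decide) (by decide), hc1])
            (by decide) (by decide) (by decide)
          refine ⟨_, (Runs.branch_true (by rw [eval_V, e18]; omega) (rc.seq (rd.seq
            (Runs.setv md (x := 2 + r + ∑ j ∈ Finset.range (k + 1), len j * n) ?_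
            le_rfl)))).mono ?_, ?_, ?_, ?_, ?_⟩
          · simp only [Expr.eval]
            rw [rd.frame 17 rfl, rd.frame 19 rfl, rc.frame 17 rfl, ea 17 (by decide), h17, hc1,
              Finset.sum_range_succ]
            omega
          · simp only [Expr.cost]; omega
          · rw [Memory.set_bank _ _ _ (by decide), rd.frame 19 rfl, hc1, hmax]
          · rw [Memory.set_same]
          · intro a ha
            rw [hmax] at ha
            rw [Memory.set_bank _ _ _ (by decide), hd1 a ha, rc.frame 0 rfl, ea 0 (by decide), f0,
              h.entry k hk a ha]
          · intro j hj
            rw [Memory.set_bank _ _ _ (by decide), hd2 j (Or.inl hj), rc.frame 6 rfl,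
              ea 6 (by decide)]
      obtain ⟨mb, rb, hb19, hb17, hb6, hb6'⟩ := r2
      obtain ⟨me, re, he1, he2⟩ := extendP_runs (c := 21) (b := 6) (pos := V 16) (len := V 19)
        (tot := V 5) (m₀ := mb) (k * (s * n)) (max 1 (len k) * n) (s * n) (flat n (b k))
        (by decide) (fun h => Nat.mul_pos (by simp) (Nat.pos_of_mul_pos_left h))
        (Nat.mul_le_mul_right n (max_le hs hl))
        (fun m' hm' => by rw [eval_V, hm' 16 (by decide) (by decide), rb.frame 16 rfl,
          ea 16 (by decide), h16])
        (fun m' hm' => by rw [eval_V, hm' 19 (by decide) (by decide), hb19])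
        (fun m' hm' => by rw [eval_V, hm' 5 (by decide) (by decide), rb.frame 5 rfl,
          ea 5 (by decide), f5])
        (by decide) (by decide) (by decide) hb6
      refine ⟨_, (r1.seq (rb.seq (re.seq (Runs.setv me (x := (k + 1) * (s * n)) ?_
        le_rfl)))).mono ?_, ?_, ?_, ?_⟩
      · simp only [Expr.eval]
        rw [re.frame 16 rfl, re.frame 5 rfl, rb.frame 16 rfl, rb.frame 5 rfl, ea 16 (by decide),
          ea 5 (by decide), h16, f5, add_mul, one_mul]
      · simp only [Expr.cost]; omega
      · rw [Memory.set_same]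
      · rw [Memory.set_bank _ _ _ (by decide), re.frame 17 rfl, hb17]
      · intro a ha
        rw [Memory.set_bank _ _ _ (by decide)]
        rcases Nat.lt_or_ge a (k * (s * n)) with hak | hak
        · rw [he2 a hak, hb6' a hak, h6 a hak]
        · obtain ⟨a, rfl⟩ := Nat.exists_eq_add_of_le hak
          rw [add_mul, one_mul] at ha
          rw [he1 a (by omega), hfb k a (by omega)])
    ⟨by rw [e16, zero_mul], by rw [e17]; simp, by simp⟩
  refine ⟨m', ((Runs.setv m₀ (x := 0) rfl le_rfl).seq ((Runs.setv _ (x := 2 + r) ?_ le_rfl).seq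
    h')).mono ?_, fun a ha => hI.2.2 a (by rwa [← mul_assoc])⟩
  · simp only [Expr.eval]
    rw [Memory.set_bank _ _ _ (by decide), hp.r]
  · simp only [Expr.cost]
    have : r * (2000 * (Z + 1) + 200) ≤ r * (3000 * (Z + 1)) := Nat.mul_le_mul_left _ (by omega)
    omega

end RAM

/-! ### The Gabber–Galil expanders -/

set_option linter.unusedSectionVars false

namespace GabberGalil

open Finset

variable {K : ℕ} [NeZero K]

/-- The discrete Fourier transform on `(ZMod K)²`. -/
noncomputable def hat (f : ZMod K × ZMod K → ℂ) (z : ZMod K × ZMod K) : ℂ :=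
  ∑ v : ZMod K × ZMod K, ZMod.stdAddChar (z.1 * v.1 + z.2 * v.2) * f v

/-! ### Fourier analysis on the discrete torus -/

theorem sum_stdAddChar_mul (v : ZMod K × ZMod K) :
    ∑ z : ZMod K × ZMod K, (ZMod.stdAddChar (z.1 * v.1 + z.2 * v.2) : ℂ) =
      if v = 0 then (K : ℂ) ^ 2 else 0 := by
  have h := fun b : ZMod K => AddChar.sum_mulShift b (ZMod.isPrimitive_stdAddChar K)
  simp only [Fintype.sum_prod_type, AddChar.map_add_eq_mul, ← Finset.mul_sum, ← Finset.sum_mul, h]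
  rcases v with ⟨a, b⟩
  by_cases ha : a = 0 <;> by_cases hb : b = 0 <;> simp [ha, hb, ZMod.card, sq]

theorem norm_stdAddChar (z : ZMod K) : ‖(ZMod.stdAddChar z : ℂ)‖ = 1 := by
  rw [ZMod.stdAddChar_apply]; exact Circle.norm_coe _

theorem star_stdAddChar (z : ZMod K) :
    (starRingEnd ℂ) (ZMod.stdAddChar z : ℂ) = ZMod.stdAddChar (-z) := by
  rw [AddChar.map_neg_eq_inv, Complex.inv_def, Complex.normSq_eq_norm_sq, norm_stdAddChar]
  simp

/-- Parseval: expand the square and use the orthogonality of the characters. -/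
theorem sum_norm_hat_sq (f : ZMod K × ZMod K → ℂ) :
    ∑ z, ‖hat f z‖ ^ 2 = (K : ℝ) ^ 2 * ∑ v, ‖f v‖ ^ 2 := by
  have key : ∀ z : ZMod K × ZMod K, ((‖hat f z‖ ^ 2 : ℝ) : ℂ) =
      ∑ v : ZMod K × ZMod K, ∑ w : ZMod K × ZMod K,
        ZMod.stdAddChar (z.1 * (v - w).1 + z.2 * (v - w).2) * (f v * (starRingEnd ℂ) (f w)) := by
    intro z
    push_cast
    rw [← Complex.mul_conj', hat, map_sum, Finset.sum_mul_sum]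
    refine Finset.sum_congr rfl fun v _ => Finset.sum_congr rfl fun w _ => ?_
    rw [map_mul, star_stdAddChar]
    have : z.1 * (v - w).1 + z.2 * (v - w).2 =
      (z.1 * v.1 + z.2 * v.2) + -(z.1 * w.1 + z.2 * w.2) := by
      simp only [Prod.fst_sub, Prod.snd_sub]; ring
    rw [this, AddChar.map_add_eq_mul (ZMod.stdAddChar) _ (-_)]
    ring
  have : ((∑ z, ‖hat f z‖ ^ 2 : ℝ) : ℂ) = ((K : ℝ) ^ 2 * ∑ v, ‖f v‖ ^ 2 : ℝ) := by
    rw [Complex.ofReal_sum]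
    simp_rw [key]
    rw [Finset.sum_comm]
    push_cast
    rw [Finset.mul_sum]
    refine Finset.sum_congr rfl fun v _ => ?_
    rw [Finset.sum_comm]
    simp_rw [← Finset.sum_mul, sum_stdAddChar_mul, sub_eq_zero]
    simp [Complex.mul_conj']
  exact_mod_cast this

/-- The factor by which a frequency is damped by averaging over a unit shift. -/
noncomputable def damp (z : ZMod K) : ℝ := ‖1 + (ZMod.stdAddChar z : ℂ)‖

theorem damp_nonneg (z : ZMod K) : 0 ≤ damp z := norm_nonneg _

theorem damp_neg (z : ZMod K) : damp (-z) = damp z := by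
  rw [damp, damp, ← star_stdAddChar, ← Complex.norm_conj]
  simp

theorem damp_le_two (z : ZMod K) : damp z ≤ 2 := by
  refine (norm_add_le _ _).trans ?_
  rw [norm_stdAddChar]; norm_num

/-- The distance of a residue to zero. -/
def height (z : ZMod K) : ℕ := z.valMinAbs.natAbs

theorem two_mul_height_le (z : ZMod K) : 2 * height z ≤ K := by
  have := ZMod.natAbs_valMinAbs_le z
  unfold height; omega

theorem height_neg (z : ZMod K) : height (-z) = height z := ZMod.natAbs_valMinAbs_neg z

theorem height_eq_zero {z : ZMod K} : height z = 0 ↔ z = 0 := by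
  simp [height, ZMod.valMinAbs_eq_zero]

theorem damp_sq (z : ZMod K) : damp z ^ 2 = 2 + 2 * Real.cos (2 * Real.pi * height z / K) := by
  have h : Real.cos (2 * Real.pi * height z / K) = Real.cos (2 * Real.pi * z.valMinAbs / K) := by
    have : ((height z : ℕ) : ℝ) = |(z.valMinAbs : ℝ)| := by
      rw [height, Nat.cast_natAbs, Int.cast_abs]
    rw [this]
    rcases abs_choice (z.valMinAbs : ℝ) with h | h <;> rw [h]
    rw [← Real.cos_neg]; congr 1; ring
  rw [h, damp]
  conv_lhs => rw [← ZMod.coe_valMinAbs z]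
  rw [ZMod.stdAddChar_coe, ← Complex.normSq_eq_norm_sq]
  have : (2 * Real.pi * Complex.I * (z.valMinAbs : ℤ) / K : ℂ) =
      ((2 * Real.pi * z.valMinAbs / K : ℝ) : ℂ) * Complex.I := by
    push_cast; ring
  rw [this, Complex.exp_mul_I, ← Complex.ofReal_cos, ← Complex.ofReal_sin, Complex.normSq_apply]
  simp only [Complex.add_re, Complex.one_re, Complex.ofReal_re, Complex.mul_re, Complex.I_re,
    mul_zero, Complex.ofReal_im, Complex.I_im, mul_one, sub_self, add_zero, Complex.add_im,
    Complex.one_im, Complex.mul_im, zero_add]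
  nlinarith [Real.sin_sq_add_cos_sq (2 * Real.pi * z.valMinAbs / K)]

/-- The hypothesis puts the two angles on opposite sides of a right angle in total: the cosine at
`a` is at most minus the cosine at `b`. By `damp_sq` the squares then sum to at most `4`, so the sum
is at most `2√2 < 73/25`. -/
theorem damp_add_le {a b : ZMod K} (h : K ≤ 2 * (height a + height b)) :
    damp a + damp b ≤ 73 / 25 := by
  have hK : (0 : ℝ) < K := by exact_mod_cast Nat.pos_of_ne_zero (NeZero.ne K)
  have ha : (2 * height a : ℝ) ≤ K := by exact_mod_cast two_mul_height_le a
  have hb : (2 * height b : ℝ) ≤ K := by exact_mod_cast two_mul_height_le b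
  have h' : (K : ℝ) ≤ 2 * (height a + height b) := by exact_mod_cast h
  have hpi := Real.pi_pos
  have hle : ∀ {u : ℝ}, u ≤ K → Real.pi * u / K ≤ Real.pi := by
    intro u hu
    rw [div_le_iff₀ hK]; nlinarith
  have hcos : Real.cos (2 * Real.pi * height a / K) ≤
      -Real.cos (2 * Real.pi * height b / K) := by
    rw [← Real.cos_pi_sub]
    have e : ∀ u : ℝ, 2 * Real.pi * u / K = Real.pi * (2 * u) / K := by intro u; ring
    apply Real.cos_le_cos_of_nonneg_of_le_pi
    · rw [e]; linarith [hle hb]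
    · rw [e]; exact hle ha
    · rw [sub_le_iff_le_add, ← add_div, le_div_iff₀ hK]; nlinarith
  nlinarith [damp_sq a, damp_sq b, sq_nonneg (damp a - damp b), damp_nonneg a, damp_nonneg b]

/-- The weights of the Schur test. -/
noncomputable def weight (p q : ℕ) : ℝ := if q < p then 5 / 4 else if p < q then 4 / 5 else 1

theorem weight_pos (p q : ℕ) : 0 < weight p q := by unfold weight; split_ifs <;> norm_num

theorem weight_le (p q : ℕ) : weight p q ≤ 5 / 4 := by unfold weight; split_ifs <;> norm_num

theorem weight_mul (p q : ℕ) : weight p q * weight q p = 1 := by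
  unfold weight
  rcases lt_trichotomy p q with h | h | h
  · simp [h, h.not_gt]
  · simp [h]
  · simp [h, h.not_gt]

/-! ### The effect of shears on heights -/

/-- Any other integer congruent to `t` modulo `K` has absolute value at least `K - |t| > c`, so no
representative is close to zero. -/
theorem lt_height {t : ℤ} {c : ℕ} (h₁ : c < t.natAbs) (h₂ : t.natAbs + c < K) :
    c < height (t : ZMod K) := by
  have h := ZMod.coe_valMinAbs (t : ZMod K)
  rw [ZMod.intCast_eq_intCast_iff_dvd_sub] at h
  obtain ⟨j, hj⟩ := h
  unfold height
  rcases lt_trichotomy j 0 with h0 | h0 | h0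
  · have : (K : ℤ) * j ≤ -K := by nlinarith
    omega
  · subst h0; simp at hj; omega
  · have : (K : ℤ) ≤ K * j := by nlinarith
    omega

/-- The two weights at `b` of the shear by `2 a`. -/
noncomputable def shearWeight (a b : ZMod K) : ℝ :=
  weight (height b) (height (b - 2 * a)) + weight (height b) (height (b + 2 * a))

theorem shearWeight_nonneg (a b : ZMod K) : 0 ≤ shearWeight a b :=
  (add_pos (weight_pos _ _) (weight_pos _ _)).le

theorem shearWeight_le (a b : ZMod K) : shearWeight a b ≤ 5 / 2 := by
  have := weight_le (height b) (height (b - 2 * a))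
  have := weight_le (height b) (height (b + 2 * a))
  unfold shearWeight; linarith

theorem weight_of_lt {p q : ℕ} (h : p < q) : weight p q = 4 / 5 := by
  simp [weight, h, h.not_gt]

theorem shear_cases (a b : ZMod K) :
    ∃ s t : ℤ, a = s ∧ b = t ∧ s.natAbs = height a ∧ t.natAbs = height b ∧
      (b - 2 * a : ZMod K) = (t - 2 * s : ℤ) ∧ (b + 2 * a : ZMod K) = (t + 2 * s : ℤ) :=
  ⟨a.valMinAbs, b.valMinAbs, by simp, by simp, rfl, rfl, by push_cast; simp, by push_cast; simp⟩

/-- Both `t - 2s` and `t + 2s` have absolute value at least `2|s| - |t| > |t|`, and the hypothesis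
`h` excludes wrapping around. Both weights are therefore `4/5`. -/
theorem shearWeight_of_height_lt {a b : ZMod K} (h : 2 * (height a + height b) < K)
    (hab : height b < height a) : shearWeight a b = 8 / 5 := by
  obtain ⟨s, t, -, -, hs, ht, h₁, h₂⟩ := shear_cases a b
  unfold shearWeight
  rw [h₁, h₂, weight_of_lt (lt_height _ _), weight_of_lt (lt_height _ _)]
  · norm_num
  all_goals omega

/-- For one of the two signs the absolute values of `t` and `2s` add up, so that shear raises the
height and has weight `4/5`. The other weight is at most `5/4`. -/
theorem shearWeight_le_of_ne_zero {a b : ZMod K} (h : 2 * (height a + height b) < K)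
    (ha : a ≠ 0) : shearWeight a b ≤ 41 / 20 := by
  obtain ⟨s, t, -, -, hs, ht, h₁, h₂⟩ := shear_cases a b
  have ha' : height a ≠ 0 := fun h => ha (height_eq_zero.1 h)
  unfold shearWeight
  have h3 := weight_le (height b) (height (b - 2 * a))
  have h4 := weight_le (height b) (height (b + 2 * a))
  by_cases hst : 0 ≤ s * t
  · have : (t + 2 * s).natAbs = t.natAbs + 2 * s.natAbs := by
      rcases le_or_gt 0 s with h5 | h5 <;> rcases le_or_gt 0 t with h6 | h6
      · omega
      · have : s = 0 := by nlinarith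
        omega
      · have : t = 0 := by nlinarith
        omega
      · omega
    rw [h₂, weight_of_lt (lt_height _ _)]
    · linarith
    all_goals omega
  · have : (t - 2 * s).natAbs = t.natAbs + 2 * s.natAbs := by
      rcases le_or_gt 0 s with h5 | h5 <;> rcases le_or_gt 0 t with h6 | h6
      · exact absurd (mul_nonneg h5 h6) hst
      · omega
      · omega
      · exact absurd (mul_nonneg_of_nonpos_of_nonpos h5.le h6.le) hst
    rw [h₁, weight_of_lt (lt_height _ _)]
    · linarith
    all_goals omega

/-- Here `b = a` or `b = -a`. One shear sends `b` to `-b`, with weight `1`, and the other triples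
`|t|`, with weight `4/5`. -/
theorem shearWeight_le_of_height_eq {a b : ZMod K} (h : 2 * (height a + height b) < K)
    (hab : height a = height b) (ha : a ≠ 0) : shearWeight a b ≤ 9 / 5 := by
  obtain ⟨s, t, hsa, htb, hs, ht, h₁, h₂⟩ := shear_cases a b
  have ha' : height a ≠ 0 := fun h => ha (height_eq_zero.1 h)
  have hself : ∀ p, weight p p = 1 := by intro p; simp [weight]
  unfold shearWeight
  rcases Int.natAbs_eq_natAbs_iff.1 (show s.natAbs = t.natAbs by omega) with h5 | h5
  · have : b - 2 * a = -b := by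
      rw [hsa, htb, h5]; ring
    rw [this, height_neg, hself, h₂, weight_of_lt (lt_height _ _)]
    · norm_num
    all_goals omega
  · have : b + 2 * a = -b := by
      rw [hsa, htb, h5]; push_cast; ring
    rw [this, height_neg, hself, h₁, weight_of_lt (lt_height _ _)]
    · norm_num
    all_goals omega

theorem shearWeight_zero_left (b : ZMod K) : shearWeight 0 b = 2 := by
  simp [shearWeight, weight]; norm_num

/-- The row bound of the Schur test. Far from the origin the dampings are small together, and `5/2 *
73/25 = 73/10`. Near the origin the damping is only bounded by `2`, but there most shears raise
heights and the weights are small. -/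
theorem damp_mul_shearWeight_le {a b : ZMod K} (h : a ≠ 0 ∨ b ≠ 0) :
    damp a * shearWeight a b + damp b * shearWeight b a ≤ 73 / 10 := by
  have h1 := shearWeight_le a b
  have h2 := shearWeight_le b a
  have h3 := shearWeight_nonneg a b
  have h4 := shearWeight_nonneg b a
  have h5 := damp_nonneg a
  have h6 := damp_nonneg b
  have h7 := damp_le_two a
  have h8 := damp_le_two b
  by_cases hK : K ≤ 2 * (height a + height b)
  · have := damp_add_le hK
    nlinarith
  push Not at hK
  have hK' : 2 * (height b + height a) < K := by omega
  -- The extremal case is that of unequal nonzero heights, with `8/5 + 41/20 = 73/20`.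
  suffices shearWeight a b + shearWeight b a ≤ 73 / 20 by nlinarith
  rcases lt_trichotomy (height a) (height b) with hab | hab | hab
  · rw [shearWeight_of_height_lt hK' hab]
    by_cases ha : a = 0
    · rw [ha, shearWeight_zero_left]; norm_num
    · linarith [shearWeight_le_of_ne_zero hK ha]
  · have ha : a ≠ 0 := by
      rintro rfl
      rcases h with h | h
      · exact h rfl
      · exact h (height_eq_zero.1 (by rw [← hab]; simp [height]))
    have hb : b ≠ 0 := by
      rintro rfl
      exact ha (height_eq_zero.1 (by rw [hab]; simp [height]))
    linarith [shearWeight_le_of_height_eq hK hab ha, shearWeight_le_of_height_eq hK' hab.symm hb]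
  · rw [shearWeight_of_height_lt hK hab]
    by_cases hb : b = 0
    · rw [hb, shearWeight_zero_left]; norm_num
    · linarith [shearWeight_le_of_ne_zero hK' hb]

/-- The eight neighbours of a vertex. -/
def nbr (v : ZMod K × ZMod K) : Fin 8 → ZMod K × ZMod K :=
  ![(v.1 + 2 * v.2, v.2), (v.1 + 2 * v.2 + 1, v.2), (v.1 - 2 * v.2, v.2),
    (v.1 - 2 * v.2 - 1, v.2), (v.1, v.2 + 2 * v.1), (v.1, v.2 + 2 * v.1 + 1),
    (v.1, v.2 - 2 * v.1), (v.1, v.2 - 2 * v.1 - 1)]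

/-- The adjacency operator of the Gabber–Galil graph. -/
noncomputable def adj (f : ZMod K × ZMod K → ℂ) (v : ZMod K × ZMod K) : ℂ := ∑ c, f (nbr v c)

/-- The shear of slope `s` in the first coordinate, followed by a translation. -/
def shearEquiv (s c : ZMod K) : ZMod K × ZMod K ≃ ZMod K × ZMod K where
  toFun v := (v.1 + s * v.2 + c, v.2)
  invFun v := (v.1 - s * v.2 - c, v.2)
  left_inv v := by ext <;> simp <;> ring
  right_inv v := by ext <;> simp <;> ring

/-! ### The adjacency operator on the Fourier side -/

theorem hat_shear (f : ZMod K × ZMod K → ℂ) (s c : ZMod K) (z : ZMod K × ZMod K) :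
    hat (fun v => f (v.1 + s * v.2 + c, v.2)) z =
      ZMod.stdAddChar (-(z.1 * c)) * hat f (z.1, z.2 - s * z.1) := by
  unfold hat
  rw [← Equiv.sum_comp (shearEquiv s c) fun v => ZMod.stdAddChar (z.1 * v.1 +
    (z.2 - s * z.1) * v.2) * f v, Finset.mul_sum]
  refine Finset.sum_congr rfl fun v _ => ?_
  rw [← mul_assoc, ← AddChar.map_add_eq_mul]
  simp only [shearEquiv, Equiv.coe_fn_mk]
  congr 2; ring

theorem hat_swap (f : ZMod K × ZMod K → ℂ) (z : ZMod K × ZMod K) :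
    hat (fun v => f v.swap) z = hat f z.swap := by
  unfold hat
  rw [← Equiv.sum_comp (Equiv.prodComm _ _)]
  refine Finset.sum_congr rfl fun v _ => ?_
  simp [add_comm]

theorem hat_add (f g : ZMod K × ZMod K → ℂ) (z : ZMod K × ZMod K) :
    hat (fun v => f v + g v) z = hat f z + hat g z := by
  simp [hat, mul_add, Finset.sum_add_distrib]

/-- A shear and its translate by one have the same transform up to a phase, so their sum carries the
factor `|1 + χ|`, which is `damp` of the frequency. -/
theorem norm_hat_half_adj (f : ZMod K × ZMod K → ℂ) (z : ZMod K × ZMod K) :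
    ‖hat (fun v => (f (v.1 + 2 * v.2, v.2) + f (v.1 + 2 * v.2 + 1, v.2)) +
      (f (v.1 - 2 * v.2, v.2) + f (v.1 - 2 * v.2 - 1, v.2))) z‖ ≤
      damp z.1 * (‖hat f (z.1, z.2 - 2 * z.1)‖ + ‖hat f (z.1, z.2 + 2 * z.1)‖) := by
  have h1 := hat_shear f 2 0 z
  have h2 := hat_shear f 2 1 z
  have h3 := hat_shear f (-2) 0 z
  have h4 := hat_shear f (-2) (-1) z
  simp only [neg_mul, ← sub_eq_add_neg, sub_neg_eq_add, mul_zero, neg_zero, add_zero, mul_one,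
    mul_neg, neg_neg, AddChar.map_zero_eq_one, one_mul] at h1 h2 h3 h4
  rw [hat_add, hat_add, hat_add, h1, h2, h3, h4, mul_add]
  refine (norm_add_le _ _).trans (add_le_add ?_ ?_)
  · rw [← one_add_mul, norm_mul, ← damp_neg]; rfl
  · rw [← one_add_mul, norm_mul]; rfl

theorem norm_hat_adj (f : ZMod K × ZMod K → ℂ) (z : ZMod K × ZMod K) :
    ‖hat (adj f) z‖ ≤
      damp z.1 * (‖hat f (z.1, z.2 - 2 * z.1)‖ + ‖hat f (z.1, z.2 + 2 * z.1)‖) +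
      damp z.2 * (‖hat f (z.1 - 2 * z.2, z.2)‖ + ‖hat f (z.1 + 2 * z.2, z.2)‖) := by
  have h := norm_hat_half_adj (fun v => f v.swap) z.swap
  rw [← hat_swap] at h
  simp only [hat_swap, Prod.swap_prod_mk, Prod.fst_swap, Prod.snd_swap] at h
  refine le_trans (le_of_eq ?_) ((norm_add_le _ _).trans
    (add_le_add (norm_hat_half_adj f z) h))
  rw [← hat_add]
  congr 2
  ext v
  simp [adj, nbr, Fin.sum_univ_eight]
  ring

/-- Cauchy–Schwarz, with each term `a * x` split into the square roots of `a * weight p q` and `a *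
weight q p * x ^ 2`. The reciprocity `weight_mul` makes the product come out right. -/
theorem weighted_sq_le {a b : ℝ} (ha : 0 ≤ a) (hb : 0 ≤ b) (p₁ q₁ p₂ q₂ p₃ q₃ p₄ q₄ : ℕ)
    (x₁ x₂ x₃ x₄ : ℝ) :
    (a * (x₁ + x₂) + b * (x₃ + x₄)) ^ 2 ≤
      (a * (weight p₁ q₁ + weight p₂ q₂) + b * (weight p₃ q₃ + weight p₄ q₄)) *
      (a * weight q₁ p₁ * x₁ ^ 2 + a * weight q₂ p₂ * x₂ ^ 2 +
        (b * weight q₃ p₃ * x₃ ^ 2 + b * weight q₄ p₄ * x₄ ^ 2)) := by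
  have h := Finset.sum_sq_le_sum_mul_sum_of_sq_le_mul (Finset.univ : Finset (Fin 4))
    (f := ![a * weight p₁ q₁, a * weight p₂ q₂, b * weight p₃ q₃, b * weight p₄ q₄])
    (g := ![a * weight q₁ p₁ * x₁ ^ 2, a * weight q₂ p₂ * x₂ ^ 2, b * weight q₃ p₃ * x₃ ^ 2,
      b * weight q₄ p₄ * x₄ ^ 2]) (r := ![a * x₁, a * x₂, b * x₃, b * x₄])
    (by intro i _; fin_cases i <;> simp <;> exact mul_nonneg ‹_› (weight_pos _ _).le)
    (by
      intro i _
      fin_cases i <;> simp <;>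
        exact mul_nonneg (mul_nonneg ‹_› (weight_pos _ _).le) (sq_nonneg _))
    (by
      intro i _
      have h1 := weight_mul p₁ q₁
      have h2 := weight_mul p₂ q₂
      have h3 := weight_mul p₃ q₃
      have h4 := weight_mul p₄ q₄
      apply le_of_eq
      fin_cases i <;> simp
      · linear_combination (-a ^ 2 * x₁ ^ 2) * h1
      · linear_combination (-a ^ 2 * x₂ ^ 2) * h2
      · linear_combination (-b ^ 2 * x₃ ^ 2) * h3
      · linear_combination (-b ^ 2 * x₄ ^ 2) * h4)
  simp only [Fin.sum_univ_four, Matrix.cons_val] at h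
  calc _ = (a * x₁ + a * x₂ + b * x₃ + b * x₄) ^ 2 := by ring
    _ ≤ _ := h
    _ = _ := by ring

/-- The column sums of the Schur test become row sums after inverting the shear. The damping is
unaffected, because it depends only on the coordinate that the shear fixes. -/
theorem sum_damp_shear (F : ZMod K × ZMod K → ℝ) (s : ZMod K) :
    ∑ z : ZMod K × ZMod K, damp z.1 * weight (height (z.2 + s * z.1)) (height z.2) *
        F (z.1, z.2 + s * z.1) =
      ∑ z : ZMod K × ZMod K, damp z.1 * weight (height z.2) (height (z.2 - s * z.1)) * F z := by
  symm
  rw [← Equiv.sum_comp ((Equiv.prodComm _ _).trans ((shearEquiv s 0).trans (Equiv.prodComm _ _)))]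
  refine Finset.sum_congr rfl fun z _ => ?_
  simp [shearEquiv]

theorem sum_damp_shear' (F : ZMod K × ZMod K → ℝ) (s : ZMod K) :
    ∑ z : ZMod K × ZMod K, damp z.2 * weight (height (z.1 + s * z.2)) (height z.1) *
        F (z.1 + s * z.2, z.2) =
      ∑ z : ZMod K × ZMod K, damp z.2 * weight (height z.1) (height (z.1 - s * z.2)) * F z := by
  symm
  rw [← Equiv.sum_comp (shearEquiv s 0)]
  refine Finset.sum_congr rfl fun z _ => ?_
  simp [shearEquiv]

/-- The Gabber–Galil graph is an expander. -/
theorem sum_norm_adj_sq_le (f : ZMod K × ZMod K → ℂ) (hf : ∑ v, f v = 0) :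
    ∑ v, ‖adj f v‖ ^ 2 ≤ (73 / 10) ^ 2 * ∑ v, ‖f v‖ ^ 2 := by
  have hK : (0 : ℝ) < (K : ℝ) ^ 2 := by
    have : (0 : ℝ) < K := by exact_mod_cast Nat.pos_of_ne_zero (NeZero.ne K)
    positivity
  have h0 : hat f 0 = 0 := by simpa [hat] using hf
  -- The weight bound fails only at frequency zero, where the terms vanish because `f` has mean
  -- zero. This serves both applications of the row bound.
  have hC : ∀ (z : ZMod K × ZMod K) {X Y : ℝ}, X ≤ (damp z.1 * shearWeight z.1 z.2 +
      damp z.2 * shearWeight z.2 z.1) * Y → 0 ≤ Y → (z = 0 → X ≤ 0) → X ≤ 73 / 10 * Y := by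
    intro z X Y hX hY hz
    by_cases h : z = 0
    · exact (hz h).trans (by positivity)
    · refine hX.trans (mul_le_mul_of_nonneg_right (damp_mul_shearWeight_le ?_) hY)
      by_contra! h'
      exact h (Prod.ext h'.1 h'.2)
  have hmain : ∑ z, ‖hat (adj f) z‖ ^ 2 ≤ (73 / 10) ^ 2 * ∑ z, ‖hat f z‖ ^ 2 := by
    calc ∑ z, ‖hat (adj f) z‖ ^ 2
      _ ≤ ∑ z : ZMod K × ZMod K, 73 / 10 * (
          damp z.1 * weight (height (z.2 - 2 * z.1)) (height z.2) *
            ‖hat f (z.1, z.2 - 2 * z.1)‖ ^ 2 +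
          damp z.1 * weight (height (z.2 + 2 * z.1)) (height z.2) *
            ‖hat f (z.1, z.2 + 2 * z.1)‖ ^ 2 +
          (damp z.2 * weight (height (z.1 - 2 * z.2)) (height z.1) *
            ‖hat f (z.1 - 2 * z.2, z.2)‖ ^ 2 +
          damp z.2 * weight (height (z.1 + 2 * z.2)) (height z.1) *
            ‖hat f (z.1 + 2 * z.2, z.2)‖ ^ 2)) := by
        refine Finset.sum_le_sum fun z _ => hC z ?_ ?_ ?_
        · exact (pow_le_pow_left₀ (norm_nonneg _) (norm_hat_adj f z) 2).trans
            (weighted_sq_le (damp_nonneg _) (damp_nonneg _) _ _ _ _ _ _ _ _ _ _ _ _)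
        · have := damp_nonneg z.1
          have := damp_nonneg z.2
          have := fun p q => (weight_pos p q).le
          refine add_nonneg (add_nonneg ?_ ?_) (add_nonneg ?_ ?_) <;>
            exact mul_nonneg (mul_nonneg ‹_› (this _ _)) (sq_nonneg _)
        · rintro rfl
          have := norm_hat_adj f 0
          have h0' : hat f (0, 0) = 0 := h0
          simp [h0'] at this
          simp [this]
      -- Inverse shears bring all four sums back to `hat f z`, with exactly the weights of
      -- `shearWeight`.
      _ = 73 / 10 * ∑ z : ZMod K × ZMod K, (damp z.1 * shearWeight z.1 z.2 +
            damp z.2 * shearWeight z.2 z.1) * ‖hat f z‖ ^ 2 := by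
        have h1 := sum_damp_shear (fun z => ‖hat f z‖ ^ 2) (-2 : ZMod K)
        have h2 := sum_damp_shear (fun z => ‖hat f z‖ ^ 2) (2 : ZMod K)
        have h3 := sum_damp_shear' (fun z => ‖hat f z‖ ^ 2) (-2 : ZMod K)
        have h4 := sum_damp_shear' (fun z => ‖hat f z‖ ^ 2) (2 : ZMod K)
        simp only [neg_mul, ← sub_eq_add_neg, sub_neg_eq_add] at h1 h2 h3 h4
        rw [← Finset.mul_sum]
        simp only [Finset.sum_add_distrib]
        rw [h1, h2, h3, h4, ← Finset.sum_add_distrib, ← Finset.sum_add_distrib,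
          ← Finset.sum_add_distrib]
        congr 1
        refine Finset.sum_congr rfl fun z _ => ?_
        unfold shearWeight
        ring
      _ ≤ 73 / 10 * ∑ z : ZMod K × ZMod K, 73 / 10 * ‖hat f z‖ ^ 2 := by
        refine mul_le_mul_of_nonneg_left (Finset.sum_le_sum fun z _ => hC z le_rfl (sq_nonneg _) ?_)
          (by norm_num)
        rintro rfl
        simp [h0]
      _ = _ := by rw [← Finset.mul_sum]; ring
  rw [sum_norm_hat_sq, sum_norm_hat_sq] at hmain
  refine le_of_mul_le_mul_left ?_ hK
  linarith

theorem sum_adj (f : ZMod K × ZMod K → ℂ) : ∑ v, adj f v = 8 * ∑ v, f v := by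
  have h1 := fun s c => Equiv.sum_comp (shearEquiv s c) f
  have h2 := fun s c => Equiv.sum_comp ((Equiv.prodComm _ _).trans
    ((shearEquiv s c).trans (Equiv.prodComm _ _))) f
  have a1 := h1 2 0
  have a2 := h1 2 1
  have a3 := h1 (-2) 0
  have a4 := h1 (-2) (-1)
  have b1 := h2 2 0
  have b2 := h2 2 1
  have b3 := h2 (-2) 0
  have b4 := h2 (-2) (-1)
  simp [shearEquiv, ← sub_eq_add_neg] at a1 a2 a3 a4 b1 b2 b3 b4
  simp [adj, nbr, Fin.sum_univ_eight, Finset.sum_add_distrib, a1, a2, a3, a4, b1, b2, b3, b4]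
  ring

end GabberGalil

/-! ### The neighbours of a numbered vertex -/

set_option linter.unusedSectionVars false

namespace GabberGalil

open Finset

theorem sum_range_mul {M : Type*} [AddCommMonoid M] (a b : ℕ) (F : ℕ → ℕ → M) :
    ∑ v ∈ range (a * b), F (v / b) (v % b) = ∑ x ∈ range a, ∑ y ∈ range b, F x y := by
  rcases Nat.eq_zero_or_pos b with rfl | hb
  · simp
  induction a with
  | zero => simp
  | succ a ih =>
    rw [add_mul, one_mul, Finset.sum_range_add, ih, Finset.sum_range_succ]
    congr 1
    refine Finset.sum_congr rfl fun y hy => ?_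
    have hy := Finset.mem_range.1 hy
    rw [mul_comm a b, Nat.mul_add_div hb, Nat.mul_add_mod, Nat.div_eq_of_lt hy,
      Nat.mod_eq_of_lt hy, add_zero]

/-- Natural numbers congruent to the coordinates of the eight neighbours of `(x, y)`. -/
def nbPair (K x y : ℕ) : ℕ → ℕ × ℕ
  | 0 => (x + (y + y), y)
  | 1 => (x + (y + y) + 1, y)
  | 2 => (x + (K - y + (K - y)), y)
  | 3 => (x + (K - y - 1 + (K - y - 1)) + 1, y)
  | 4 => (x, y + (x + x))
  | 5 => (x, y + (x + x) + 1)
  | 6 => (x, y + (K - x + (K - x)))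
  | _ => (x, y + (K - x - 1 + (K - x - 1)) + 1)

/-- The number of the vertex with coordinates `x mod K` and `y mod K`. -/
def vertex (K : ℕ) (p : ℕ × ℕ) : ℕ := (p.1 % K) * K + p.2 % K

/-- The neighbour number `c` of the vertex number `v`. -/
def nb (K v c : ℕ) : ℕ := vertex K (nbPair K (v / K) (v % K) c)

theorem vertex_lt {K : ℕ} (hK : 0 < K) (p : ℕ × ℕ) : vertex K p < K * K := by
  have h1 := Nat.mod_lt p.1 hK
  have h2 := Nat.mod_lt p.2 hK
  unfold vertex
  nlinarith

/-- The sum of a function over the neighbours of a numbered vertex. -/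
def adjNat {M : Type*} [AddCommMonoid M] (K : ℕ) (f : ℕ → M) (v : ℕ) : M :=
  ∑ c ∈ range 8, f (nb K v c)

section

variable {K : ℕ} [NeZero K]

/-- The number of a vertex. -/
def number (z : ZMod K × ZMod K) : ℕ := z.1.val * K + z.2.val

theorem number_natCast (a b : ℕ) : number ((a : ZMod K), (b : ZMod K)) = vertex K (a, b) := by
  simp [number, vertex, ZMod.val_natCast]

theorem sum_range_sq {M : Type*} [AddCommMonoid M] (F : ℕ → M) :
    ∑ v ∈ range (K * K), F v = ∑ z : ZMod K × ZMod K, F (number z) := by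
  have h : ∀ f : ℕ → M, ∑ x ∈ range K, f x = ∑ x : ZMod K, f x.val := by
    intro f
    refine Finset.sum_bij' (fun x _ => (x : ZMod K)) (fun x _ => x.val) ?_ ?_ ?_ ?_ ?_
    · simp
    · intro x _; exact Finset.mem_range.2 (ZMod.val_lt x)
    · intro x hx; exact ZMod.val_cast_of_lt (Finset.mem_range.1 hx)
    · simp
    · intro x hx; rw [ZMod.val_cast_of_lt (Finset.mem_range.1 hx)]
  have := sum_range_mul K K fun x y => F (x * K + y)
  simp only [mul_comm (_ / K) K, Nat.div_add_mod] at this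
  rw [this, h, Fintype.sum_prod_type]
  refine Finset.sum_congr rfl fun x _ => ?_
  rw [h]
  rfl

/-- Natural subtraction is exact because coordinates are below `K`, so `K - y` represents `-y`. In
`nbPair`, the shift `-1` arises from `2 * (K - y - 1) + 1 ≡ -2y - 1`. -/
theorem nb_number (z : ZMod K × ZMod K) (c : Fin 8) : nb K (number z) c = number (nbr z c) := by
  have hK : 0 < K := Nat.pos_of_ne_zero (NeZero.ne K)
  have hx := ZMod.val_lt z.1
  have hy := ZMod.val_lt z.2
  have h1 : number z / K = z.1.val := by
    rw [number, mul_comm, Nat.mul_add_div hK, Nat.div_eq_of_lt hy, add_zero]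
  have h2 : number z % K = z.2.val := by
    rw [number, mul_comm, Nat.mul_add_mod, Nat.mod_eq_of_lt hy]
  rw [nb, h1, h2]
  have e : nbr z c = (((nbPair K z.1.val z.2.val c).1 : ZMod K),
      ((nbPair K z.1.val z.2.val c).2 : ZMod K)) := by
    have cx : ((K - z.1.val : ℕ) : ZMod K) = -z.1 := by
      rw [Nat.cast_sub hx.le]; simp
    have cy : ((K - z.2.val : ℕ) : ZMod K) = -z.2 := by
      rw [Nat.cast_sub hy.le]; simp
    have cx' : ((K - z.1.val - 1 : ℕ) : ZMod K) = -z.1 - 1 := by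
      rw [Nat.cast_sub (by omega), cx]; simp
    have cy' : ((K - z.2.val - 1 : ℕ) : ZMod K) = -z.2 - 1 := by
      rw [Nat.cast_sub (by omega), cy]; simp
    fin_cases c <;> simp [nbr, nbPair, cx, cy, cx', cy'] <;> ring
  rw [e, number_natCast]

theorem adjNat_number (f : ℕ → ℂ) (z : ZMod K × ZMod K) :
    adjNat K f (number z) = adj (fun z => f (number z)) z := by
  unfold adjNat adj
  rw [Finset.sum_range]
  exact Finset.sum_congr rfl fun c _ => by rw [nb_number]

end

variable {K : ℕ}

theorem sum_adjNat (hK : 0 < K) (f : ℕ → ℂ) :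
    ∑ v ∈ range (K * K), adjNat K f v = 8 * ∑ v ∈ range (K * K), f v := by
  have : NeZero K := ⟨hK.ne'⟩
  simp only [sum_range_sq, adjNat_number, sum_adj]

theorem sum_norm_adjNat_sq_le (hK : 0 < K) (f : ℕ → ℂ) (hf : ∑ v ∈ range (K * K), f v = 0) :
    ∑ v ∈ range (K * K), ‖adjNat K f v‖ ^ 2 ≤
      (73 / 10) ^ 2 * ∑ v ∈ range (K * K), ‖f v‖ ^ 2 := by
  have : NeZero K := ⟨hK.ne'⟩
  rw [sum_range_sq] at hf
  simp only [sum_range_sq, adjNat_number]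
  exact sum_norm_adj_sq_le _ hf

theorem sum_iterate_adjNat (hK : 0 < K) (t : ℕ) (f : ℕ → ℂ) :
    ∑ v ∈ range (K * K), (adjNat K)^[t] f v = 8 ^ t * ∑ v ∈ range (K * K), f v := by
  induction t generalizing f with
  | zero => simp
  | succ t ih => rw [Function.iterate_succ_apply, ih, sum_adjNat hK]; ring

theorem sum_norm_iterate_adjNat_sq_le (hK : 0 < K) (t : ℕ) (f : ℕ → ℂ)
    (hf : ∑ v ∈ range (K * K), f v = 0) :
    ∑ v ∈ range (K * K), ‖(adjNat K)^[t] f v‖ ^ 2 ≤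
      ((73 / 10) ^ t) ^ 2 * ∑ v ∈ range (K * K), ‖f v‖ ^ 2 := by
  induction t generalizing f with
  | zero => simp
  | succ t ih =>
    rw [Function.iterate_succ_apply]
    refine (ih _ (by rw [sum_adjNat hK, hf, mul_zero])).trans ?_
    have := mul_le_mul_of_nonneg_left (sum_norm_adjNat_sq_le hK f hf)
      (show (0 : ℝ) ≤ ((73 / 10) ^ t) ^ 2 by positivity)
    refine this.trans (le_of_eq ?_)
    ring

theorem iterate_adjNat_sub_const {M : Type*} [AddCommGroup M] (t : ℕ) (f : ℕ → M) (c : M) :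
    (adjNat K)^[t] (fun v => f v - c) = fun v => (adjNat K)^[t] f v - 8 ^ t • c := by
  induction t generalizing f c with
  | zero => simp
  | succ t ih =>
    have : adjNat K (fun v => f v - c) = fun v => adjNat K f v - 8 • c := by
      ext v; simp [adjNat, Finset.sum_sub_distrib]
    rw [Function.iterate_succ_apply, this, ih, Function.iterate_succ_apply, pow_succ, mul_smul]

/-- The end of the walk of length `j` with number `a`. -/
def walkEnd (K : ℕ) : ℕ → ℕ → ℕ
  | 0, a => a
  | j + 1, a => nb K (walkEnd K j (a / 8)) (a % 8)

theorem walkEnd_lt (hK : 0 < K) (j a : ℕ) (ha : a < K * K * 8 ^ j) :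
    walkEnd K j a < K * K := by
  cases j with
  | zero => simpa [walkEnd] using ha
  | succ j => exact vertex_lt hK _

/-- A walk number `a` has its start `a / 8 ^ j` as leading part and its steps as base-8 digits.
Summing over all walks therefore applies the `j`-th power of the adjacency operator. The maps `X`
may depend on the start. -/
theorem sum_walkEnd {M M' : Type*} [AddCommMonoid M] [AddCommMonoid M'] (X : ℕ → M →+ M')
    (j m : ℕ) (g : ℕ → M) :
    ∑ a ∈ range (m * 8 ^ j), X (a / 8 ^ j) (g (walkEnd K j a)) =
      ∑ v ∈ range m, X v ((adjNat K)^[j] g v) := by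
  induction j generalizing g with
  | zero => simp [walkEnd]
  | succ j ih =>
    rw [Function.iterate_succ_apply, ← ih, pow_succ, ← mul_assoc]
    simp only [walkEnd, mul_comm (8 ^ j) 8, ← Nat.div_div_eq_div_mul]
    rw [sum_range_mul (m * 8 ^ j) 8 fun b c => X (b / 8 ^ j) (g (nb K (walkEnd K j b) c))]
    exact Finset.sum_congr rfl fun b _ => by rw [adjNat, map_sum]

/-! ### Vector-valued functions -/

variable {Γ : Type*} [Fintype Γ]

theorem iterate_adjNat_apply (t : ℕ) (g : ℕ → EuclideanSpace ℂ Γ) (v : ℕ) (x : Γ) :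
    (adjNat K)^[t] g v x = (adjNat K)^[t] (fun v => g v x) v := by
  induction t generalizing g with
  | zero => rfl
  | succ t ih =>
    rw [Function.iterate_succ_apply, Function.iterate_succ_apply, ih]
    congr 1

theorem euclidean_sum_apply {ι : Type*} (s : Finset ι) (g : ι → EuclideanSpace ℂ Γ) (x : Γ) :
    (∑ v ∈ s, g v) x = ∑ v ∈ s, g v x := by simp

theorem sum_iterate_adjNat_euclidean (hK : 0 < K) (t : ℕ) (g : ℕ → EuclideanSpace ℂ Γ) :
    ∑ v ∈ range (K * K), (adjNat K)^[t] g v = (8 ^ t : ℂ) • ∑ v ∈ range (K * K), g v := by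
  ext x
  rw [euclidean_sum_apply]
  simp only [iterate_adjNat_apply]
  rw [sum_iterate_adjNat hK]
  simp

theorem sum_norm_iterate_adjNat_euclidean (hK : 0 < K) (t : ℕ) (g : ℕ → EuclideanSpace ℂ Γ)
    (hg : ∑ v ∈ range (K * K), g v = 0) :
    ∑ v ∈ range (K * K), ‖(adjNat K)^[t] g v‖ ^ 2 ≤
      ((73 / 10) ^ t) ^ 2 * ∑ v ∈ range (K * K), ‖g v‖ ^ 2 := by
  simp only [EuclideanSpace.norm_sq_eq, iterate_adjNat_apply]
  rw [Finset.sum_comm, Finset.sum_comm (s := range (K * K)), Finset.mul_sum]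
  refine Finset.sum_le_sum fun x _ => sum_norm_iterate_adjNat_sq_le hK t _ ?_
  have := congrArg (fun u : EuclideanSpace ℂ Γ => u x) hg
  simpa using this

/-- Pythagoras: constant families are orthogonal to families of mean zero. -/
theorem sum_norm_const_add_sq {ι E : Type*} [NormedAddCommGroup E] [InnerProductSpace ℂ E]
    (s : Finset ι) (a : E) (u : ι → E) (hu : ∑ v ∈ s, u v = 0) :
    ∑ v ∈ s, ‖a + u v‖ ^ 2 = s.card * ‖a‖ ^ 2 + ∑ v ∈ s, ‖u v‖ ^ 2 := by
  have : ∑ v ∈ s, RCLike.re (inner ℂ a (u v)) = 0 := by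
    rw [← map_sum, ← inner_sum, hu, inner_zero_right, map_zero]
  simp only [@norm_add_sq ℂ, Finset.sum_add_distrib, ← Finset.mul_sum, this]
  simp

/-- A long walk in a Gabber–Galil graph mixes vector-valued functions. -/
theorem norm_sum_iterate_adjNat_le (hK : 0 < K) {t : ℕ} (ht : (73 / 80 : ℝ) ^ t ≤ 1 / 16)
    (g : ℕ → EuclideanSpace ℂ Γ) (X : ℕ → EuclideanSpace ℂ Γ →ₗ[ℂ] EuclideanSpace ℂ Γ)
    (hX : ∀ v f, ‖X v f‖ = ‖f‖) {b : ℝ} (hb : 0 ≤ b) (hgb : ∀ v, ‖g v‖ ≤ b) :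
    ‖∑ v ∈ range (K * K), X v ((adjNat K)^[t] g v)‖ ≤
      8 ^ t * (15 / 16 * ‖∑ v ∈ range (K * K), X v
        (((K * K : ℕ) : ℂ)⁻¹ • ∑ w ∈ range (K * K), g w)‖ + 1 / 16 * ((K * K : ℕ) * b)) := by
  set m := K * K with hm
  have hm0 : 0 < m := Nat.mul_pos hK hK
  have hmC : (m : ℂ) ≠ 0 := by exact_mod_cast hm0.ne'
  have h8 : (8 ^ t : ℂ) ≠ 0 := pow_ne_zero _ (by norm_num)
  set gb := (m : ℂ)⁻¹ • ∑ w ∈ range m, g w with hgbar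
  have hgsum : ∑ v ∈ range m, (g v - gb) = 0 := by
    rw [Finset.sum_sub_distrib, Finset.sum_const, card_range, hgbar, ← Nat.cast_smul_eq_nsmul ℂ,
      smul_smul, mul_inv_cancel₀ hmC, one_smul, sub_self]
  set d : ℕ → EuclideanSpace ℂ Γ := fun v => (8 ^ t : ℂ)⁻¹ • (adjNat K)^[t] (fun v => g v - gb) v
    with hd
  have hdsum : ∑ v ∈ range m, d v = 0 := by
    rw [hd, ← Finset.smul_sum, sum_iterate_adjNat_euclidean hK, hgsum, smul_zero, smul_zero]
  have hdnorm : ∑ v ∈ range m, ‖d v‖ ^ 2 ≤ (1 / 16) ^ 2 * ∑ v ∈ range m, ‖g v - gb‖ ^ 2 := by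
    have h := sum_norm_iterate_adjNat_euclidean hK t _ hgsum
    have e : ∀ v, ‖d v‖ ^ 2 = ((8 ^ t : ℝ)⁻¹) ^ 2 *
        ‖(adjNat K)^[t] (fun v => g v - gb) v‖ ^ 2 := by
      intro v
      rw [hd, norm_smul, mul_pow]
      simp
    simp only [e]
    rw [← Finset.mul_sum]
    refine (mul_le_mul_of_nonneg_left h (by positivity)).trans ?_
    rw [← mul_assoc]
    refine mul_le_mul_of_nonneg_right ?_ (by positivity)
    rw [← mul_pow, ← inv_pow, ← mul_pow]
    refine pow_le_pow_left₀ (by positivity) ?_ 2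
    rw [show (8⁻¹ * (73 / 10) : ℝ) = 73 / 80 by norm_num]
    exact ht
  -- Up to the factor `8 ^ t` the walk returns the mean `gb` plus an error `d`. Moving `1/16` of the
  -- mean to the error leaves `15/16` of the full average and `1/16` of the family `gb + 16 d`.
  have hsplit : ∀ v, (adjNat K)^[t] g v =
      (8 ^ t : ℂ) • ((15 / 16 : ℂ) • gb + (1 / 16 : ℂ) • (gb + (16 : ℂ) • d v)) := by
    intro v
    rw [hd, iterate_adjNat_sub_const]
    have : (8 ^ t : ℕ) • gb = (8 ^ t : ℂ) • gb := by
      rw [← Nat.cast_smul_eq_nsmul ℂ]; simp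
    rw [this]
    have h16 : ∀ y : EuclideanSpace ℂ Γ, (8 ^ t : ℂ) • (8 ^ t : ℂ)⁻¹ • y = y :=
      fun y => smul_inv_smul₀ h8 y
    conv_lhs => rw [← h16 ((adjNat K)^[t] g v)]
    congr 1
    dsimp only
    rw [smul_sub, inv_smul_smul₀ h8]
    module
  -- The passage from `g` to `gb + 16 d` fixes the mean and contracts its orthogonal complement,
  -- since the error shrank by `1/16`. So the ℓ² norm does not grow.
  have hk : ∑ v ∈ range m, ‖gb + (16 : ℂ) • d v‖ ^ 2 ≤ m * b ^ 2 := by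
    rw [sum_norm_const_add_sq _ _ _ (by rw [← Finset.smul_sum, hdsum, smul_zero])]
    have h1 := sum_norm_const_add_sq (range m) gb _ hgsum
    simp only [add_sub_cancel] at h1
    have h2 : ∑ v ∈ range m, ‖(16 : ℂ) • d v‖ ^ 2 = 16 ^ 2 * ∑ v ∈ range m, ‖d v‖ ^ 2 := by
      rw [Finset.mul_sum]
      refine Finset.sum_congr rfl fun v _ => ?_
      rw [norm_smul, mul_pow]; norm_num
    have h3 : ∑ v ∈ range m, ‖g v‖ ^ 2 ≤ ∑ v ∈ range m, b ^ 2 :=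
      Finset.sum_le_sum fun v _ => pow_le_pow_left₀ (norm_nonneg _) (hgb v) 2
    rw [Finset.sum_const, card_range, nsmul_eq_mul] at h3
    rw [h2]
    linarith
  have hk' : ∑ v ∈ range m, ‖gb + (16 : ℂ) • d v‖ ≤ m * b := by
    have h := sq_sum_le_card_mul_sum_sq (s := range m) (f := fun v => ‖gb + (16 : ℂ) • d v‖)
    rw [card_range] at h
    have hm' : (0 : ℝ) ≤ m := by positivity
    refine abs_le_of_sq_le_sq' ?_ (by positivity) |>.2
    refine h.trans ((mul_le_mul_of_nonneg_left hk hm').trans (le_of_eq (by ring)))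
  simp only [hsplit, map_smul, map_add _ ((15 / 16 : ℂ) • gb)]
  rw [← Finset.smul_sum, norm_smul]
  have : ‖(8 ^ t : ℂ)‖ = 8 ^ t := by simp
  rw [this]
  refine mul_le_mul_of_nonneg_left ?_ (by positivity)
  rw [Finset.sum_add_distrib, ← Finset.smul_sum, ← Finset.smul_sum]
  refine (norm_add_le _ _).trans (add_le_add ?_ ?_)
  · rw [norm_smul]; norm_num
  · have h : ‖∑ v ∈ range m, X v (gb + (16 : ℂ) • d v)‖ ≤ m * b :=
      (norm_sum_le _ _).trans (by simpa only [hX] using hk')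
    have e : ‖(1 / 16 : ℂ)‖ = 1 / 16 := by norm_num
    rw [norm_smul, e]
    linarith

end GabberGalil

/-! ### Right translations of functions on a finite group -/

namespace CayleySpectrum

open Finset

variable {Γ : Type*} [Group Γ] [Fintype Γ]

/-- Right translation of functions by a group element. -/
noncomputable def rho (a : Γ) : EuclideanSpace ℂ Γ →ₗ[ℂ] EuclideanSpace ℂ Γ where
  toFun f := WithLp.toLp 2 fun x => f (x * a)
  map_add' _ _ := rfl
  map_smul' _ _ := rfl

@[simp]
theorem rho_apply (a : Γ) (f : EuclideanSpace ℂ Γ) (x : Γ) : rho a f x = f (x * a) := rfl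

theorem rho_mul (a b : Γ) (f : EuclideanSpace ℂ Γ) : rho (a * b) f = rho a (rho b f) := by
  ext x; simp [mul_assoc]

theorem rho_one (f : EuclideanSpace ℂ Γ) : rho (1 : Γ) f = f := by
  ext x; simp

theorem norm_rho (a : Γ) (f : EuclideanSpace ℂ Γ) : ‖rho a f‖ = ‖f‖ := by
  rw [EuclideanSpace.norm_eq, EuclideanSpace.norm_eq]
  congr 1
  exact Equiv.sum_comp (Equiv.mulRight a) fun x => ‖f x‖ ^ 2

theorem inner_rho (a : Γ) (f g : EuclideanSpace ℂ Γ) :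
    inner ℂ (rho a f) g = inner ℂ f (rho a⁻¹ g) := by
  simp only [PiLp.inner_apply]
  rw [← Equiv.sum_comp (Equiv.mulRight a⁻¹)]
  simp

/-- The sum of the right translates by the elements of a subgroup. -/
noncomputable def cosetSum (H : Subgroup Γ) : EuclideanSpace ℂ Γ →ₗ[ℂ] EuclideanSpace ℂ Γ :=
  ∑ h ∈ (H : Set Γ).toFinite.toFinset, rho h

theorem cosetSum_eq (H : Subgroup Γ) (f : EuclideanSpace ℂ Γ) :
    cosetSum H f = ∑ h ∈ (H : Set Γ).toFinite.toFinset, rho h f := by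
  simp [cosetSum]

theorem cosetSum_apply (H : Subgroup Γ) (f : EuclideanSpace ℂ Γ) (x : Γ) :
    cosetSum H f x = ∑ h ∈ (H : Set Γ).toFinite.toFinset, f (x * h) := by
  simp [cosetSum_eq]

theorem sum_subgroup_mul_right {M : Type*} [AddCommMonoid M] (H : Subgroup Γ) {a : Γ} (ha : a ∈ H)
    (F : Γ → M) : ∑ h ∈ (H : Set Γ).toFinite.toFinset, F (h * a) =
      ∑ h ∈ (H : Set Γ).toFinite.toFinset, F h := by
  refine Finset.sum_bij' (fun h _ => h * a) (fun h _ => h * a⁻¹) ?_ ?_ ?_ ?_ ?_ <;>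
    simp +contextual [H.mul_mem_cancel_right ha, H.mul_mem_cancel_right (H.inv_mem ha)]

theorem sum_subgroup_mul_left {M : Type*} [AddCommMonoid M] (H : Subgroup Γ) {a : Γ} (ha : a ∈ H)
    (F : Γ → M) : ∑ h ∈ (H : Set Γ).toFinite.toFinset, F (a * h) =
      ∑ h ∈ (H : Set Γ).toFinite.toFinset, F h := by
  refine Finset.sum_bij' (fun h _ => a * h) (fun h _ => a⁻¹ * h) ?_ ?_ ?_ ?_ ?_ <;>
    simp +contextual [H.mul_mem_cancel_left ha, H.mul_mem_cancel_left (H.inv_mem ha)]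

theorem sum_subgroup_conj {M : Type*} [AddCommMonoid M] (H : Subgroup Γ) {a : Γ}
    (ha : ∀ h ∈ H, a * h * a⁻¹ ∈ H) (ha' : ∀ h ∈ H, a⁻¹ * h * a ∈ H) (F : Γ → M) :
    ∑ h ∈ (H : Set Γ).toFinite.toFinset, F (a * h * a⁻¹) =
      ∑ h ∈ (H : Set Γ).toFinite.toFinset, F h := by
  refine Finset.sum_bij' (fun h _ => a * h * a⁻¹) (fun h _ => a⁻¹ * h * a) ?_ ?_ ?_ ?_ ?_
  · simpa using ha
  · simpa using ha'
  · intro h _; group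
  · intro h _; group
  · intro h _; rfl

theorem cosetSum_rho (H : Subgroup Γ) {a : Γ} (ha : a ∈ H) (f : EuclideanSpace ℂ Γ) :
    cosetSum H (rho a f) = cosetSum H f := by
  rw [cosetSum_eq, cosetSum_eq, ← sum_subgroup_mul_right H ha fun h => rho h f]
  simp only [rho_mul]

theorem rho_cosetSum (H : Subgroup Γ) {a : Γ} (ha : a ∈ H) (f : EuclideanSpace ℂ Γ) :
    rho a (cosetSum H f) = cosetSum H f := by
  rw [cosetSum_eq, map_sum, ← sum_subgroup_mul_left H ha fun h => rho h f]
  simp only [rho_mul]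

theorem rho_cosetSum_comm (H : Subgroup Γ) {a : Γ} (ha : ∀ h ∈ H, a * h * a⁻¹ ∈ H)
    (ha' : ∀ h ∈ H, a⁻¹ * h * a ∈ H) (f : EuclideanSpace ℂ Γ) :
    rho a (cosetSum H f) = cosetSum H (rho a f) := by
  rw [cosetSum_eq, cosetSum_eq, map_sum, ← sum_subgroup_conj H ha ha' fun h => rho h (rho a f)]
  refine Finset.sum_congr rfl fun h _ => ?_
  rw [← rho_mul, ← rho_mul]
  simp

theorem card_subgroup_pos (H : Subgroup Γ) : 0 < (H : Set Γ).toFinite.toFinset.card :=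
  Finset.card_pos.2 ⟨1, by simp⟩

/-- The average of the right translates by the elements of a subgroup. -/
noncomputable def avg (H : Subgroup Γ) (f : EuclideanSpace ℂ Γ) : EuclideanSpace ℂ Γ :=
  ((H : Set Γ).toFinite.toFinset.card : ℂ)⁻¹ • cosetSum H f

theorem card_smul_avg (H : Subgroup Γ) (f : EuclideanSpace ℂ Γ) :
    ((H : Set Γ).toFinite.toFinset.card : ℂ) • avg H f = cosetSum H f :=
  smul_inv_smul₀ (by exact_mod_cast (card_subgroup_pos H).ne') _

theorem avg_of_invariant (H : Subgroup Γ) {f : EuclideanSpace ℂ Γ} (hf : ∀ h ∈ H, rho h f = f) :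
    avg H f = f := by
  have : cosetSum H f = ((H : Set Γ).toFinite.toFinset.card : ℂ) • f := by
    rw [cosetSum_eq, Finset.sum_congr rfl (fun h hh => hf h (by simpa using hh)),
      Finset.sum_const, Nat.cast_smul_eq_nsmul]
  rw [avg, this, inv_smul_smul₀ (by exact_mod_cast (card_subgroup_pos H).ne')]

theorem rho_avg (H : Subgroup Γ) {a : Γ} (ha : a ∈ H) (f : EuclideanSpace ℂ Γ) :
    rho a (avg H f) = avg H f := by
  rw [avg, map_smul, rho_cosetSum H ha]

theorem cosetSum_sub_avg (H : Subgroup Γ) (f : EuclideanSpace ℂ Γ) :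
    cosetSum H (f - avg H f) = 0 := by
  have h := avg_of_invariant H fun a ha => rho_avg H ha f
  rw [map_sub, ← card_smul_avg H f, ← card_smul_avg H (avg H f), h, sub_self]

theorem inner_cosetSum (H : Subgroup Γ) (f g : EuclideanSpace ℂ Γ) :
    inner ℂ (cosetSum H f) g = inner ℂ f (cosetSum H g) := by
  rw [cosetSum_eq, cosetSum_eq, sum_inner, inner_sum]
  simp only [inner_rho]
  exact Finset.sum_bij' (fun h _ => h⁻¹) (fun h _ => h⁻¹) (by simp) (by simp) (by simp) (by simp)
    (by simp)

/-- The average over a subgroup is an orthogonal projection: translation by an element is adjoint to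
translation by its inverse. -/
theorem norm_sq_avg_add (H : Subgroup Γ) (f : EuclideanSpace ℂ Γ) :
    ‖f‖ ^ 2 = ‖avg H f‖ ^ 2 + ‖f - avg H f‖ ^ 2 := by
  have h : inner ℂ (avg H f) (f - avg H f) = 0 := by
    rw [avg, inner_smul_left, inner_cosetSum, ← avg, cosetSum_sub_avg, inner_zero_right, mul_zero]
  have := norm_add_sq_eq_norm_sq_add_norm_sq_of_inner_eq_zero _ _ h
  rw [add_sub_cancel] at this
  rw [sq, this]; ring

/-! ### Spectral bounds -/

/-- The average of the first `m` elements of the family `S` contracts by `lam` the functions of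
mean zero on the cosets of `H`. -/
def SpectralBound (H : Subgroup Γ) (lam : ℝ) (S : ℕ → Γ) (m : ℕ) : Prop :=
  ∀ f : EuclideanSpace ℂ Γ, cosetSum H f = 0 → ‖∑ v ∈ range m, rho (S v) f‖ ≤ lam * m * ‖f‖

theorem SpectralBound.mono {H : Subgroup Γ} {a b : ℝ} {S : ℕ → Γ} {m : ℕ}
    (h : SpectralBound H a S m) (hab : a ≤ b) : SpectralBound H b S m := fun f hf =>
  (h f hf).trans (by gcongr)

theorem cosetSum_sum_rho {ι : Type*} {H : Subgroup Γ} (s : Finset ι) {S : ι → Γ}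
    (hS : ∀ v ∈ s, S v ∈ H) {f : EuclideanSpace ℂ Γ} (hf : cosetSum H f = 0) :
    cosetSum H (∑ v ∈ s, rho (S v) f) = 0 := by
  rw [map_sum]
  exact Finset.sum_eq_zero fun v hv => by rw [cosetSum_rho H (hS v hv), hf]

/-- Derandomized squaring along long walks in Gabber–Galil graphs. -/
theorem SpectralBound.square {H : Subgroup Γ} {lam : ℝ} (hlam : 0 ≤ lam) {S : ℕ → Γ} {K t : ℕ}
    (hK : 0 < K) (ht : (73 / 80 : ℝ) ^ t ≤ 1 / 16) (hS : ∀ v < K * K, S v ∈ H)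
    (h : SpectralBound H lam S (K * K)) :
    SpectralBound H (15 / 16 * lam ^ 2 + 1 / 16)
      (fun a => S (a / 8 ^ t) * S (GabberGalil.walkEnd K t a)) (K * K * 8 ^ t) := by
  intro f hf
  have hm : (0 : ℝ) < (K * K : ℕ) := by exact_mod_cast Nat.mul_pos hK hK
  have hmC : ((K * K : ℕ) : ℂ) ≠ 0 := by exact_mod_cast (Nat.mul_pos hK hK).ne'
  simp only [rho_mul]
  -- The mixing lemma applies to `g w = rho (S w) f` and `X v = rho (S v)`. Its averaged part is the
  -- square of the normalized operator at `f`, which accounts for `lam ^ 2`; its error part accounts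
  -- for `1/16`.
  have hwalk := GabberGalil.sum_walkEnd (K := K) (fun v => (rho (S v)).toAddMonoidHom) t (K * K)
    fun w => rho (S w) f
  simp only [LinearMap.toAddMonoidHom_coe] at hwalk
  rw [hwalk]
  refine (GabberGalil.norm_sum_iterate_adjNat_le hK ht (fun w => rho (S w) f)
    (fun v => rho (S v)) (fun v => norm_rho _) (norm_nonneg f)
    (fun v => (norm_rho _ _).le)).trans ?_
  have h0 : cosetSum H (((K * K : ℕ) : ℂ)⁻¹ • ∑ w ∈ range (K * K), rho (S w) f) = 0 := by
    rw [map_smul, cosetSum_sum_rho _ (fun v hv => hS v (Finset.mem_range.1 hv)) hf, smul_zero]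
  have h1 := h _ h0
  have h2 := h f hf
  rw [norm_smul, norm_inv, Complex.norm_natCast] at h1
  have h3 : ((K * K : ℕ) : ℝ)⁻¹ * ‖∑ w ∈ range (K * K), rho (S w) f‖ ≤ lam * ‖f‖ := by
    rw [inv_mul_le_iff₀ hm]
    exact h2.trans (le_of_eq (by ring))
  have h4 := h1.trans (mul_le_mul_of_nonneg_left h3 (by positivity))
  rw [Nat.cast_mul (K * K), Nat.cast_pow]
  push_cast at h4 ⊢
  calc _ ≤ (8 : ℝ) ^ t * (15 / 16 * (lam * (K * K) * (lam * ‖f‖)) + 1 / 16 * (K * K * ‖f‖)) := by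
        gcongr
    _ = _ := by ring

/-! ### Periodic extension and symmetrization of families -/

theorem sum_range_mod {M : Type*} [AddCommMonoid M] (N T : ℕ) (F : ℕ → M) :
    ∑ v ∈ range N, F (v % T) = (N / T) • ∑ u ∈ range T, F u + ∑ u ∈ range (N % T), F u := by
  conv_lhs => rw [← Nat.div_add_mod N T, Finset.sum_range_add, mul_comm]
  congr 1
  · rw [GabberGalil.sum_range_mul (N / T) T fun _ y => F y]
    simp
  · rcases Nat.eq_zero_or_pos T with rfl | hT
    · simp
    refine Finset.sum_congr rfl fun u hu => ?_
    have := Finset.mem_range.1 hu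
    have := Nat.mod_lt N hT
    rw [mul_comm, Nat.mul_add_mod, Nat.mod_eq_of_lt (by omega)]

/-- Complete periods contract by `lam`. The incomplete one is bounded trivially and makes up at most
half of the whole, so the gap is at worst halved. -/
theorem norm_sum_range_mod_le {E : Type*} [SeminormedAddCommGroup E] {F : ℕ → E} {b lam : ℝ}
    {N T : ℕ} (hF : ∀ v, ‖F v‖ ≤ b) (hlam : lam ≤ 1) (hT : 0 < T)
    (hN : T ≤ N) (h : ‖∑ u ∈ range T, F u‖ ≤ lam * T * b) :
    ‖∑ v ∈ range N, F (v % T)‖ ≤ (1 - (1 - lam) / 2) * N * b := by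
  have hb : 0 ≤ b := (norm_nonneg _).trans (hF 0)
  rw [sum_range_mod]
  have h1 : ‖∑ u ∈ range (N % T), F u‖ ≤ (N % T : ℕ) * b :=
    (norm_sum_le _ _).trans ((Finset.sum_le_sum fun u _ => hF u).trans (by simp))
  have h2 : ‖(N / T) • ∑ u ∈ range T, F u‖ ≤ (N / T : ℕ) * (lam * T * b) :=
    (norm_nsmul_le).trans (by gcongr)
  refine (norm_add_le _ _).trans ((add_le_add h2 h1).trans ?_)
  have hq : 1 ≤ N / T := Nat.div_pos hN hT
  have he : N % T ≤ T * (N / T) := (Nat.mod_lt _ hT).le.trans (Nat.le_mul_of_pos_right T hq)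
  have hN' : (N : ℝ) = T * (N / T : ℕ) + (N % T : ℕ) := by exact_mod_cast (Nat.div_add_mod N T).symm
  have he' : ((N % T : ℕ) : ℝ) ≤ T * (N / T : ℕ) := by exact_mod_cast he
  rw [hN']
  nlinarith [mul_nonneg (mul_nonneg hb (sub_nonneg.2 hlam)) (sub_nonneg.2 he')]

theorem SpectralBound.extend {H : Subgroup Γ} {lam : ℝ} (hlam : lam ≤ 1) {S : ℕ → Γ} {T N : ℕ}
    (hT : 0 < T) (hN : T ≤ N) (h : SpectralBound H lam S T) :
    SpectralBound H (1 - (1 - lam) / 2) (fun v => S (v % T)) N := fun f hf =>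
  norm_sum_range_mod_le (F := fun v => rho (S v) f) (fun _ => (norm_rho _ _).le) hlam hT hN
    (h f hf)

/-- The averages over the family and over its inverses are adjoint, hence have the same norm. With
`u` the value at `f`, one bounds `‖u‖ ^ 2` by the operator applied to `u`. -/
theorem SpectralBound.inv {H : Subgroup Γ} {lam : ℝ} {S : ℕ → Γ} {m : ℕ}
    (hS : ∀ v < m, S v ∈ H) (h : SpectralBound H lam S m) :
    SpectralBound H lam (fun v => (S v)⁻¹) m := by
  intro f hf
  set u := ∑ v ∈ range m, rho (S v)⁻¹ f with hu
  have hu0 : cosetSum H u = 0 :=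
    cosetSum_sum_rho _ (fun v hv => H.inv_mem (hS v (Finset.mem_range.1 hv))) hf
  have h1 : (inner ℂ u u : ℂ) = inner ℂ (∑ v ∈ range m, rho (S v) u) f := by
    conv_lhs => rw [hu, inner_sum]
    rw [sum_inner]
    exact Finset.sum_congr rfl fun v _ => by rw [inner_rho]
  have h2 : ‖u‖ * ‖u‖ ≤ lam * m * ‖u‖ * ‖f‖ := by
    have := norm_inner_le_norm (𝕜 := ℂ) (∑ v ∈ range m, rho (S v) u) f
    rw [← h1, inner_self_eq_norm_sq_to_K, norm_pow, RCLike.norm_ofReal, abs_norm, sq] at this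
    exact this.trans (mul_le_mul_of_nonneg_right (h u hu0) (norm_nonneg _))
  rcases (norm_nonneg u).eq_or_lt with h0 | h0
  · rw [← h0]
    have h3 := (norm_nonneg _).trans (h f hf)
    exact h3
  · nlinarith

/-- The first `m` members of a family, their inverses, and so on periodically for the first `q`
periods, followed by identity elements. -/
def symmetrized (S : ℕ → Γ) (m q v : ℕ) : Γ :=
  if v < q * (2 * m) then
    if v % (2 * m) < m then S (v % (2 * m)) else (S (v % (2 * m) - m))⁻¹
  else 1

/-- The identity padding has fewer than `2 * m ≤ N / 8` members and adds at most `1/8` to the bound.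
-/
theorem SpectralBound.symmetrized {H : Subgroup Γ} {S : ℕ → Γ} {m N : ℕ}
    (hS : ∀ v < m, S v ∈ H) (h : SpectralBound H (1 / 8) S m) (hN : 16 * m ≤ N) (hm : 0 < m) :
    SpectralBound H (1 / 4) (symmetrized S m (N / (2 * m))) N := by
  intro f hf
  set q := N / (2 * m) with hq
  have hNq : N = q * (2 * m) + N % (2 * m) := by
    rw [hq, mul_comm]; exact (Nat.div_add_mod _ _).symm
  have hr : N % (2 * m) < 2 * m := Nat.mod_lt _ (by omega)
  set e := N % (2 * m)
  have h1 := h f hf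
  have h2 := h.inv hS f hf
  set F : ℕ → EuclideanSpace ℂ Γ := fun u => rho (if u < m then S u else (S (u - m))⁻¹) f with hF
  have hs : ∑ v ∈ range N, rho (CayleySpectrum.symmetrized S m q v) f =
      q • (∑ u ∈ range m, rho (S u) f + ∑ u ∈ range m, rho (S u)⁻¹ f) + e • f := by
    rw [hNq, Finset.sum_range_add]
    congr 1
    · have : ∀ v ∈ range (q * (2 * m)), rho (CayleySpectrum.symmetrized S m q v) f =
          F (v % (2 * m)) := by
        intro v hv
        rw [CayleySpectrum.symmetrized, if_pos (Finset.mem_range.1 hv)]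
      rw [Finset.sum_congr rfl this, GabberGalil.sum_range_mul q (2 * m) fun _ u => F u,
        Finset.sum_const, card_range, two_mul, Finset.sum_range_add]
      congr 2
      · exact Finset.sum_congr rfl fun u hu => by simp [hF, Finset.mem_range.1 hu]
      · exact Finset.sum_congr rfl fun u _ => by simp [hF]
    · simp [CayleySpectrum.symmetrized, rho_one]
  rw [hs]
  have h3 : ‖q • (∑ u ∈ range m, rho (S u) f + ∑ u ∈ range m, rho (S u)⁻¹ f)‖ ≤
      q * (1 / 8 * m * ‖f‖ + 1 / 8 * m * ‖f‖) := by
    rw [← Nat.cast_smul_eq_nsmul ℝ, norm_smul, Real.norm_natCast]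
    exact mul_le_mul_of_nonneg_left ((norm_add_le _ _).trans (add_le_add h1 h2)) (by positivity)
  have h4 : ‖e • f‖ ≤ e * ‖f‖ := by
    rw [← Nat.cast_smul_eq_nsmul ℝ, norm_smul, Real.norm_natCast]
  refine (norm_add_le _ _).trans ((add_le_add h3 h4).trans ?_)
  have hN' : (N : ℝ) = q * (2 * m) + e := by exact_mod_cast hNq
  have h5 : (8 * e : ℝ) ≤ N := by
    have : 8 * e ≤ N := by omega
    exact_mod_cast this
  have h6 : (0 : ℝ) ≤ ‖f‖ := norm_nonneg _
  nlinarith [mul_nonneg h6 (sub_nonneg.2 h5), mul_nonneg h6 (Nat.cast_nonneg (α := ℝ) e)]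

/-! ### Chains of normal subgroups -/

/-- The layers are the differences of successive averages over the `N i`. The operator preserves
this orthogonal decomposition, so a bound on every layer is a bound on the whole. The induction
descends the chain through functions invariant under `N i`. -/
theorem norm_sum_rho_le_of_chain {ι : Type*} {N : ℕ → Subgroup Γ} {r : ℕ} (hr : N r = ⊥)
    (hle : ∀ i, N (i + 1) ≤ N i) (hnormal : ∀ i, ∀ a ∈ N 0, ∀ h ∈ N i, a * h * a⁻¹ ∈ N i)
    (s : Finset ι) {S : ι → Γ} (hS : ∀ v ∈ s, S v ∈ N 0) {c : ℝ} (hc : 0 ≤ c)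
    (hfac : ∀ i < r, ∀ f : EuclideanSpace ℂ Γ, (∀ h ∈ N (i + 1), rho h f = f) →
      cosetSum (N i) f = 0 → ‖∑ v ∈ s, rho (S v) f‖ ≤ c * ‖f‖)
    {f : EuclideanSpace ℂ Γ} (hf : cosetSum (N 0) f = 0) :
    ‖∑ v ∈ s, rho (S v) f‖ ≤ c * ‖f‖ := by
  have hle0 : ∀ i, N i ≤ N 0 := by
    intro i
    induction i with
    | zero => exact le_rfl
    | succ i ih => exact (hle i).trans ih
  have key : ∀ i ≤ r, ∀ f : EuclideanSpace ℂ Γ, cosetSum (N 0) f = 0 →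
      (∀ h ∈ N i, rho h f = f) → ‖∑ v ∈ s, rho (S v) f‖ ≤ c * ‖f‖ := by
    intro i
    induction i with
    | zero =>
      intro _ f hf hinv
      have : f = 0 := by rw [← avg_of_invariant _ hinv, avg, hf, smul_zero]
      simp [this]
    | succ i ih =>
      intro hi f hf hinv
      set u := avg (N i) f with hu
      have hu0 : cosetSum (N 0) u = 0 := by
        rw [hu, avg, map_smul, cosetSum_eq (N i), map_sum, Finset.sum_eq_zero, smul_zero]
        intro h hh
        rw [cosetSum_rho _ (hle0 i (by simpa using hh)), hf]
      have h1 := ih (by omega) u hu0 fun h hh => rho_avg _ hh f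
      have h2 := hfac i hi (f - u)
        (fun h hh => by rw [map_sub, hinv h hh, hu, rho_avg _ (hle i hh)]) (cosetSum_sub_avg _ f)
      -- Conjugation by `S v` permutes `N i`, so translation by `S v` commutes with averaging.
      have hTu : ∑ v ∈ s, rho (S v) u = avg (N i) (∑ v ∈ s, rho (S v) f) := by
        rw [hu, avg, avg, map_sum, Finset.smul_sum]
        refine Finset.sum_congr rfl fun v hv => ?_
        have ha := hS v hv
        rw [map_smul, rho_cosetSum_comm]
        · exact hnormal i _ ha
        · have := hnormal i _ ((N 0).inv_mem ha)
          simpa using this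
      have hTw : ∑ v ∈ s, rho (S v) (f - u) =
          ∑ v ∈ s, rho (S v) f - avg (N i) (∑ v ∈ s, rho (S v) f) := by
        rw [← hTu, ← Finset.sum_sub_distrib]
        simp only [map_sub]
      have hsq := norm_sq_avg_add (N i) (∑ v ∈ s, rho (S v) f)
      have hsq' := norm_sq_avg_add (N i) f
      rw [hTu] at h1
      rw [hTw] at h2
      refine abs_le_of_sq_le_sq' ?_ (by positivity) |>.2
      rw [hsq, mul_pow, hsq', mul_add, ← mul_pow, ← mul_pow]
      exact add_le_add (pow_le_pow_left₀ (norm_nonneg _) h1 2)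
        (pow_le_pow_left₀ (norm_nonneg _) h2 2)
  refine key r le_rfl f hf fun h hh => ?_
  rw [hr, Subgroup.mem_bot] at hh
  rw [hh, rho_one]

/-- The blocks of a family indexed by pairs, repeated periodically up to the same length. -/
def blocks (len : ℕ → ℕ) (b : ℕ → ℕ → Γ) (s v : ℕ) : Γ := b (v / s) ((v % s) % len (v / s))

/-- On layer `i` one block out of `r` contracts by `5/8` and the others do not expand: `(r - 1 +
5/8) / r = 1 - 3/(8r)`. -/
theorem spectralBound_blocks {N : ℕ → Subgroup Γ} {r s : ℕ} (hr : N r = ⊥) (hr0 : 0 < r)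
    (hle : ∀ i, N (i + 1) ≤ N i) (hnormal : ∀ i, ∀ a ∈ N 0, ∀ h ∈ N i, a * h * a⁻¹ ∈ N i)
    {len : ℕ → ℕ} (hlen : ∀ i < r, 0 < len i) (hlen' : ∀ i < r, len i ≤ s) {b : ℕ → ℕ → Γ}
    (hb : ∀ i j, b i j ∈ N 0)
    (hfac : ∀ i < r, ∀ f : EuclideanSpace ℂ Γ, (∀ h ∈ N (i + 1), rho h f = f) →
      cosetSum (N i) f = 0 → ‖∑ j ∈ range (len i), rho (b i j) f‖ ≤ 1 / 4 * len i * ‖f‖) :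
    SpectralBound (N 0) (1 - 3 / (8 * r)) (blocks len b s) (r * s) := by
  have hr' : (1 : ℝ) ≤ r := by exact_mod_cast hr0
  intro f hf
  refine norm_sum_rho_le_of_chain hr hle hnormal _ (fun v _ => hb _ _) ?_ ?_ hf
  · refine mul_nonneg ?_ (by positivity)
    rw [sub_nonneg, div_le_one (by positivity)]
    linarith
  intro i hi f hinv hf
  refine (congrArg norm (GabberGalil.sum_range_mul r s
    fun x y => rho (b x (y % len x)) f)).trans_le ?_
  -- Periodic repetition up to length `s` halves the gap `3/4`, which yields `5/8`.
  have h1 := norm_sum_range_mod_le (F := fun j => rho (b i j) f) (fun v => (norm_rho _ _).le)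
    (by norm_num) (hlen i hi) (hlen' i hi) (hfac i hi f hinv hf)
  have h2 : ∀ x, ‖∑ y ∈ range s, rho (b x (y % len x)) f‖ ≤ s * ‖f‖ := fun x =>
    (norm_sum_le _ _).trans (by simp [norm_rho])
  have himem : i ∈ range r := Finset.mem_range.2 hi
  rw [← Finset.add_sum_erase _ _ himem]
  have h3 : ‖∑ x ∈ (range r).erase i, ∑ y ∈ range s, rho (b x (y % len x)) f‖ ≤
      (r - 1) * (s * ‖f‖) := by
    refine (norm_sum_le _ _).trans ((Finset.sum_le_sum fun x _ => h2 x).trans (le_of_eq ?_))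
    rw [Finset.sum_const, Finset.card_erase_of_mem himem, card_range, nsmul_eq_mul,
      Nat.cast_sub hr0, Nat.cast_one]
  refine (norm_add_le _ _).trans ((add_le_add h1 h3).trans (le_of_eq ?_))
  push_cast
  field_simp
  ring

end CayleySpectrum

/-! ### Spectral expanders and translations -/

namespace CayleySpectrum

open Finset

theorem IsSpectralExpander.sum_sq_le {G : Type*} [Group G] [inst : Fintype G] [Finite G]
    {lam : ℝ} {S : Multiset G}
    (h : IsSpectralExpander lam S) {f : G → ℂ} (hf : ∑ x, f x = 0) :
    ∑ x, ‖(S.map fun a => f (x * a)).sum‖ ^ 2 ≤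
      (lam * Multiset.card S) ^ 2 * ∑ x, ‖f x‖ ^ 2 := by
  have e : Fintype.ofFinite G = inst := Subsingleton.elim _ _
  unfold IsSpectralExpander at h
  rw [e] at h
  rcases Nat.eq_zero_or_pos (Multiset.card S) with h0 | h0
  · rw [Multiset.card_eq_zero] at h0
    simp [h0]
  have h1 := h f hf
  rw [EuclideanSpace.norm_eq, EuclideanSpace.norm_eq] at h1
  have h2 : ∑ x, ‖cayleyOp S f x‖ ^ 2 ≤ lam ^ 2 * ∑ x, ‖f x‖ ^ 2 := by
    have := pow_le_pow_left₀ (Real.sqrt_nonneg _) h1 2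
    rw [mul_pow, Real.sq_sqrt (by positivity), Real.sq_sqrt (by positivity)] at this
    exact this
  have hc : (0 : ℝ) < Multiset.card S := by exact_mod_cast h0
  simp only [cayleyOp, norm_mul, mul_pow, norm_inv, Complex.norm_natCast] at h2
  rw [← Finset.mul_sum, inv_pow, inv_mul_le_iff₀ (by positivity)] at h2
  exact h2.trans (le_of_eq (by ring))

theorem isSpectralExpander_of_sum_sq_le {G : Type*} [Group G] [inst : Fintype G] [Finite G] {lam : ℝ}
    {S : Multiset G} (hlam : 0 ≤ lam)
    (h : ∀ f : G → ℂ, ∑ x, f x = 0 → ∑ x, ‖(S.map fun a => f (x * a)).sum‖ ^ 2 ≤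
      (lam * Multiset.card S) ^ 2 * ∑ x, ‖f x‖ ^ 2) :
    IsSpectralExpander lam S := by
  have e : Fintype.ofFinite G = inst := Subsingleton.elim _ _
  unfold IsSpectralExpander
  rw [e]
  intro f hf
  have h1 := h f hf
  rw [EuclideanSpace.norm_eq, EuclideanSpace.norm_eq, ← Real.sqrt_sq hlam, ← Real.sqrt_mul
    (by positivity)]
  apply Real.sqrt_le_sqrt
  have h2 : ∑ x, ‖cayleyOp S f x‖ ^ 2 ≤ lam ^ 2 * ∑ x, ‖f x‖ ^ 2 := by
    rcases Nat.eq_zero_or_pos (Multiset.card S) with h0 | h0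
    · simp only [cayleyOp, h0]
      simp
      positivity
    have hc : (0 : ℝ) < Multiset.card S := by exact_mod_cast h0
    simp only [cayleyOp, norm_mul, mul_pow, norm_inv, Complex.norm_natCast]
    rw [← Finset.mul_sum, inv_pow, inv_mul_le_iff₀ (by positivity)]
    exact h1.trans (le_of_eq (by ring))
  exact h2

/-- A spectral gap forces generation. -/
theorem IsSpectralExpander.closure_eq_top {G : Type*} [Group G] [Fintype G] {lam : ℝ}
    {S : Multiset G} (h : IsSpectralExpander lam S) (hlam : 0 ≤ lam) (hlam' : lam < 1)
    (hS : 0 < Multiset.card S) : Subgroup.closure {g : G | g ∈ S} = ⊤ := by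
  classical
  set H := Subgroup.closure {g : G | g ∈ S} with hH
  set i : G → ℂ := fun x => if x ∈ H then 1 else 0 with hi
  set c : ℂ := (Fintype.card G : ℂ)⁻¹ * ∑ x, i x with hc
  have hf : ∑ x, (i x - c) = 0 := by
    rw [Finset.sum_sub_distrib, Finset.sum_const, Finset.card_univ, nsmul_eq_mul, hc,
      mul_inv_cancel_left₀ (by exact_mod_cast Fintype.card_ne_zero), sub_self]
  have h1 := IsSpectralExpander.sum_sq_le h hf
  -- The indicator of the closure, minus its mean, is an eigenfunction with eigenvalue `1`; the gap
  -- forces it to vanish.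
  have h2 : ∀ x, (S.map fun a => i (x * a) - c).sum = Multiset.card S * (i x - c) := by
    intro x
    rw [Multiset.map_congr rfl (g := fun _ => i x - c), Multiset.map_const', Multiset.sum_replicate,
      nsmul_eq_mul]
    intro a ha
    have : a ∈ H := Subgroup.subset_closure ha
    simp only [hi, H.mul_mem_cancel_right this]
  simp only [h2, norm_mul, mul_pow, Complex.norm_natCast] at h1
  rw [← Finset.mul_sum] at h1
  have hc0 : (0 : ℝ) < Multiset.card S := by exact_mod_cast hS
  have hlt : lam ^ 2 < 1 := by nlinarith
  have h3 : ∑ x, ‖i x - c‖ ^ 2 = 0 := by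
    have h4 : 0 ≤ ∑ x, ‖i x - c‖ ^ 2 := by positivity
    by_contra h5
    have h6 : 0 < ∑ x, ‖i x - c‖ ^ 2 := lt_of_le_of_ne h4 (Ne.symm h5)
    have h7 : 0 < (Multiset.card S : ℝ) ^ 2 * ∑ x, ‖i x - c‖ ^ 2 := by positivity
    nlinarith
  rw [Finset.sum_eq_zero_iff_of_nonneg (fun _ _ => by positivity)] at h3
  have h4 : ∀ x, i x = c := fun x => by
    have := h3 x (Finset.mem_univ x)
    rwa [sq_eq_zero_iff, norm_eq_zero, sub_eq_zero] at this
  rw [eq_top_iff]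
  intro x _
  by_contra hx
  have h5 := (h4 x).trans (h4 1).symm
  simp [hi, hx, H.one_mem] at h5

variable {Γ : Type*} [Group Γ] [Fintype Γ]

/-! ### Transfer between factor groups, subgroups and the ambient group -/

theorem sum_subgroup_eq {M : Type*} [AddCommMonoid M] (H : Subgroup Γ) [Fintype H] (F : Γ → M) :
    ∑ h ∈ (H : Set Γ).toFinite.toFinset, F h = ∑ h : H, F h := by
  classical
  refine Finset.sum_bij' (fun h hh => ⟨h, by simpa using hh⟩) (fun h _ => h) ?_ ?_ ?_ ?_ ?_ <;> simp

theorem sum_quotient_eq {G M : Type*} [Group G] [Fintype G] (H : Subgroup G) [Fintype (G ⧸ H)]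
    [AddCommMonoid M] (F : G ⧸ H → M) :
    ∑ x : G, F (QuotientGroup.mk x) = Nat.card H • ∑ q, F q := by
  classical
  rw [← Finset.sum_fiberwise (g := fun x : G => (QuotientGroup.mk x : G ⧸ H)), Finset.smul_sum]
  refine Finset.sum_congr rfl fun q _ => ?_
  have h1 : ∀ x ∈ Finset.univ.filter (fun x : G => (QuotientGroup.mk x : G ⧸ H) = q),
      F (QuotientGroup.mk x) = F q := by
    intro x hx
    rw [(Finset.mem_filter.1 hx).2]
  rw [Finset.sum_congr rfl h1, Finset.sum_const]
  congr 1
  have h2 := QuotientGroup.card_preimage_mk H {q}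
  rw [show Nat.card ({q} : Set (G ⧸ H)) = 1 by simp, mul_one] at h2
  rw [← h2, ← Nat.card_eq_finsetCard]
  exact Nat.card_congr (Equiv.subtypeEquivRight fun x => by simp)

/-- For every `x` the function `h ↦ f (x * h)` descends to the factor group and has mean zero there.
The expander bound applies coset by coset, and the squared bounds are summed over `x`. -/
theorem norm_sum_rho_le_of_factor {H H' : Subgroup Γ}
    [(H'.subgroupOf H).Normal] (L : List H)
    (h : IsSpectralExpander (1 / 4) ((L.map fun b : H => (QuotientGroup.mk b : H ⧸ H'.subgroupOf H) :
      List (H ⧸ H'.subgroupOf H)) : Multiset (H ⧸ H'.subgroupOf H)))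
    {f : EuclideanSpace ℂ Γ} (hinv : ∀ h ∈ H', rho h f = f) (hf : cosetSum H f = 0) :
    ‖(L.map fun b : H => rho (b : Γ) f).sum‖ ≤ 1 / 4 * L.length * ‖f‖ := by
  classical
  have := Fintype.ofFinite H
  have := Fintype.ofFinite (H ⧸ H'.subgroupOf H)
  set Φ : Γ → H ⧸ H'.subgroupOf H → ℂ := fun x => Quotient.lift (fun h : H => f (x * h)) (by
    intro a b hab
    have hab' : (a : Γ)⁻¹ * b ∈ H' := by
      have := QuotientGroup.leftRel_apply.1 hab
      simpa [Subgroup.mem_subgroupOf] using this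
    have := congrArg (fun g : EuclideanSpace ℂ Γ => g (x * a)) (hinv _ hab')
    simp only [rho_apply] at this
    rw [← this]
    group) with hΦ
  have hΦmk : ∀ x (h : H), Φ x (QuotientGroup.mk h) = f (x * h) := fun x h => rfl
  have hcard : (0 : ℝ) < Nat.card (H'.subgroupOf H) := by exact_mod_cast Nat.card_pos
  have h0 : ∀ x, ∑ q, Φ x q = 0 := by
    intro x
    have h1 := sum_quotient_eq (H'.subgroupOf H) (Φ x)
    simp only [hΦmk] at h1
    rw [← sum_subgroup_eq H fun h => f (x * h), ← cosetSum_apply, hf, nsmul_eq_mul] at h1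
    have := (mul_eq_zero.1 h1.symm).resolve_left (by exact_mod_cast Nat.card_pos.ne')
    exact this
  have h1 : ∀ x, ∑ h : H, ‖(L.map fun b : H => f (x * h * b)).sum‖ ^ 2 ≤
      (1 / 4 * L.length) ^ 2 * ∑ h : H, ‖f (x * h)‖ ^ 2 := by
    intro x
    have h2 := IsSpectralExpander.sum_sq_le h (h0 x)
    have h3 := sum_quotient_eq (H'.subgroupOf H) fun q => ‖Φ x q‖ ^ 2
    have h4 := sum_quotient_eq (H'.subgroupOf H) fun q => ‖((L.map fun b =>
      (QuotientGroup.mk b : H ⧸ H'.subgroupOf H)).map fun a => Φ x (q * a)).sum‖ ^ 2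
    simp only [hΦmk, List.map_map, Function.comp_def, ← QuotientGroup.mk_mul, Subgroup.coe_mul,
      ← mul_assoc] at h3 h4
    rw [h3, h4, nsmul_eq_mul, nsmul_eq_mul, mul_left_comm]
    refine mul_le_mul_of_nonneg_left ?_ hcard.le
    simpa only [Multiset.map_coe, Multiset.sum_coe, Multiset.coe_card, List.length_map,
      List.map_map, Function.comp_def] using h2
  have h2 := Finset.sum_le_sum fun x (_ : x ∈ (Finset.univ : Finset Γ)) => h1 x
  rw [← Finset.mul_sum, Finset.sum_comm, Finset.sum_comm (f := fun x (h : H) => ‖f (x * h)‖ ^ 2)]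
    at h2
  -- Summing over all `x` and `h` counts each group element once for every `h`; this common factor
  -- cancels.
  have h3 : ∀ F : Γ → ℝ, ∑ h : H, ∑ x : Γ, F (x * h) = Fintype.card H * ∑ x, F x := by
    intro F
    have h4 : ∀ h : H, ∑ x : Γ, F (x * h) = ∑ x, F x := fun h =>
      Equiv.sum_comp (Equiv.mulRight (h : Γ)) F
    simp [h4]
  rw [h3 fun x => ‖(L.map fun b : H => f (x * b)).sum‖ ^ 2, h3 fun x => ‖f x‖ ^ 2, mul_left_comm] at h2
  have h4 := le_of_mul_le_mul_left h2 (by exact_mod_cast Fintype.card_pos)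
  have h5 : ‖(L.map fun b : H => rho (b : Γ) f).sum‖ ^ 2 =
      ∑ x, ‖(L.map fun b : H => f (x * b)).sum‖ ^ 2 := by
    rw [EuclideanSpace.norm_sq_eq]
    refine Finset.sum_congr rfl fun x _ => ?_
    congr 2
    clear * -
    induction L with
    | nil => simp
    | cons a L ih => simp only [List.map_cons, List.sum_cons, PiLp.add_apply, ih, rho_apply]
  refine abs_le_of_sq_le_sq' ?_ (by positivity) |>.2
  rw [h5, mul_pow, EuclideanSpace.norm_sq_eq]
  exact h4

/-- Extension by zero from `H` to `Γ` preserves norms and turns functions of mean zero into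
functions killed by `cosetSum H`. -/
theorem isSpectralExpander_of_norm_sum_rho_le {H : Subgroup Γ} (U : List H) {lam : ℝ}
    (hlam : 0 ≤ lam) (h : ∀ f : EuclideanSpace ℂ Γ, cosetSum H f = 0 →
      ‖(U.map fun u : H => rho (u : Γ) f).sum‖ ≤ lam * U.length * ‖f‖) :
    IsSpectralExpander lam (U : Multiset H) := by
  classical
  have := Fintype.ofFinite H
  refine isSpectralExpander_of_sum_sq_le hlam fun φ hφ => ?_
  set f : EuclideanSpace ℂ Γ := WithLp.toLp 2 fun x => if hx : x ∈ H then φ ⟨x, hx⟩ else 0 with hfdef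
  have hfH : ∀ x : H, f x = φ x := fun x => by simp [hfdef]
  have hf : cosetSum H f = 0 := by
    ext x
    rw [cosetSum_apply, sum_subgroup_eq]
    by_cases hx : x ∈ H
    · have h1 : ∀ y : H, f (x * y) = φ (⟨x, hx⟩ * y) := fun y => hfH (⟨x, hx⟩ * y)
      simp only [h1]
      exact (Equiv.sum_comp (Equiv.mulLeft (⟨x, hx⟩ : H)) φ).trans hφ
    · refine Finset.sum_eq_zero fun y _ => ?_
      simp [hfdef, H.mul_mem_cancel_right y.2, hx]
  have h1 := pow_le_pow_left₀ (norm_nonneg _) (h f hf) 2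
  rw [mul_pow, EuclideanSpace.norm_sq_eq, EuclideanSpace.norm_sq_eq] at h1
  have h2 : ∑ x, ‖f x‖ ^ 2 = ∑ x, ‖φ x‖ ^ 2 := by
    simp only [← hfH]
    rw [← sum_subgroup_eq H fun x => ‖f x‖ ^ 2]
    symm
    refine Finset.sum_subset (Finset.subset_univ _) fun x _ hx => ?_
    have : x ∉ H := by simpa using hx
    simp [hfdef, this]
  rw [h2] at h1
  have h3 : ∀ x : H, (((U : Multiset H).map fun a => φ (x * a)).sum : ℂ) =
      (U.map fun u : H => rho (u : Γ) f).sum x := by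
    intro x
    rw [Multiset.map_coe, Multiset.sum_coe]
    clear * - hfH
    induction U with
    | nil => simp
    | cons a U ih =>
      have := hfH (x * a)
      simp only [Subgroup.coe_mul] at this
      simp [ih, this]
  simp only [h3, Multiset.coe_card]
  refine le_trans ?_ h1
  rw [← sum_subgroup_eq H fun x => ‖(U.map fun u : H => rho (u : Γ) f).sum x‖ ^ 2]
  exact Finset.sum_le_sum_of_subset_of_nonneg (Finset.subset_univ _) fun _ _ _ => by positivity

end CayleySpectrum

/-! ### The program for derandomized squaring -/

namespace RAM

open GabberGalil

/-- Expressions for the coordinates of the eight neighbours. -/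
def nbExpr : ℕ → Expr × Expr
  | 0 => (.add (V 23) (.add (V 24) (V 24)), V 24)
  | 1 => (.add (.add (V 23) (.add (V 24) (V 24))) (.const 1), V 24)
  | 2 => (.add (V 23) (.add (.monus (V 13) (V 24)) (.monus (V 13) (V 24))), V 24)
  | 3 => (.add (.add (V 23) (.add (.monus (.monus (V 13) (V 24)) (.const 1))
      (.monus (.monus (V 13) (V 24)) (.const 1)))) (.const 1), V 24)
  | 4 => (V 23, .add (V 24) (.add (V 23) (V 23)))
  | 5 => (V 23, .add (.add (V 24) (.add (V 23) (V 23))) (.const 1))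
  | 6 => (V 23, .add (V 24) (.add (.monus (V 13) (V 23)) (.monus (V 13) (V 23))))
  | _ => (V 23, .add (.add (V 24) (.add (.monus (.monus (V 13) (V 23)) (.const 1))
      (.monus (.monus (V 13) (V 23)) (.const 1)))) (.const 1))

theorem nbExpr_cost (c : ℕ) : (nbExpr c).1.cost ≤ 100 ∧ (nbExpr c).2.cost ≤ 100 := by
  unfold nbExpr
  split <;> decide

theorem nbExpr_eval (c : ℕ) {m : Memory} {K x y : ℕ} (hK : m 13 0 = K) (hx : m 23 0 = x)
    (hy : m 24 0 = y) :
    (nbExpr c).1.eval m = (nbPair K x y c).1 ∧ (nbExpr c).2.eval m = (nbPair K x y c).2 := by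
  subst hK hx hy
  rcases c with _ | _ | _ | _ | _ | _ | _ | c <;> exact ⟨rfl, rfl⟩

/-- Bounds the time of the reduction modulo `K`, which is done by repeated subtraction. -/
theorem nbPair_le {K x y : ℕ} (hx : x < K) (hy : y < K) (c : ℕ) :
    (nbPair K x y c).1 ≤ 3 * K ∧ (nbPair K x y c).2 ≤ 3 * K := by
  unfold nbPair
  split <;> constructor <;> dsimp only <;> omega

/-- Append the number of one vertex to the table of neighbours. -/
def entryP (e : Expr × Expr) : Prog :=
  .seq (divmodP 25 26 e.1 (V 13)) (.seq (divmodP 27 28 e.2 (V 13))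
    (.seq (mulP 29 21 (V 26) (V 13)) (.seq (.write 8 (V 30) (.add (V 29) (V 28)))
      (setv 30 (.add (V 30) (.const 1))))))

theorem entryP_runs {m₀ : Memory} {K x y p : ℕ} (c : ℕ) (hK : m₀ 13 0 = K) (hx : m₀ 23 0 = x)
    (hy : m₀ 24 0 = y) (hp : m₀ 30 0 = p) (hxK : x < K) (hyK : y < K) :
    ∃ m', Runs (entryP (nbExpr c)) m₀ m' (5000 * (K + 1)) ∧ m' 30 0 = p + 1 ∧
      m' 8 p = vertex K (nbPair K x y c) ∧ ∀ j < p, m' 8 j = m₀ 8 j := by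
  have hK0 : 0 < K := by omega
  obtain ⟨hX, hY⟩ := nbPair_le hxK hyK c
  have hev := nbExpr_eval c hK hx hy
  obtain ⟨ma, ra, -, ha⟩ := divmodP_runs (q := 25) (d := 26) (v := (nbExpr c).1) (k := V 13)
    (m₀ := m₀) _ K (by decide) hK0 hev.1
    (fun m hm => by rw [eval_V, hm 13 (by decide) (by decide), hK])
    (nbExpr_cost c).1 (by decide)
  have hev' := nbExpr_eval c (m := ma) (K := K) (x := x) (y := y) (by rw [ra.frame 13 rfl, hK])
    (by rw [ra.frame 23 rfl, hx]) (by rw [ra.frame 24 rfl, hy])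
  obtain ⟨mb, rb, -, hb⟩ := divmodP_runs (q := 27) (d := 28) (v := (nbExpr c).2) (k := V 13)
    (m₀ := ma) _ K (by decide) hK0 hev'.2
    (fun m hm => by rw [eval_V, hm 13 (by decide) (by decide), ra.frame 13 rfl, hK])
    (nbExpr_cost c).2 (by decide)
  obtain ⟨md, rd, hd⟩ := mulP_runs (d := 29) (c := 21) (x := V 26) (y := V 13) (m₀ := mb)
    ((nbPair K x y c).1 % K) K (by decide)
    (fun m hm => by rw [eval_V, hm 26 (by decide) (by decide), rb.frame 26 rfl, ha])
    (fun m hm => by rw [eval_V, hm 13 (by decide) (by decide), rb.frame 13 rfl,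
      ra.frame 13 rfl, hK])
    (by decide) (by decide)
  have h30 : md 30 0 = p := by rw [rd.frame 30 rfl, rb.frame 30 rfl, ra.frame 30 rfl, hp]
  have h8 : md 8 = m₀ 8 := by rw [rd.frame 8 rfl, rb.frame 8 rfl, ra.frame 8 rfl]
  refine ⟨_, (ra.seq (rb.seq (rd.seq ((Runs.write (j := p) (x := vertex K (nbPair K x y c))
    (T := 20) md ?_ ?_ (by decide)).seq (Runs.setv _ (x := p + 1) ?_ le_rfl))))).mono ?_,
    ?_, ?_, ?_⟩
  · simp only [Expr.eval, h30]
  · simp only [Expr.eval, hd, rd.frame 28 rfl, hb]; rfl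
  · simp only [Expr.eval, Memory.set_bank md _ _ (show (30 : ℕ) ≠ 8 by decide), h30]
  · have := Nat.mod_lt (nbPair K x y c).1 hK0
    simp only [Expr.cost]; omega
  · rw [Memory.set_same]
  · rw [Memory.set_bank _ _ _ (by decide), Memory.set_same]
  · intro j hj
    rw [Memory.set_bank _ _ _ (by decide), Memory.set_addr _ _ _ _ (by omega), h8]

/-- Append the numbers of the first `c` neighbours. -/
def entriesP : ℕ → Prog
  | 0 => .skip
  | c + 1 => .seq (entriesP c) (entryP (nbExpr c))

theorem entriesP_runs {m₀ : Memory} {K x y p : ℕ} (c : ℕ) (hK : m₀ 13 0 = K) (hx : m₀ 23 0 = x)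
    (hy : m₀ 24 0 = y) (hp : m₀ 30 0 = p) (hxK : x < K) (hyK : y < K) :
    ∃ m', Runs (entriesP c) m₀ m' (c * (5000 * (K + 1)) + 1) ∧ m' 13 0 = K ∧ m' 23 0 = x ∧
      m' 24 0 = y ∧ m' 30 0 = p + c ∧
      (∀ i < c, m' 8 (p + i) = vertex K (nbPair K x y i)) ∧ ∀ j < p, m' 8 j = m₀ 8 j := by
  induction c with
  | zero => exact ⟨m₀, (Runs.skip m₀).mono (by omega), hK, hx, hy, hp, by simp, by simp⟩
  | succ c ih =>
    obtain ⟨m₁, r₁, k₁, x₁, y₁, p₁, h₁, h₁'⟩ := ih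
    obtain ⟨m₂, r₂, p₂, h₂, h₂'⟩ := entryP_runs c k₁ x₁ y₁ p₁ hxK hyK
    refine ⟨m₂, (r₁.seq r₂).mono (by rw [add_mul, one_mul]; omega), ?_, ?_, ?_, p₂, ?_, ?_⟩
    · rw [r₂.frame 13 rfl, k₁]
    · rw [r₂.frame 23 rfl, x₁]
    · rw [r₂.frame 24 rfl, y₁]
    · intro i hi
      rcases Nat.lt_succ_iff_lt_or_eq.1 hi with hi | rfl
      · rw [h₂' _ (by omega), h₁ i hi]
      · exact h₂
    · intro j hj
      rw [h₂' _ (by omega), h₁' j hj]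

/-- Compute the table of neighbours. -/
def tableP : Prog :=
  .seq (setv 30 (.const 0)) (forP 20 (V 14) (.seq (divmodP 23 24 (V 20) (V 13)) (entriesP 8)))

theorem tableP_runs {m₀ : Memory} {K Z : ℕ} (hK0 : 0 < K) (hK : m₀ 13 0 = K)
    (hKK : m₀ 14 0 = K * K) (hZ : K * K ≤ Z) :
    ∃ m', Runs tableP m₀ m' (Z * (50000 * (Z + 1)) + 300) ∧
      ∀ v < K * K, ∀ c < 8, m' 8 (8 * v + c) = nb K v c := by
  have hKZ : K ≤ Z := (Nat.le_mul_of_pos_left K hK0).trans hZ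
  obtain ⟨m', h', hI⟩ := forP_runs (c := 20) (N := V 14)
    (body := .seq (divmodP 23 24 (V 20) (V 13)) (entriesP 8)) (m₀ := m₀.set 30 0 0) (K * K)
    (41000 * (Z + 1))
    (fun k m => m 30 0 = 8 * k ∧ ∀ v < k, ∀ c < 8, m 8 (8 * v + c) = nb K v c) rfl (by decide)
    (fun m hm => by
      rw [eval_V, hm 14 rfl (by decide), Memory.set_bank _ _ _ (by decide), hKK])
    (fun k m v h => by
      rwa [Memory.set_bank _ _ _ (by decide), Memory.set_bank _ _ _ (by decide)])
    (by
      rintro k hk m hm hc ⟨h30, h8⟩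
      have f13 : m 13 0 = K := by
        rw [hm 13 rfl (by decide), Memory.set_bank _ _ _ (by decide), hK]
      obtain ⟨ma, ra, ha, ha'⟩ := divmodP_runs (q := 23) (d := 24) (v := V 20) (k := V 13)
        (m₀ := m) k K (by decide) hK0 (by rw [eval_V, hc])
        (fun m' hm' => by rw [eval_V, hm' 13 (by decide) (by decide), f13])
        (by decide) (by decide)
      obtain ⟨mb, rb, -, -, -, p, hb, hb'⟩ := entriesP_runs 8 (by rw [ra.frame 13 rfl, f13]) ha ha'
        (by rw [ra.frame 30 rfl, h30]) (Nat.div_lt_of_lt_mul hk) (Nat.mod_lt _ hK0)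
      refine ⟨mb, (ra.seq rb).mono (by omega), by rw [p]; omega, ?_⟩
      intro v hv c hc8
      rcases Nat.lt_succ_iff_lt_or_eq.1 hv with hv | rfl
      · rw [hb' _ (by omega), ra.frame 8 rfl, h8 v hv c hc8]
      · exact hb c hc8)
    ⟨Memory.set_same _ _ _ _, by simp⟩
  refine ⟨m', ((Runs.setv m₀ (x := 0) rfl le_rfl).seq h').mono ?_, hI.2⟩
  simp only [Expr.cost]
  have : K * K * (41000 * (Z + 1) + 200) ≤ Z * (50000 * (Z + 1)) :=
    Nat.mul_le_mul hZ (by omega)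
  omega

/-- Eight times the value of an expression. -/
def oct (e : Expr) : Expr := .add (.add (.add e e) (.add e e)) (.add (.add e e) (.add e e))

theorem oct_eval (m : Memory) (e : Expr) : (oct e).eval m = 8 * e.eval m := by
  simp only [oct, Expr.eval]; omega

/-- Prolong all walks by one step. -/
def walkStepP : Prog :=
  .seq (setv 33 (oct (V 32))) (.seq
    (forP 20 (V 33) (.seq (divmodP 23 24 (V 20) (.const 8))
      (.write 10 (V 20) (.read 8 (.add (oct (.read 9 (V 23))) (V 24))))))
    (.seq (copyP 20 9 (.const 0) 10 (.const 0) (V 33)) (setv 32 (V 33))))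

/-- Walk `a` prolongs walk `a / 8` by the edge `a % 8`. The new ends are collected in bank `10`,
because the old ones in bank `9` are still being read. -/
theorem walkStepP_runs {m₀ : Memory} {K l Z : ℕ} {E : ℕ → ℕ} (hl : m₀ 32 0 = l)
    (htab : ∀ v < K * K, ∀ c < 8, m₀ 8 (8 * v + c) = nb K v c) (hE : ∀ a < l, m₀ 9 a = E a)
    (hEK : ∀ a < l, E a < K * K) (hZ : l * 8 ≤ Z) :
    ∃ m', Runs walkStepP m₀ m' (Z * (1000 * (Z + 1)) + 1000 * (Z + 1)) ∧ m' 32 0 = l * 8 ∧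
      ∀ a < l * 8, m' 9 a = nb K (E (a / 8)) (a % 8) := by
  obtain ⟨m₁, h₁, hI⟩ := forP_runs (c := 20) (N := V 33)
    (body := .seq (divmodP 23 24 (V 20) (.const 8))
      (.write 10 (V 20) (.read 8 (.add (oct (.read 9 (V 23))) (V 24)))))
    (m₀ := m₀.set 33 0 (l * 8)) (l * 8) (500 * (Z + 1) + 100)
    (fun k m => ∀ a < k, m 10 a = nb K (E (a / 8)) (a % 8)) rfl (by decide)
    (fun m hm => by rw [eval_V, hm 33 rfl (by decide), Memory.set_same])
    (fun k m v h => by rwa [Memory.set_bank _ _ _ (by decide)])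
    (by
      intro k hk m hm hc hI
      obtain ⟨ma, ra, ha, ha'⟩ := divmodP_runs (q := 23) (d := 24) (v := V 20) (k := .const 8)
        (m₀ := m) k 8 (by decide) (by decide) (by rw [eval_V, hc]) (fun _ _ => rfl)
        (by decide) (by decide)
      have hk8 : k / 8 < l := Nat.div_lt_of_lt_mul (by omega)
      refine ⟨_, (ra.seq (Runs.write (j := k) (x := nb K (E (k / 8)) (k % 8)) (T := 100) ma ?_ ?_
        (by decide))).mono (by omega), ?_⟩
      · simp only [Expr.eval]; rw [ra.frame 20 rfl, hc]
      · simp only [Expr.eval, oct_eval, ha, ha']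
        rw [ra.frame 9 rfl, ra.frame 8 rfl, hm 9 rfl (by decide), hm 8 rfl (by decide),
          Memory.set_bank _ _ _ (by decide), Memory.set_bank _ _ _ (by decide), hE _ hk8,
          htab _ (hEK _ hk8) _ (Nat.mod_lt _ (by decide))]
      · intro a ha
        rcases Nat.lt_succ_iff_lt_or_eq.1 ha with ha | rfl
        · rw [Memory.set_addr _ _ _ _ (by omega), ra.frame 10 rfl, hI a ha]
        · rw [Memory.set_same])
    (by simp)
  have h33 : m₁ 33 0 = l * 8 := by rw [h₁.frame 33 rfl, Memory.set_same]
  obtain ⟨m₂, h₂, h₂', -⟩ := copyP_runs (c := 20) (dst := 9) (src := 10) (dpos := .const 0)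
    (spos := .const 0) (len := V 33) (m₀ := m₁) 0 0 (l * 8) (by decide) (by decide) (by decide)
    (fun _ _ => rfl) (fun _ _ => rfl)
    (fun m hm => by rw [eval_V, hm 33 (by decide) (by decide), h33])
    (by decide) (by decide) (by decide)
  refine ⟨_, ((Runs.setv m₀ (x := l * 8) ?_ (T := 30) (by decide)).seq (h₁.seq (h₂.seq
    (Runs.setv m₂ (x := l * 8) ?_ le_rfl)))).mono ?_, Memory.set_same _ _ _ _, ?_⟩
  · rw [oct_eval, eval_V, hl, mul_comm]
  · rw [eval_V, h₂.frame 33 rfl, h33]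
  · simp only [Expr.cost]
    have : l * 8 * (500 * (Z + 1) + 100 + 200) ≤ Z * (1000 * (Z + 1)) :=
      Nat.mul_le_mul hZ (by omega)
    omega
  · intro a ha
    rw [Memory.set_bank _ _ _ (by decide)]
    have := h₂' a ha
    simp only [zero_add] at this
    rw [this, hI a ha]

/-- The length of the walks. -/
abbrev walkLength : ℕ := 32

/-- Compute the ends of all walks. -/
def walkP : Prog :=
  .seq (forP 20 (V 14) (.write 9 (V 20) (V 20))) (.seq (setv 32 (V 14))
    (forP 31 (.const walkLength) walkStepP))

theorem walkP_time (a W z : ℕ) (h : a ≤ z) :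
    a * (100 + 200) + 200 + ((V 14).cost + 2 + (W + 200)) ≤ W + 1000 * (z + 1) := by
  simp only [Expr.cost]
  omega

theorem walkP_runs {m₀ : Memory} {K Z : ℕ} (hK0 : 0 < K) (hKK : m₀ 14 0 = K * K)
    (htab : ∀ v < K * K, ∀ c < 8, m₀ 8 (8 * v + c) = nb K v c)
    (hZ : K * K * 8 ^ walkLength ≤ Z) :
    ∃ m', Runs walkP m₀ m' 
      (walkLength * (Z * (1000 * (Z + 1)) + 1000 * (Z + 1) + 200) + 1000 * (Z + 1)) ∧
      m' 32 0 = K * K * 8 ^ walkLength ∧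
      ∀ a < K * K * 8 ^ walkLength, m' 9 a = walkEnd K walkLength a := by
  have hKZ : K * K ≤ Z := (Nat.le_mul_of_pos_right _ (by positivity)).trans hZ
  obtain ⟨m₁, h₁, hI⟩ := forP_runs (c := 20) (N := V 14) (body := .write 9 (V 20) (V 20))
    (m₀ := m₀) (K * K) 100 (fun k m => ∀ a < k, m 9 a = a) rfl (by decide)
    (fun m hm => by rw [eval_V, hm 14 rfl (by decide), hKK])
    (fun k m v h => by rwa [Memory.set_bank _ _ _ (by decide)])
    (by
      intro k hk m hm hc hI
      refine ⟨_, Runs.write (j := k) (x := k) m hc hc (by decide), ?_⟩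
      intro a ha
      rcases Nat.lt_succ_iff_lt_or_eq.1 ha with ha | rfl
      · rw [Memory.set_addr _ _ _ _ (by omega), hI a ha]
      · rw [Memory.set_same])
    (by simp)
  have h14 : m₁ 14 0 = K * K := by rw [h₁.frame 14 rfl, hKK]
  obtain ⟨m₂, h₂, hJ⟩ := forP_runs (c := 31) (N := .const walkLength) (body := walkStepP)
    (m₀ := m₁.set 32 0 (K * K)) walkLength (Z * (1000 * (Z + 1)) + 1000 * (Z + 1))
    (fun k m => m 32 0 = K * K * 8 ^ k ∧ ∀ a < K * K * 8 ^ k, m 9 a = walkEnd K k a) rfl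
    (by decide) (fun _ _ => rfl)
    (fun k m v h => by
      rwa [Memory.set_bank _ _ _ (by decide), Memory.set_bank _ _ _ (by decide)])
    (by
      rintro k hk m hm hc ⟨h32, h9⟩
      have hpow : K * K * 8 ^ (k + 1) ≤ Z :=
        (Nat.mul_le_mul_left _ (Nat.pow_le_pow_right (by decide) hk)).trans hZ
      rw [pow_succ, ← mul_assoc] at hpow
      obtain ⟨m', h', h32', h9'⟩ := walkStepP_runs h32
        (fun v hv c hc => by rw [hm 8 rfl (by decide), Memory.set_bank _ _ _ (by decide),
          h₁.frame 8 rfl, htab v hv c hc]) h9 (fun a ha => walkEnd_lt hK0 k a ha) hpow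
      refine ⟨m', h', by rw [h32', pow_succ, mul_assoc], ?_⟩
      rw [pow_succ, ← mul_assoc]
      exact h9')
    ⟨by rw [Memory.set_same, pow_zero, mul_one], fun a ha => by
      rw [pow_zero, mul_one] at ha
      rw [Memory.set_bank _ _ _ (by decide), hI a ha, walkEnd]⟩
  refine ⟨m₂, (h₁.seq ((Runs.setv m₁ (x := K * K) (by rw [eval_V, h14]) le_rfl).seq h₂)).mono ?_, hJ⟩
  have e1 : K * K * (100 + 200) ≤ Z * 300 := Nat.mul_le_mul_right _ hKZ
  exact walkP_time _ _ _ hKZ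

/-- Multiply the permutations at the two ends of every walk. -/
def composeP : Prog :=
  .seq (mulP 34 21 (V 32) (V 2)) (.seq
    (forP 20 (V 34) (.seq (divmodP 23 24 (V 20) (V 2))
      (.seq (divmodP 25 26 (V 23) (.const (8 ^ walkLength)))
      (.seq (mulP 27 21 (.read 9 (V 23)) (V 2))
      (.seq (setv 28 (.read 6 (.add (V 27) (V 24))))
      (.seq (mulP 29 21 (V 25) (V 2))
        (.write 7 (V 20) (.read 6 (.add (V 29) (V 28))))))))))
    (copyP 20 6 (.const 0) 7 (.const 0) (V 34)))

/-- Cell `a` receives the image of the point `a % n` under the product number `a / n`; the right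
factor, at the end of the walk, is applied first. Bank `7` is a buffer, since the factors are read
from bank `6`. -/
theorem composeP_runs {m₀ : Memory} {n k D Z : ℕ} {S : ℕ → Equiv.Perm (Fin n)} {E : ℕ → ℕ}
    (hD : D = 8 ^ walkLength) (h2 : m₀ 2 0 = n) (h32 : m₀ 32 0 = k * D)
    (hE : ∀ a < k * D, m₀ 9 a = E a) (hEk : ∀ a < k * D, E a < k)
    (hS : ∀ a < k * n, m₀ 6 a = flat n S a) (hZ : k * D * n ≤ Z) (hZ' : k * D ≤ Z) :
    ∃ m', Runs composeP m₀ m' (Z * (4000 * (Z + 1)) + 2000 * (Z + 1)) ∧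
      ∀ a < k * D * n, m' 6 a = flat n (fun u => S (u / D) * S (E u)) a := by
  have hD0 : 0 < D := by rw [hD]; positivity
  have hkZ : k ≤ Z := (Nat.le_mul_of_pos_right k hD0).trans hZ'
  obtain ⟨m₁, r₁, h₁⟩ := mulP_runs (d := 34) (c := 21) (x := V 32) (y := V 2) (m₀ := m₀)
    (k * D) n (by decide) (fun m hm => by rw [eval_V, hm 32 (by decide) (by decide), h32])
    (fun m hm => by rw [eval_V, hm 2 (by decide) (by decide), h2]) (by decide) (by decide)
  obtain ⟨m₂, r₂, hI⟩ := forP_runs (c := 20) (N := V 34)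
    (body := .seq (divmodP 23 24 (V 20) (V 2))
      (.seq (divmodP 25 26 (V 23) (.const (8 ^ walkLength)))
      (.seq (mulP 27 21 (.read 9 (V 23)) (V 2))
      (.seq (setv 28 (.read 6 (.add (V 27) (V 24))))
      (.seq (mulP 29 21 (V 25) (V 2))
        (.write 7 (V 20) (.read 6 (.add (V 29) (V 28)))))))))
    (m₀ := m₁) (k * D * n) (2000 * (Z + 1) + 100)
    (fun j m => ∀ a < j, m 7 a = flat n (fun u => S (u / D) * S (E u)) a) rfl (by decide)
    (fun m hm => by rw [eval_V, hm 34 rfl (by decide), h₁])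
    (fun k m v h => by rwa [Memory.set_bank _ _ _ (by decide)])
    (by
      intro j hj m hm hc hI
      have hn : 0 < n := Nat.pos_of_ne_zero (by rintro rfl; simp at hj)
      have f2 : m 2 0 = n := by rw [hm 2 rfl (by decide), r₁.frame 2 rfl, h2]
      have f6 : m 6 = m₀ 6 := by rw [hm 6 rfl (by decide), r₁.frame 6 rfl]
      have f9 : m 9 = m₀ 9 := by rw [hm 9 rfl (by decide), r₁.frame 9 rfl]
      have hu : j / n < k * D := Nat.div_lt_of_lt_mul (by rwa [mul_comm])
      have huj : j / n ≤ j := Nat.div_le_self _ _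
      have ho : j / n / D < k := Nat.div_lt_of_lt_mul (by rwa [mul_comm])
      have hi : j % n < n := Nat.mod_lt _ hn
      have hSS : ∀ v < k, ∀ i : Fin n, m₀ 6 (v * n + i) = S v i := by
        intro v hv i
        have hi2 := i.2
        have : (v + 1) * n ≤ k * n := Nat.mul_le_mul_right n hv
        rw [add_mul, one_mul] at this
        rw [hS _ (by omega), flat_mul_add]
      obtain ⟨ma, ra, ha, ha'⟩ := divmodP_runs (q := 23) (d := 24) (v := V 20) (k := V 2)
        (m₀ := m) j n (by decide) hn (by rw [eval_V, hc])
        (fun m' hm' => by rw [eval_V, hm' 2 (by decide) (by decide), f2])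
        (by decide) (by decide)
      obtain ⟨mb, rb, hb, -⟩ := divmodP_runs (q := 25) (d := 26) (v := V 23)
        (k := .const (8 ^ walkLength)) (m₀ := ma) (j / n) D (by decide) hD0 (by rw [eval_V, ha])
        (fun _ _ => hD.symm) (by decide) (by simp [Expr.cost])
      obtain ⟨md, rd, hd⟩ := mulP_runs (d := 27) (c := 21) (x := .read 9 (V 23)) (y := V 2)
        (m₀ := mb) (E (j / n)) n (by decide)
        (fun m' hm' => by
          rw [Expr.eval, eval_V, hm' 23 (by decide) (by decide), hm' 9 (by decide) (by decide),
            rb.frame 23 rfl, rb.frame 9 rfl, ha, ra.frame 9 rfl, f9, hE _ hu])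
        (fun m' hm' => by rw [eval_V, hm' 2 (by decide) (by decide), rb.frame 2 rfl,
          ra.frame 2 rfl, f2])
        (by decide) (by decide)
      have r28 : Runs (setv 28 (.read 6 (.add (V 27) (V 24)))) md
          (md.set 28 0 (S (E (j / n)) ⟨j % n, hi⟩)) 20 := by
        refine Runs.setv md ?_ (by decide)
        simp only [Expr.eval]
        rw [hd, rd.frame 24 rfl, rb.frame 24 rfl, ha', rd.frame 6 rfl, rb.frame 6 rfl,
          ra.frame 6 rfl, f6]
        exact hSS _ (hEk _ hu) ⟨j % n, hi⟩
      obtain ⟨mf, rf, hf⟩ := mulP_runs (d := 29) (c := 21) (x := V 25) (y := V 2)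
        (m₀ := md.set 28 0 (S (E (j / n)) ⟨j % n, hi⟩)) (j / n / D) n (by decide)
        (fun m' hm' => by
          rw [eval_V, hm' 25 (by decide) (by decide), r28.frame 25 rfl, rd.frame 25 rfl, hb])
        (fun m' hm' => by rw [eval_V, hm' 2 (by decide) (by decide), r28.frame 2 rfl,
          rd.frame 2 rfl, rb.frame 2 rfl, ra.frame 2 rfl, f2])
        (by decide) (by decide)
      have hEu := hEk _ hu
      refine ⟨_, (ra.seq (rb.seq (rd.seq (r28.seq (rf.seq (Runs.write (j := j)
        (x := flat n (fun u => S (u / D) * S (E u)) j) (T := 50) mf ?_ ?_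
        (by decide))))))).mono (by omega), ?_⟩
      · rw [eval_V, rf.frame 20 rfl, r28.frame 20 rfl, rd.frame 20 rfl, rb.frame 20 rfl,
          ra.frame 20 rfl, hc]
      · simp only [Expr.eval]
        rw [hf, rf.frame 28 rfl, Memory.set_same, rf.frame 6 rfl, r28.frame 6 rfl,
          rd.frame 6 rfl, rb.frame 6 rfl, ra.frame 6 rfl, f6, hSS _ ho]
        simp only [flat, hn, dif_pos, Equiv.Perm.mul_apply]
      · intro a ha
        rcases Nat.lt_succ_iff_lt_or_eq.1 ha with ha | rfl
        · rw [Memory.set_addr _ _ _ _ (by omega), rf.frame 7 rfl, r28.frame 7 rfl,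
            rd.frame 7 rfl, rb.frame 7 rfl, ra.frame 7 rfl, hI a ha]
        · rw [Memory.set_same])
    (by simp)
  obtain ⟨m₃, r₃, h₃, -⟩ := copyP_runs (c := 20) (dst := 6) (src := 7) (dpos := .const 0)
    (spos := .const 0) (len := V 34) (m₀ := m₂) 0 0 (k * D * n) (by decide) (by decide) (by decide)
    (fun _ _ => rfl) (fun _ _ => rfl)
    (fun m hm => by rw [eval_V, hm 34 (by decide) (by decide), r₂.frame 34 rfl, h₁])
    (by decide) (by decide) (by decide)
  refine ⟨m₃, (r₁.seq (r₂.seq r₃)).mono ?_, ?_⟩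
  · have e1 := Nat.mul_le_mul hZ
      (show 2000 * (Z + 1) + 100 + 200 ≤ 4000 * (Z + 1) by omega)
    have aux : ∀ x y a b z : ℕ, x ≤ z → y ≤ z → a ≤ b →
        500 * (x + 1) + (a + 200 + 500 * (y + 1)) ≤ b + 2000 * (z + 1) := by
      intro x y a b z h1 h2 h3
      omega
    exact aux _ _ _ _ _ hZ' hZ e1
  · intro a ha
    have := h₃ a ha
    simp only [zero_add] at this
    rw [this, hI a ha]

/-- One derandomized squaring. -/
def squareP : Prog :=
  .seq tableP (.seq walkP (.seq composeP
    (.seq (mulP 35 21 (V 13) (.const (8 ^ (walkLength / 2))))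
      (.seq (setv 13 (V 35)) (setv 14 (V 32))))))

/-- The effect of one derandomized squaring on a family indexed by the vertices of the graph of
side `K`. -/
def squareStep {G : Type*} [Mul G] (x : ℕ × (ℕ → G)) : ℕ × (ℕ → G) :=
  (x.1 * 8 ^ (walkLength / 2),
    fun a => x.2 (a / 8 ^ walkLength) * x.2 (walkEnd x.1 walkLength a))

/-- The memory holds the number of points and a family of permutations. -/
structure Holds (m : Memory) (n : ℕ) (x : ℕ × (ℕ → Equiv.Perm (Fin n))) : Prop where
  pos : 0 < x.1
  points : m 2 0 = n
  side : m 13 0 = x.1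
  size : m 14 0 = x.1 * x.1
  entry : ∀ a < x.1 * x.1 * n, m 6 a = flat n x.2 a

/-- A time bound for one derandomized squaring. -/
def squareT (Z : ℕ) : ℕ :=
  walkLength * (Z * (1000 * (Z + 1)) + 1000 * (Z + 1) + 200) + 100000 * (Z + 1) * (Z + 1)

/-- The walk length is even, so the number of walks is again a perfect square, and the new family is
indexed by a larger Gabber–Galil graph without padding. -/
theorem squareStep_size {G : Type*} [Mul G] (x : ℕ × (ℕ → G)) :
    (squareStep x).1 * (squareStep x).1 = x.1 * x.1 * 8 ^ walkLength := by
  simp only [squareStep]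
  rw [mul_mul_mul_comm, ← pow_add]
  rfl

theorem squareP_runs {m₀ : Memory} {n Z : ℕ} {x : ℕ × (ℕ → Equiv.Perm (Fin n))}
    (h : Holds m₀ n x) (hZ : x.1 * x.1 * 8 ^ walkLength ≤ Z)
    (hZ' : x.1 * x.1 * 8 ^ walkLength * n ≤ Z) :
    ∃ m', Runs squareP m₀ m' (squareT Z) ∧ Holds m' n (squareStep x) := by
  have hKZ : x.1 * x.1 ≤ Z := (Nat.le_mul_of_pos_right _ (by positivity)).trans hZ
  have hKZ' : x.1 ≤ Z := (Nat.le_mul_of_pos_left _ h.pos).trans hKZ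
  obtain ⟨m₁, r₁, h₁⟩ := tableP_runs h.pos h.side h.size hKZ
  obtain ⟨m₂, r₂, h₂, h₂'⟩ := walkP_runs h.pos (by rw [r₁.frame 14 rfl, h.size]) h₁ hZ
  obtain ⟨m₃, r₃, h₃⟩ := composeP_runs (n := n) (k := x.1 * x.1) (S := x.2) rfl
    (by rw [r₂.frame 2 rfl, r₁.frame 2 rfl, h.points]) h₂ h₂' (fun a ha => walkEnd_lt h.pos _ a ha)
    (fun a ha => by rw [r₂.frame 6 rfl, r₁.frame 6 rfl, h.entry a ha]) hZ' hZ
  obtain ⟨m₄, r₄, h₄⟩ := mulP_runs (d := 35) (c := 21) (x := V 13)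
    (y := .const (8 ^ (walkLength / 2))) (m₀ := m₃) x.1 (8 ^ (walkLength / 2)) (by decide)
    (fun m hm => by rw [eval_V, hm 13 (by decide) (by decide), r₃.frame 13 rfl, r₂.frame 13 rfl,
      r₁.frame 13 rfl, h.side])
    (fun _ _ => rfl) (by decide) (by simp [Expr.cost])
  refine ⟨_, (r₁.seq (r₂.seq (r₃.seq (r₄.seq ((Runs.setv m₄ (x := (squareStep x).1) ?_ le_rfl).seq
    (Runs.setv _ (x := (squareStep x).1 * (squareStep x).1) ?_ le_rfl)))))).mono ?_, ?_, ?_, ?_,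
    ?_, ?_⟩
  · rw [eval_V, h₄]; rfl
  · rw [eval_V, Memory.set_bank _ _ _ (by decide), r₄.frame 32 rfl, r₃.frame 32 rfl, h₂,
      squareStep_size]
  -- The products are abstracted to variables, which leaves a linear inequality.
  · have aux : ∀ w x z y p : ℕ, x ≤ z → p = z * (z + 1) →
        z * (50000 * (z + 1)) = 50000 * p → z * (4000 * (z + 1)) = 4000 * p →
        100000 * (z + 1) * (z + 1) = 100000 * p + 100000 * (z + 1) →
        z * (50000 * (z + 1)) + 300 + (w + 1000 * (z + 1) + (z * (4000 * (z + 1)) +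
          2000 * (z + 1) + (500 * (x + 1) + ((V 35).cost + 2 + ((V 32).cost + 2))))) ≤
          w + 100000 * (z + 1) * (z + 1) := by
      intro w x z y p h1 _ h2 h3 h4
      rw [h2, h3, h4]
      simp only [Expr.cost]
      omega
    exact aux _ _ _ 0 _ hKZ' rfl (by ring) (by ring) (by ring)
  · exact Nat.mul_pos h.pos (by positivity)
  · rw [Memory.set_bank _ _ _ (by decide), Memory.set_bank _ _ _ (by decide), r₄.frame 2 rfl,
      r₃.frame 2 rfl, r₂.frame 2 rfl, r₁.frame 2 rfl, h.points]
  · rw [Memory.set_bank _ _ _ (by decide), Memory.set_same]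
  · rw [Memory.set_same]
  · intro a ha
    rw [squareStep_size] at ha
    rw [Memory.set_bank _ _ _ (by decide), Memory.set_bank _ _ _ (by decide), r₄.frame 6 rfl,
      h₃ a ha]
    rfl

end RAM

/-! ### The main program -/

namespace RAM

open GabberGalil CayleySpectrum

/-- Choose the side of the graph and extend the family periodically to all its vertices. -/
def sizeP : Prog :=
  .seq (mulP 11 21 (V 3) (V 4)) (.seq (mulP 12 21 (V 11) (V 2))
    (.seq (setv 13 (.const 1)) (.seq (setv 14 (.const 1))
    (.seq (.loop (.monus (V 11) (V 14)) (.seq (setv 13 (.add (V 13) (V 13)))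
      (setv 14 (.add (.add (V 14) (V 14)) (.add (V 14) (V 14))))))
    (.seq (mulP 22 21 (V 14) (V 2)) (extendP 21 6 (.const 0) (V 12) (V 22)))))))

/-- The least power of `b` that is at least `R`. It is used with `b = 4` for the size of the graph
and with `b = 2` for the number of amplification rounds. -/
theorem exists_pow_bounds {b R : ℕ} (hb : 1 < b) (hR : 0 < R) :
    ∃ J, R ≤ b ^ J ∧ b ^ J ≤ b * R ∧ ∀ k < J, b ^ k < R := by
  have hex : ∃ J, R ≤ b ^ J := ⟨R, (Nat.lt_pow_self hb).le⟩
  classical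
  refine ⟨Nat.find hex, Nat.find_spec hex, ?_, fun k hk => not_le.1 (Nat.find_min hex hk)⟩
  rcases h : Nat.find hex with _ | J
  · rw [pow_zero]; exact Nat.mul_pos (by omega) hR
  · have : b ^ J < R := not_le.1 (Nat.find_min hex (by omega))
    rw [pow_succ, mul_comm]
    exact Nat.mul_le_mul_left b this.le

theorem sizeP_time (a b c d e z : ℕ) (ha : a ≤ z) (hb : b ≤ z) (hc : c ≤ z) (hd : d ≤ z)
    (he : e ≤ z) :
    500 * (a + 1) + (500 * (b + 1) + ((Expr.const 1).cost + 2 + ((Expr.const 1).cost + 2 +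
      ((c * ((Expr.monus (V 11) (V 14)).cost + 1 + 100) + (Expr.monus (V 11) (V 14)).cost + 1) +
      (500 * (d + 1) + 500 * (e + 1)))))) ≤ 5000 * (z + 1) := by
  simp only [Expr.cost]
  omega

/-- The side `K` is doubled until `K * K ≥ r * s`, so rounding up costs at most a factor `4`. -/
theorem sizeP_runs {m₀ : Memory} {n r s Z : ℕ} {S : ℕ → Equiv.Perm (Fin n)}
    (hp : Params m₀ n r s) (hrs : 0 < r * s) (hS : ∀ a < r * s * n, m₀ 6 a = flat n S a)
    (hZ : 4 * (r * s) ≤ Z) (hZ' : 4 * (r * s) * n ≤ Z) :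
    ∃ m', Runs sizeP m₀ m' (5000 * (Z + 1)) ∧ ∃ K, r * s ≤ K * K ∧ K * K ≤ 4 * (r * s) ∧
      Holds m' n (K, fun v => S (v % (r * s))) := by
  obtain ⟨J, hJ, hJ', hJmin⟩ := exists_pow_bounds (b := 4) (by decide) hrs
  have hsq : ∀ k, 2 ^ k * 2 ^ k = 4 ^ k := fun k => by rw [← mul_pow]; norm_num
  obtain ⟨m₁, r₁, h₁⟩ := mulP_runs (d := 11) (c := 21) (x := V 3) (y := V 4) (m₀ := m₀) r s
    (by decide) (fun m hm => by rw [eval_V, hm 3 (by decide) (by decide), hp.r])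
    (fun m hm => by rw [eval_V, hm 4 (by decide) (by decide), hp.s]) (by decide) (by decide)
  obtain ⟨m₂, r₂, h₂⟩ := mulP_runs (d := 12) (c := 21) (x := V 11) (y := V 2) (m₀ := m₁) (r * s) n
    (by decide) (fun m hm => by rw [eval_V, hm 11 (by decide) (by decide), h₁])
    (fun m hm => by rw [eval_V, hm 2 (by decide) (by decide), r₁.frame 2 rfl, hp.n])
    (by decide) (by decide)
  obtain ⟨m₃, r₃, h13, h14⟩ := loop_runs (e := .monus (V 11) (V 14))
    (p := .seq (setv 13 (.add (V 13) (V 13)))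
      (setv 14 (.add (.add (V 14) (V 14)) (.add (V 14) (V 14)))))
    (m₀ := (m₂.set 13 0 1).set 14 0 1) J 100
    (fun k m => m 13 0 = 2 ^ k ∧ m 14 0 = 4 ^ k)
    (by
      rintro k hk m hm ⟨h13, h14⟩
      have f11 : m 11 0 = r * s := by
        rw [hm 11 rfl, Memory.set_bank _ _ _ (by decide), Memory.set_bank _ _ _ (by decide),
          r₂.frame 11 rfl, h₁]
      have := hJmin k hk
      refine ⟨by simp only [Expr.eval, f11, h14]; omega, _,
        ((Runs.setv m (x := 2 ^ (k + 1)) ?_ le_rfl).seq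
          (Runs.setv _ (x := 4 ^ (k + 1)) ?_ le_rfl)).mono (by decide), ?_, ?_⟩
      · simp only [Expr.eval, h13, pow_succ]; omega
      · simp only [Expr.eval]
        rw [Memory.set_bank _ _ _ (by decide), h14, pow_succ]; omega
      · rw [Memory.set_bank _ _ _ (by decide), Memory.set_same]
      · rw [Memory.set_same])
    (by
      rintro m hm ⟨h13, h14⟩
      have f11 : m 11 0 = r * s := by
        rw [hm 11 rfl, Memory.set_bank _ _ _ (by decide), Memory.set_bank _ _ _ (by decide),
          r₂.frame 11 rfl, h₁]
      simp only [Expr.eval, f11, h14]; omega)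
    ⟨by rw [Memory.set_bank _ _ _ (by decide), Memory.set_same]; rfl, by
      rw [Memory.set_same]; rfl⟩
  have fb : ∀ b, b ≠ 11 → b ≠ 12 → b ≠ 13 → b ≠ 14 → b ≠ 21 → m₃ b = m₀ b := by
    intro b h11 h12 h13 h14 h21
    rw [r₃.frame b (by simp [Prog.wr, h13, h14]), Memory.set_bank _ _ _ h14,
      Memory.set_bank _ _ _ h13, r₂.frame b (by simp [mulP, forP_wr, Prog.wr, h12, h21]),
      r₁.frame b (by simp [mulP, forP_wr, Prog.wr, h11, h21])]
  have f12 : m₃ 12 0 = r * s * n := by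
    rw [r₃.frame 12 rfl, Memory.set_bank _ _ _ (by decide), Memory.set_bank _ _ _ (by decide), h₂]
  obtain ⟨m₄, r₄, h₄⟩ := mulP_runs (d := 22) (c := 21) (x := V 14) (y := V 2) (m₀ := m₃) (4 ^ J) n
    (by decide) (fun m hm => by rw [eval_V, hm 14 (by decide) (by decide), h14])
    (fun m hm => by rw [eval_V, hm 2 (by decide) (by decide),
      fb 2 (by decide) (by decide) (by decide) (by decide) (by decide), hp.n])
    (by decide) (by decide)
  obtain ⟨m₅, r₅, h₅, -⟩ := extendP_runs (c := 21) (b := 6) (pos := .const 0) (len := V 12)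
    (tot := V 22) (m₀ := m₄) 0 (r * s * n) (4 ^ J * n) (flat n S) (by decide)
    (fun h => Nat.mul_pos hrs (Nat.pos_of_mul_pos_left h)) (Nat.mul_le_mul_right n hJ)
    (fun _ _ => rfl)
    (fun m hm => by rw [eval_V, hm 12 (by decide) (by decide), r₄.frame 12 rfl, f12])
    (fun m hm => by rw [eval_V, hm 22 (by decide) (by decide), h₄])
    (by decide) (by decide) (by decide)
    (fun a ha => by rw [zero_add, r₄.frame 6 rfl,
      fb 6 (by decide) (by decide) (by decide) (by decide) (by decide), hS a ha])
  refine ⟨m₅, (r₁.seq (r₂.seq ((Runs.setv m₂ (x := 1) rfl le_rfl).seq ((Runs.setv _ (x := 1) rfl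
    le_rfl).seq (r₃.seq (r₄.seq r₅)))))).mono ?_, 2 ^ J, by rw [hsq]; exact hJ,
    by rw [hsq]; exact hJ', ?_, ?_, ?_, ?_, ?_⟩
  · refine sizeP_time _ _ _ _ _ _ ?_ ?_ ?_ ?_ ?_
    · exact (Nat.le_mul_of_pos_right r (Nat.pos_of_mul_pos_left hrs)).trans (by omega)
    · omega
    · exact (Nat.lt_pow_self (by decide)).le.trans (hJ'.trans hZ)
    · exact hJ'.trans hZ
    · exact (Nat.mul_le_mul_right n hJ').trans hZ'
  · positivity
  · rw [r₅.frame 2 rfl, r₄.frame 2 rfl,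
      fb 2 (by decide) (by decide) (by decide) (by decide) (by decide), hp.n]
  · rw [r₅.frame 13 rfl, r₄.frame 13 rfl, h13]
  · rw [r₅.frame 14 rfl, r₄.frame 14 rfl, h14, hsq]
  · intro a ha
    simp only [hsq] at ha
    have := h₅ a ha
    rw [zero_add] at this
    rw [this]
    refine flat_congr ?_ ?_
    · rw [mod_mul_div]
    · rw [mul_comm, Nat.mod_mul_right_mod]

/-- Amplify the spectral gap. -/
def amplifyP : Prog :=
  .seq (setv 15 (.const 1)) (.loop (.monus (oct (V 3)) (V 15))
    (.seq (setv 15 (.add (V 15) (V 15)))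
      (.seq squareP (.seq squareP (.seq squareP squareP)))))

theorem squareStep_iterate_size {G : Type*} [Mul G] (x : ℕ × (ℕ → G)) (k : ℕ) :
    (squareStep^[k] x).1 * (squareStep^[k] x).1 = x.1 * x.1 * (8 ^ walkLength) ^ k := by
  induction k with
  | zero => simp
  | succ k ih =>
    rw [Function.iterate_succ_apply', squareStep_size, ih, pow_succ (8 ^ walkLength) k, mul_assoc]

theorem squareP_iterate_runs {m₀ : Memory} {n Z k N : ℕ} {x : ℕ × (ℕ → Equiv.Perm (Fin n))}
    (h : Holds m₀ n (squareStep^[k] x)) (hk : k + 1 ≤ N)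
    (hZ : x.1 * x.1 * (8 ^ walkLength) ^ N ≤ Z)
    (hZ' : x.1 * x.1 * (8 ^ walkLength) ^ N * n ≤ Z) :
    ∃ m', Runs squareP m₀ m' (squareT Z) ∧ Holds m' n (squareStep^[k + 1] x) := by
  have hle : (squareStep^[k] x).1 * (squareStep^[k] x).1 * 8 ^ walkLength ≤
      x.1 * x.1 * (8 ^ walkLength) ^ N := by
    rw [squareStep_iterate_size, mul_assoc, ← pow_succ]
    exact Nat.mul_le_mul_left _ (Nat.pow_le_pow_right (by positivity) hk)
  rw [Function.iterate_succ_apply']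
  exact squareP_runs h (hle.trans hZ) ((Nat.mul_le_mul_right n hle).trans hZ')

theorem amplifyP_time (J T c Z : ℕ) (hJ : J ≤ Z) (hc : c ≤ 100) :
    (Expr.const 1).cost + 2 + (J * (c + 1 + (10 + (T + (T + (T + T))))) + c + 1) ≤
      Z * (4 * T + 200) + 200 := by
  have := Nat.mul_le_mul hJ (show c + 1 + (10 + (T + (T + (T + T)))) ≤ 4 * T + 200 by omega)
  simp only [Expr.cost]
  omega

/-- Bank `15` doubles in every round until it reaches `8 * r`, and each round performs four
squarings. All intermediate families are bounded by the final one, so a single `Z` governs every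
round. -/
theorem amplifyP_runs {m₀ : Memory} {n r Z : ℕ} {x : ℕ × (ℕ → Equiv.Perm (Fin n))}
    (h : Holds m₀ n x) (hr : m₀ 3 0 = r) (hr0 : 0 < r) (hrZ : 16 * r ≤ Z)
    (hZ : ∀ J, 2 ^ J ≤ 16 * r → x.1 * x.1 * (8 ^ walkLength) ^ (4 * J) ≤ Z ∧
      x.1 * x.1 * (8 ^ walkLength) ^ (4 * J) * n ≤ Z) :
    ∃ m', Runs amplifyP m₀ m' (Z * (4 * squareT Z + 200) + 200) ∧
      ∃ J, 8 * r ≤ 2 ^ J ∧ 2 ^ J ≤ 16 * r ∧ Holds m' n (squareStep^[4 * J] x) := by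
  obtain ⟨J, hJ, hJ', hJmin⟩ := exists_pow_bounds (b := 2) (R := 8 * r) (by decide) (by omega)
  replace hJ' : 2 ^ J ≤ 16 * r := by omega
  obtain ⟨hZ, hZ'⟩ := hZ J hJ'
  have f3 : ∀ m : Memory, (∀ b, (Prog.seq (setv 15 (.add (V 15) (V 15)))
      (.seq squareP (.seq squareP (.seq squareP squareP)))).wr b = false →
      m b = m₀.set 15 0 1 b) → m 3 0 = r := fun m hm => by
    rw [hm 3 rfl, Memory.set_bank _ _ _ (by decide), hr]
  obtain ⟨m', h', h15, hH⟩ := loop_runs (e := .monus (oct (V 3)) (V 15))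
    (p := .seq (setv 15 (.add (V 15) (V 15)))
      (.seq squareP (.seq squareP (.seq squareP squareP))))
    (m₀ := m₀.set 15 0 1) J (10 + (squareT Z + (squareT Z + (squareT Z + squareT Z))))
    (fun k m => m 15 0 = 2 ^ k ∧ Holds m n (squareStep^[4 * k] x))
    (by
      rintro k hk m hm ⟨h15, hH⟩
      have := hJmin k hk
      have h0 : Holds (m.set 15 0 (2 ^ (k + 1))) n (squareStep^[4 * k] x) :=
        ⟨hH.pos, hH.points, hH.side, hH.size, hH.entry⟩
      obtain ⟨m₁, r₁, h₁⟩ := squareP_iterate_runs h0 (N := 4 * J) (by omega) hZ hZ'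
      obtain ⟨m₂, r₂, h₂⟩ := squareP_iterate_runs h₁ (N := 4 * J) (by omega) hZ hZ'
      obtain ⟨m₃, r₃, h₃⟩ := squareP_iterate_runs h₂ (N := 4 * J) (by omega) hZ hZ'
      obtain ⟨m₄, r₄, h₄⟩ := squareP_iterate_runs h₃ (N := 4 * J) (by omega) hZ hZ'
      refine ⟨?_, m₄, (Runs.setv m (x := 2 ^ (k + 1)) ?_ (by decide)).seq
        (r₁.seq (r₂.seq (r₃.seq r₄))), ?_, h₄⟩
      · rw [Expr.eval, oct_eval, eval_V, eval_V, f3 m hm, h15]; omega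
      · simp only [Expr.eval, h15, pow_succ]; omega
      · rw [r₄.frame 15 rfl, r₃.frame 15 rfl, r₂.frame 15 rfl, r₁.frame 15 rfl, Memory.set_same])
    (by
      rintro m hm ⟨h15, -⟩
      rw [Expr.eval, oct_eval, eval_V, eval_V, f3 m hm, h15]; omega)
    ⟨by rw [Memory.set_same, pow_zero], h.pos, h.points, h.side, h.size, h.entry⟩
  refine ⟨m', ((Runs.setv m₀ (x := 1) rfl le_rfl).seq h').mono ?_, J, hJ, hJ', hH⟩
  exact amplifyP_time _ _ _ _ ((Nat.lt_pow_self (by decide)).le.trans (hJ'.trans hrZ)) (by decide)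

/-- The exponent of the length of the series in the length of the output. -/
abbrev degree : ℕ := 2000

/-- Compute the length of the output. -/
def powerP : Prog :=
  .seq (setv 36 (V 4)) (forP 20 (.const degree)
    (.seq (mulP 37 21 (V 36) (V 3)) (setv 36 (V 37))))

theorem powerP_runs {m₀ : Memory} {n r s Z : ℕ} (hp : Params m₀ n r s) (hr : 0 < r)
    (hZ : s * r ^ degree ≤ Z) :
    ∃ m', Runs powerP m₀ m' (degree * (1000 * (Z + 1) + 200) + 300) ∧
      m' 36 0 = s * r ^ degree := by
  obtain ⟨m', h', hI⟩ := forP_runs (c := 20) (N := .const degree)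
    (body := .seq (mulP 37 21 (V 36) (V 3)) (setv 36 (V 37))) (m₀ := m₀.set 36 0 s) degree
    (1000 * (Z + 1)) (fun k m => m 36 0 = s * r ^ k) rfl (by decide) (fun _ _ => rfl)
    (fun k m v h => by rwa [Memory.set_bank _ _ _ (by decide)])
    (by
      intro k hk m hm hc hI
      have f3 : m 3 0 = r := by
        rw [hm 3 rfl (by decide), Memory.set_bank _ _ _ (by decide), hp.r]
      have hle : s * r ^ k ≤ Z :=
        (Nat.mul_le_mul_left s (Nat.pow_le_pow_right hr hk.le)).trans hZ
      obtain ⟨ma, ra, ha⟩ := mulP_runs (d := 37) (c := 21) (x := V 36) (y := V 3) (m₀ := m)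
        (s * r ^ k) r (by decide)
        (fun m' hm' => by rw [eval_V, hm' 36 (by decide) (by decide), hI])
        (fun m' hm' => by rw [eval_V, hm' 3 (by decide) (by decide), f3])
        (by decide) (by decide)
      refine ⟨_, (ra.seq (Runs.setv ma (x := s * r ^ (k + 1)) (T := 20) ?_ (by decide))).mono ?_,
        Memory.set_same _ _ _ _⟩
      · rw [eval_V, ha, pow_succ, mul_assoc]
      · generalize s * r ^ k = y at hle
        clear * - hle
        omega)
    (by rw [Memory.set_same, pow_zero, mul_one])
  refine ⟨m', ((Runs.setv m₀ (x := s) (T := 20) (by rw [eval_V, hp.s]) (by decide)).seq h').mono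
    ?_, hI⟩
  generalize degree * (1000 * (Z + 1) + 200) = W
  clear * -
  omega

theorem loop_time {a z : ℕ} (h : a ≤ z) :
    a * (500 * (z + 1) + 100 + 200) + 200 ≤ z * (1000 * (z + 1)) + 200 :=
  Nat.add_le_add_right (Nat.mul_le_mul h (by omega)) _

/-- Write the inverses of the family behind the family. -/
def inverseP : Prog :=
  forP 20 (V 34) (.seq (divmodP 23 24 (V 20) (V 2))
    (.write 1 (.add (.add (.const 1) (V 34)) (.add (.monus (V 20) (V 24)) (.read 6 (V 20))))
      (V 24)))

/-- The inverse is written by scattering: the cell whose position is the image of a point receives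
that point. -/
theorem inverseP_runs {m₀ : Memory} {n k Z : ℕ} {S : ℕ → Equiv.Perm (Fin n)} (h2 : m₀ 2 0 = n)
    (h34 : m₀ 34 0 = k * n) (h6 : ∀ a < k * n, m₀ 6 a = flat n S a)
    (h1 : ∀ a < k * n, m₀ 1 (1 + a) = flat n S a) (hZ : k * n ≤ Z) :
    ∃ m', Runs inverseP m₀ m' (Z * (1000 * (Z + 1)) + 200) ∧ ∀ a < 2 * k * n,
      m' 1 (1 + a) = flat n (fun u => if u < k then S u else (S (u - k))⁻¹) a := by
  obtain ⟨m', h', hI, hI'⟩ := forP_runs (c := 20) (N := V 34)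
    (body := .seq (divmodP 23 24 (V 20) (V 2))
      (.write 1 (.add (.add (.const 1) (V 34)) (.add (.monus (V 20) (V 24)) (.read 6 (V 20))))
        (V 24))) (m₀ := m₀) (k * n) (500 * (Z + 1) + 100)
    (fun j m => (∀ a < j, m 1 (1 + k * n + (a / n * n + flat n S a)) = a % n) ∧
      ∀ a < k * n, m 1 (1 + a) = flat n S a) rfl (by decide)
    (fun m hm => by rw [eval_V, hm 34 rfl (by decide), h34])
    (fun k m v h => by rwa [Memory.set_bank _ _ _ (by decide)])
    (by
      rintro j hj m hm hc ⟨hI, hI'⟩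
      have hn : 0 < n := Nat.pos_of_ne_zero (by rintro rfl; simp at hj)
      obtain ⟨ma, ra, -, ha⟩ := divmodP_runs (q := 23) (d := 24) (v := V 20) (k := V 2)
        (m₀ := m) j n (by decide) hn (by rw [eval_V, hc])
        (fun m' hm' => by rw [eval_V, hm' 2 (by decide) (by decide), hm 2 rfl (by decide), h2])
        (by decide) (by decide)
      have hsub : j - j % n = j / n * n := by
        have := Nat.div_add_mod j n
        rw [mul_comm] at this
        omega
      refine ⟨_, (ra.seq (Runs.write (j := 1 + k * n + (j / n * n + flat n S j)) (x := j % n)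
        (T := 100) ma ?_ ?_ (by decide))).mono (by omega), ?_, ?_⟩
      · simp only [Expr.eval]
        rw [ra.frame 34 rfl, ra.frame 20 rfl, ra.frame 6 rfl, ha, hm 34 rfl (by decide), h34, hc,
          hm 6 rfl (by decide), h6 j hj, hsub]
      · rw [eval_V, ha]
      · intro a haj
        -- A coincidence of target cells forces the same permutation and, by injectivity, the same
        -- point, so no earlier entry is spoiled.
        by_cases e : a / n * n + flat n S a = j / n * n + flat n S j
        · have hfa := flat_lt hn S a
          have hfj := flat_lt hn S j
          have hd : a / n = j / n := by
            have h1 := congrArg (· / n) e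
            simpa only [mul_comm _ n, Nat.mul_add_div hn, Nat.div_eq_of_lt hfa,
              Nat.div_eq_of_lt hfj, add_zero] using h1
          have hm' : a % n = j % n := by
            rw [hd] at e
            have e2 : flat n S a = flat n S j := by omega
            simp only [flat, hn, dif_pos, hd] at e2
            exact congrArg Fin.val ((S (j / n)).injective (Fin.ext e2))
          rw [e, Memory.set_same, hm']
        · rw [Memory.set_addr _ _ _ _ (by omega), ra.frame 1 rfl]
          rcases Nat.lt_succ_iff_lt_or_eq.1 haj with haj | rfl
          · exact hI a haj
          · exact absurd rfl e
      · intro a ha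
        rw [Memory.set_addr _ _ _ _ (by omega), ra.frame 1 rfl, hI' a ha])
    ⟨by simp, h1⟩
  refine ⟨m', h'.mono (loop_time hZ), ?_⟩
  intro a ha
  have hn : 0 < n := Nat.pos_of_ne_zero (by rintro rfl; simp at ha)
  rcases Nat.lt_or_ge a (k * n) with hak | hak
  · rw [hI' a hak]
    have : a / n < k := Nat.div_lt_of_lt_mul (by rwa [mul_comm])
    exact flat_congr (by rw [if_pos this]) rfl
  · obtain ⟨c, rfl⟩ := Nat.exists_eq_add_of_le hak
    have hc : c < k * n := by rw [two_mul, add_mul] at ha; omega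
    have hv : c / n < k := Nat.div_lt_of_lt_mul (by rwa [mul_comm])
    have hdiv : (k * n + c) / n = k + c / n := by
      rw [mul_comm, Nat.mul_add_div hn]
    have hmod : (k * n + c) % n = c % n := by rw [mul_comm, Nat.mul_add_mod]
    set i : Fin n := ⟨c % n, Nat.mod_lt c hn⟩ with hi
    set y : Fin n := (S (c / n))⁻¹ i with hy
    have h3 : flat n S (c / n * n + y) = c % n := by rw [flat_mul_add, hy]; simp [hi]
    have h4 : (c / n * n + (y : ℕ)) / n = c / n := by
      rw [mul_comm, Nat.mul_add_div hn, Nat.div_eq_of_lt y.2, add_zero]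
    have h5 : (c / n * n + (y : ℕ)) % n = y := by
      rw [mul_comm, Nat.mul_add_mod, Nat.mod_eq_of_lt y.2]
    have h6 : c / n * n + (y : ℕ) < k * n := by
      have := Nat.mul_le_mul_right n (show c / n + 1 ≤ k from hv)
      rw [add_mul, one_mul] at this
      have := y.2
      omega
    have h7 := hI _ h6
    rw [h3, h4, h5, mul_comm (c / n) n, Nat.div_add_mod, add_assoc] at h7
    rw [h7]
    simp [flat, hn, hdiv, hmod, hy, hi]

/-- Write the identity permutations behind the output. -/
def identitiesP : Prog :=
  forP 20 (V 43) (.seq (divmodP 23 24 (V 20) (V 2))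
    (.write 1 (.add (.add (.const 1) (V 41)) (V 20)) (V 24)))

theorem identitiesP_runs {m₀ : Memory} {n e L Z : ℕ} (h2 : m₀ 2 0 = n) (h43 : m₀ 43 0 = e * n)
    (h41 : m₀ 41 0 = L) (hZ : e * n ≤ Z) :
    ∃ m', Runs identitiesP m₀ m' (Z * (1000 * (Z + 1)) + 200) ∧
      (∀ a < e * n, m' 1 (1 + L + a) = a % n) ∧ ∀ a < L, m' 1 (1 + a) = m₀ 1 (1 + a) := by
  obtain ⟨m', h', hI⟩ := forP_runs (c := 20) (N := V 43)
    (body := .seq (divmodP 23 24 (V 20) (V 2))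
      (.write 1 (.add (.add (.const 1) (V 41)) (V 20)) (V 24))) (m₀ := m₀) (e * n)
    (500 * (Z + 1) + 100)
    (fun j m => (∀ a < j, m 1 (1 + L + a) = a % n) ∧ ∀ a < L, m 1 (1 + a) = m₀ 1 (1 + a))
    rfl (by decide)
    (fun m hm => by rw [eval_V, hm 43 rfl (by decide), h43])
    (fun k m v h => by rwa [Memory.set_bank _ _ _ (by decide)])
    (by
      rintro j hj m hm hc ⟨hI, hI'⟩
      have hn : 0 < n := Nat.pos_of_ne_zero (by rintro rfl; simp at hj)
      obtain ⟨ma, ra, -, ha⟩ := divmodP_runs (q := 23) (d := 24) (v := V 20) (k := V 2)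
        (m₀ := m) j n (by decide) hn (by rw [eval_V, hc])
        (fun m' hm' => by rw [eval_V, hm' 2 (by decide) (by decide), hm 2 rfl (by decide), h2])
        (by decide) (by decide)
      refine ⟨_, (ra.seq (Runs.write (j := 1 + L + j) (x := j % n) (T := 100) ma ?_ ?_
        (by decide))).mono (by omega), ?_, ?_⟩
      · simp only [Expr.eval]
        rw [ra.frame 41 rfl, ra.frame 20 rfl, hm 41 rfl (by decide), h41, hc]
      · rw [eval_V, ha]
      · intro a haj
        rcases Nat.lt_succ_iff_lt_or_eq.1 haj with haj | rfl
        · rw [Memory.set_addr _ _ _ _ (by omega), ra.frame 1 rfl, hI a haj]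
        · rw [Memory.set_same]
      · intro a ha
        rw [Memory.set_addr _ _ _ _ (by omega), ra.frame 1 rfl, hI' a ha])
    ⟨by simp, by simp⟩
  refine ⟨m', h'.mono (loop_time hZ), hI⟩

/-- Write the output. -/
def outputP : Prog :=
  .seq (mulP 34 21 (V 14) (V 2)) (.seq (copyP 20 1 (.const 1) 6 (.const 0) (V 34))
    (.seq inverseP (.seq (setv 38 (.add (V 14) (V 14))) (.seq (divmodP 39 40 (V 36) (V 38))
    (.seq (mulP 41 21 (.monus (V 36) (V 40)) (V 2)) (.seq (setv 42 (.add (V 34) (V 34)))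
    (.seq (extendP 20 1 (.const 1) (V 42) (V 41)) (.seq (mulP 43 21 (V 40) (V 2))
    (.seq identitiesP (.write 1 (.const 0) (V 36)))))))))))

theorem outputP_time (a b W c d e f z : ℕ) (ha : a ≤ z) (hb : b ≤ z) (hc : c ≤ z) (hd : d ≤ z)
    (he : e ≤ z) (hf : f ≤ z) :
    500 * (a + 1) + (500 * (b + 1) + (W + 200 + (20 + (500 * (c + 1) + (500 * (d + 1) + (20 +
      (500 * (e + 1) + (500 * (f + 1) + (W + 200 + 20))))))))) ≤
      2 * W + 4000 * (z + 1) := by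
  omega

/-- With `k` the size of the family, the period consists of its `k` members and their inverses. It
is repeated up to the largest multiple of `2 * k` below or equal to `N`, and the `N % (2 * k)`
remaining places receive identities. -/
theorem outputP_runs {m₀ : Memory} {n N Z : ℕ} {x : ℕ × (ℕ → Equiv.Perm (Fin n))}
    (h : Holds m₀ n x) (h36 : m₀ 36 0 = N) (hN : 2 * (x.1 * x.1) ≤ N) (hZ : N ≤ Z)
    (hZ' : N * n ≤ Z) :
    ∃ m', Runs outputP m₀ m' (2 * (Z * (1000 * (Z + 1))) + 4000 * (Z + 1)) ∧ m' 1 0 = N ∧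
      ∀ a < N * n, m' 1 (1 + a) =
        flat n (symmetrized x.2 (x.1 * x.1) (N / (2 * (x.1 * x.1)))) a := by
  have hk0 : 0 < x.1 * x.1 := Nat.mul_pos h.pos h.pos
  have h6 := h.entry
  have h14 := h.size
  have h2 := h.points
  generalize x.1 * x.1 = k at *
  generalize x.2 = S at *
  have hdm := Nat.div_add_mod N (2 * k)
  have hml : N % (2 * k) < 2 * k := Nat.mod_lt _ (by omega)
  have hkn : k * n ≤ Z := (Nat.mul_le_mul_right n (by omega)).trans hZ'
  obtain ⟨m₁, r₁, h₁⟩ := mulP_runs (d := 34) (c := 21) (x := V 14) (y := V 2) (m₀ := m₀) k n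
    (by decide) (fun m hm => by rw [eval_V, hm 14 (by decide) (by decide), h14])
    (fun m hm => by rw [eval_V, hm 2 (by decide) (by decide), h2]) (by decide) (by decide)
  obtain ⟨m₂, r₂, h₂, -⟩ := copyP_runs (c := 20) (dst := 1) (src := 6) (dpos := .const 1)
    (spos := .const 0) (len := V 34) (m₀ := m₁) 1 0 (k * n) (by decide) (by decide) (by decide)
    (fun _ _ => rfl) (fun _ _ => rfl)
    (fun m hm => by rw [eval_V, hm 34 (by decide) (by decide), h₁])
    (by decide) (by decide) (by decide)
  have f6 : ∀ a < k * n, m₁ 6 a = flat n S a := fun a ha => by rw [r₁.frame 6 rfl, h6 a ha]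
  obtain ⟨m₃, r₃, h₃⟩ := inverseP_runs (m₀ := m₂) (n := n) (k := k) (S := S)
    (by rw [r₂.frame 2 rfl, r₁.frame 2 rfl, h2]) (by rw [r₂.frame 34 rfl, h₁])
    (fun a ha => by rw [r₂.frame 6 rfl, f6 a ha])
    (fun a ha => by rw [h₂ a ha, zero_add, f6 a ha]) hkn
  have r₄ : Runs (setv 38 (.add (V 14) (V 14))) m₃ (m₃.set 38 0 (2 * k)) 20 := by
    refine Runs.setv m₃ ?_ (by decide)
    simp only [Expr.eval]
    rw [r₃.frame 14 rfl, r₂.frame 14 rfl, r₁.frame 14 rfl, h14]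
    omega
  set m₄ := m₃.set 38 0 (2 * k) with hm₄
  have h38 : m₄ 38 0 = 2 * k := Memory.set_same _ _ _ _
  have g36 : m₄ 36 0 = N := by
    rw [r₄.frame 36 rfl, r₃.frame 36 rfl, r₂.frame 36 rfl, r₁.frame 36 rfl, h36]
  have g2 : m₄ 2 0 = n := by
    rw [r₄.frame 2 rfl, r₃.frame 2 rfl, r₂.frame 2 rfl, r₁.frame 2 rfl, h2]
  have g34 : m₄ 34 0 = k * n := by
    rw [r₄.frame 34 rfl, r₃.frame 34 rfl, r₂.frame 34 rfl, h₁]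
  obtain ⟨m₅, r₅, -, h₅⟩ := divmodP_runs (q := 39) (d := 40) (v := V 36) (k := V 38)
    (m₀ := m₄) N (2 * k) (by decide) (by omega) (by rw [eval_V, g36])
    (fun m hm => by rw [eval_V, hm 38 (by decide) (by decide), h38]) (by decide) (by decide)
  obtain ⟨m₆, r₆, h₆⟩ := mulP_runs (d := 41) (c := 21) (x := .monus (V 36) (V 40)) (y := V 2)
    (m₀ := m₅) (N - N % (2 * k)) n (by decide)
    (fun m hm => by rw [Expr.eval, eval_V, eval_V, hm 36 (by decide) (by decide),
      hm 40 (by decide) (by decide), h₅, r₅.frame 36 rfl, g36])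
    (fun m hm => by rw [eval_V, hm 2 (by decide) (by decide), r₅.frame 2 rfl, g2])
    (by decide) (by decide)
  have r₇ : Runs (setv 42 (.add (V 34) (V 34))) m₆ (m₆.set 42 0 (2 * k * n)) 20 := by
    refine Runs.setv m₆ ?_ (by decide)
    simp only [Expr.eval]
    rw [r₆.frame 34 rfl, r₅.frame 34 rfl, g34, mul_assoc]
    omega
  set m₇ := m₆.set 42 0 (2 * k * n) with hm₇
  have h42 : m₇ 42 0 = 2 * k * n := Memory.set_same _ _ _ _
  have h1 : m₇ 1 = m₃ 1 := by
    rw [r₇.frame 1 rfl, r₆.frame 1 rfl, r₅.frame 1 rfl, r₄.frame 1 rfl]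
  have hq : 2 * k * 1 ≤ 2 * k * (N / (2 * k)) :=
    Nat.mul_le_mul_left _ (Nat.div_pos hN (by omega))
  have hlen : 2 * k * n ≤ (N - N % (2 * k)) * n := Nat.mul_le_mul_right n (by omega)
  obtain ⟨m₈, r₈, h₈, -⟩ := extendP_runs (c := 20) (b := 1) (pos := .const 1) (len := V 42)
    (tot := V 41) (m₀ := m₇) 1 (2 * k * n) ((N - N % (2 * k)) * n)
    (flat n (fun u => if u < k then S u else (S (u - k))⁻¹)) (by decide)
    (fun h => Nat.mul_pos (by omega) (Nat.pos_of_mul_pos_left h)) hlen (fun _ _ => rfl)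
    (fun m hm => by rw [eval_V, hm 42 (by decide) (by decide), h42])
    (fun m hm => by rw [eval_V, hm 41 (by decide) (by decide), r₇.frame 41 rfl, h₆])
    (by decide) (by decide) (by decide) (fun a ha => by rw [h1, h₃ a ha])
  obtain ⟨m₉, r₉, h₉⟩ := mulP_runs (d := 43) (c := 21) (x := V 40) (y := V 2)
    (m₀ := m₈) (N % (2 * k)) n (by decide)
    (fun m hm => by rw [eval_V, hm 40 (by decide) (by decide), r₈.frame 40 rfl, r₇.frame 40 rfl,
      r₆.frame 40 rfl, h₅])
    (fun m hm => by rw [eval_V, hm 2 (by decide) (by decide), r₈.frame 2 rfl, r₇.frame 2 rfl,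
      r₆.frame 2 rfl, r₅.frame 2 rfl, g2])
    (by decide) (by decide)
  have hen : N % (2 * k) * n ≤ Z := (Nat.mul_le_mul_right n (Nat.mod_le _ _)).trans hZ'
  obtain ⟨m', r', h', h''⟩ := identitiesP_runs (m₀ := m₉) (n := n) (e := N % (2 * k))
    (L := (N - N % (2 * k)) * n)
    (by rw [r₉.frame 2 rfl, r₈.frame 2 rfl, r₇.frame 2 rfl, r₆.frame 2 rfl, r₅.frame 2 rfl, g2])
    h₉ (by rw [r₉.frame 41 rfl, r₈.frame 41 rfl, r₇.frame 41 rfl, h₆]) hen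
  refine ⟨_, (r₁.seq (r₂.seq (r₃.seq (r₄.seq (r₅.seq (r₆.seq (r₇.seq (r₈.seq (r₉.seq (r'.seq
    (Runs.write (j := 0) (x := N) (T := 20) m' rfl ?_ (by decide)))))))))))).mono ?_,
    Memory.set_same _ _ _ _, ?_⟩
  · rw [eval_V, r'.frame 36 rfl, r₉.frame 36 rfl, r₈.frame 36 rfl, r₇.frame 36 rfl,
      r₆.frame 36 rfl, r₅.frame 36 rfl, g36]
  · exact outputP_time _ _ _ _ _ _ _ _ (by omega) hkn hZ (by omega)
      ((Nat.mul_le_mul_right n (Nat.sub_le _ _)).trans hZ') (by omega)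
  · intro a ha
    have hn : 0 < n := Nat.pos_of_ne_zero (by rintro rfl; simp at ha)
    rw [Memory.set_addr _ _ _ _ (by omega)]
    rcases Nat.lt_or_ge a ((N - N % (2 * k)) * n) with hlt | hge
    · rw [h'' a hlt, r₉.frame 1 rfl, h₈ a hlt]
      have h10 : a / n < N / (2 * k) * (2 * k) := by
        rw [mul_comm (N / (2 * k))]
        refine Nat.div_lt_of_lt_mul ?_
        rw [mul_comm n]
        exact hlt.trans_le (Nat.mul_le_mul_right n (by omega))
      refine flat_congr ?_ ?_
      · rw [mod_mul_div, symmetrized, if_pos h10]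
      · rw [mul_comm (2 * k) n, Nat.mod_mul_right_mod]
    · obtain ⟨c, rfl⟩ := Nat.exists_eq_add_of_le hge
      have hc : c < N % (2 * k) * n := by
        have : N * n = (N - N % (2 * k)) * n + N % (2 * k) * n := by
          rw [← add_mul]; congr 1; have := Nat.mod_le N (2 * k); omega
        omega
      have h10 : ¬ ((N - N % (2 * k)) * n + c) / n < N / (2 * k) * (2 * k) := by
        have e : 2 * k * (N / (2 * k)) = N - N % (2 * k) := by omega
        rw [mul_comm _ n, Nat.mul_add_div hn, mul_comm (N / (2 * k)), e]
        exact not_lt.2 (Nat.le_add_right _ _)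
      rw [← add_assoc, h' c hc]
      simp only [flat, hn, dif_pos, symmetrized, if_neg h10, Equiv.Perm.one_apply]
      rw [mul_comm _ n, Nat.mul_add_mod]

end RAM

/-! ### The complete program and its polynomial time bound -/

namespace RAM

open GabberGalil CayleySpectrum

/-- Output the list of generators of a series of length one. -/
def copyOneP : Prog :=
  .seq (copyP 20 1 (.const 1) 0 (.const 3) (V 5)) (.write 1 (.const 0) (V 4))

theorem copyOneP_runs {m₀ : Memory} {n s Z : ℕ} {len : ℕ → ℕ} {b : ℕ → ℕ → Equiv.Perm (Fin n)}
    (h : Input m₀ n 1 len b) (hp : Params m₀ n 1 s) (h5 : m₀ 5 0 = s * n) (hlen : len 0 = s)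
    (hZ : s * n ≤ Z) :
    ∃ m', Runs copyOneP m₀ m' (500 * (Z + 1) + 20) ∧ m' 1 0 = s ∧
      ∀ a < s * n, m' 1 (1 + a) = flat n (b 0) a := by
  obtain ⟨m₁, r₁, h₁, -⟩ := copyP_runs (c := 20) (dst := 1) (src := 0) (dpos := .const 1)
    (spos := .const 3) (len := V 5) (m₀ := m₀) 1 3 (s * n) (by decide) (by decide) (by decide)
    (fun _ _ => rfl) (fun _ _ => rfl)
    (fun m hm => by rw [eval_V, hm 5 (by decide) (by decide), h5])
    (by decide) (by decide) (by decide)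
  refine ⟨_, (r₁.seq (Runs.write (j := 0) (x := s) (T := 20) m₁ rfl ?_ (by decide))).mono
    (by omega), Memory.set_same _ _ _ _, fun a ha => ?_⟩
  · rw [eval_V, r₁.frame 4 rfl, hp.s]
  · rw [Memory.set_addr _ _ _ _ (by omega), h₁ a ha]
    simpa using h.entry 0 one_pos a (by rwa [hlen])

/-- The main part of the program, for a series of length at least two. -/
def expandP : Prog := .seq loadP (.seq sizeP (.seq amplifyP (.seq powerP outputP)))

/-- The program. -/
def mainP : Prog :=
  .seq paramsP (.branch (V 4) (.seq (mulP 5 21 (V 4) (V 2))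
    (.branch (.monus (V 3) (.const 1)) expandP copyOneP)) .skip)

-- Since `8 ^ 32 = 2 ^ 96`, the growth over `4 * J` squarings is `(2 ^ J) ^ 384 ≤ (16 * r) ^ 384`.
-- For `r ≥ 2` the constants are absorbed by `16 ≤ r ^ 4` and `64 ≤ r ^ 6`, and the total exponent
-- is `1927`. The exponent `2000` leaves room to spare.
set_option exponentiation.threshold 2000 in
theorem amplified_size_le {k r s J : ℕ} (hr : 2 ≤ r) (hk : k ≤ 4 * (r * s))
    (hJ : 2 ^ J ≤ 16 * r) : 16 * (k * (8 ^ walkLength) ^ (4 * J)) ≤ s * r ^ degree := by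
  have h16 : 16 ≤ r ^ 4 := Nat.pow_le_pow_left hr 4
  have h64 : 64 ≤ r ^ 6 := Nat.pow_le_pow_left hr 6
  have e : (8 ^ walkLength) ^ (4 * J) = (2 ^ J) ^ 384 := by
    rw [show 8 ^ walkLength = 2 ^ 96 by norm_num, ← pow_mul, ← pow_mul]
    congr 1
    ring
  calc 16 * (k * (8 ^ walkLength) ^ (4 * J)) ≤ 16 * (4 * (r * s) * (r ^ 4 * r) ^ 384) := by
        rw [e]
        gcongr
        exact hJ.trans (Nat.mul_le_mul_right r h16)
    _ = 64 * (s * r * (r ^ 5) ^ 384) := by ring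
    _ ≤ r ^ 6 * (s * r * (r ^ 5) ^ 384) := by gcongr
    _ = s * r ^ 1927 := by rw [← pow_mul]; ring
    _ ≤ s * r ^ degree := Nat.mul_le_mul_left s (Nat.pow_le_pow_right (by omega) (by decide))

/-- The family of permutations that the program has computed when it halts. -/
def IsResult {n : ℕ} (r s : ℕ) (len : ℕ → ℕ) (b : ℕ → ℕ → Equiv.Perm (Fin n))
    (W : ℕ → Equiv.Perm (Fin n)) : Prop :=
  (r = 1 → W = b 0) ∧ (2 ≤ r → 0 < s → ∃ (K J : ℕ) (x : ℕ × (ℕ → Equiv.Perm (Fin n))),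
    r * s ≤ K * K ∧ 8 * r ≤ 2 ^ J ∧
    x = squareStep^[4 * J] (K, fun v =>
      (fun v => b (v / s) ((v % s) % max 1 (len (v / s)))) (v % (r * s))) ∧
    16 * (x.1 * x.1) ≤ s * r ^ degree ∧
    W = symmetrized x.2 (x.1 * x.1) (s * r ^ degree / (2 * (x.1 * x.1))))

/-- A time bound for the main part of the program. -/
def expandT (Z : ℕ) : ℕ :=
  Z * (3000 * (Z + 1)) + 300 + (5000 * (Z + 1) + (Z * (4 * squareT Z + 200) + 200 +
    (degree * (1000 * (Z + 1) + 200) + 300 + (2 * (Z * (1000 * (Z + 1))) + 4000 * (Z + 1)))))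

theorem expandP_runs {m₀ : Memory} {n r s Z : ℕ} {len : ℕ → ℕ} {b : ℕ → ℕ → Equiv.Perm (Fin n)}
    (h : Input m₀ n r len b) (hp : Params m₀ n r s) (h5 : m₀ 5 0 = s * n) (hr : 2 ≤ r)
    (hs : 0 < s) (hlen : ∀ i < r, len i ≤ s) (hb : ∀ i < r, len i = 0 → b i 0 = 1)
    (hZ : 16 * (s * r ^ degree) * (n + 1) ≤ Z) :
    ∃ m', Runs expandP m₀ m' (expandT Z) ∧ m' 1 0 = s * r ^ degree ∧ ∃ W,
      IsResult r s len b W ∧ ∀ a < s * r ^ degree * n, m' 1 (1 + a) = flat n W a := by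
  obtain ⟨N, hN⟩ : ∃ N, s * r ^ degree = N := ⟨_, rfl⟩
  have hrsN : r * s ≤ N := by
    rw [mul_comm, ← hN]
    exact Nat.mul_le_mul_left s (Nat.le_self_pow (by decide) r)
  have hsize : ∀ k J, k ≤ 4 * (r * s) → 2 ^ J ≤ 16 * r →
      16 * (k * (8 ^ walkLength) ^ (4 * J)) ≤ N := fun k J hk hJ =>
    (amplified_size_le hr hk hJ).trans hN.le
  rw [hN] at hZ ⊢
  have hN0 : 0 < N := (Nat.mul_pos (by omega) hs).trans_le hrsN
  have hrs : r ≤ r * s := Nat.le_mul_of_pos_right r hs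
  have hsr : s ≤ r * s := Nat.le_mul_of_pos_left s (by omega)
  have hZa : ∀ a, a ≤ 16 * N → a ≤ Z ∧ a * n ≤ Z := by
    intro a ha
    have h1 : a * (n + 1) ≤ Z := (Nat.mul_le_mul_right _ ha).trans hZ
    rw [mul_add, mul_one] at h1
    constructor <;> omega
  have hnZ : n ≤ Z := by
    have := (hZa 1 (by omega)).2
    omega
  obtain ⟨m₁, r₁, h₁⟩ := loadP_runs h hp h5 hs hlen hb hnZ (hZa s (by omega)).1
    (hZa s (by omega)).2
  obtain ⟨m₂, r₂, K, hK, hK', h₂⟩ := sizeP_runs (Z := Z)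
    (hp.frame (r₁.frame 2 rfl) (r₁.frame 3 rfl) (r₁.frame 4 rfl)) (Nat.mul_pos (by omega) hs) h₁
    (hZa _ (by omega)).1 (hZa _ (by omega)).2
  have h3 : m₂ 3 0 = r := by rw [r₂.frame 3 rfl, r₁.frame 3 rfl, hp.r]
  have hle : ∀ k, 16 * k ≤ N → k ≤ 16 * N := fun k hk => by omega
  obtain ⟨m₃, r₃, J, hJ, hJ', h₃⟩ := amplifyP_runs (Z := Z) h₂ h3 (by omega)
    (hZa _ (by omega)).1 (fun J hJ => hZa _ (hle _ (hsize _ J hK' hJ)))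
  have hx := hsize _ J hK' hJ'
  rw [← squareStep_iterate_size (K, fun v =>
      (fun v => b (v / s) ((v % s) % max 1 (len (v / s)))) (v % (r * s)))] at hx
  have hp₃ : Params m₃ n r s := hp.frame (by rw [r₃.frame 2 rfl, r₂.frame 2 rfl, r₁.frame 2 rfl])
    (by rw [r₃.frame 3 rfl, r₂.frame 3 rfl, r₁.frame 3 rfl])
    (by rw [r₃.frame 4 rfl, r₂.frame 4 rfl, r₁.frame 4 rfl])
  obtain ⟨m₄, r₄, h₄⟩ := powerP_runs (Z := Z) hp₃ (by omega)
    (by rw [hN]; exact (hZa N (by omega)).1)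
  generalize hxe : squareStep^[4 * J] (K, fun v =>
      (fun v => b (v / s) ((v % s) % max 1 (len (v / s)))) (v % (r * s))) = x at hx h₃
  have hx₄ : Holds m₄ n x := ⟨h₃.pos, by rw [r₄.frame 2 rfl, h₃.points],
    by rw [r₄.frame 13 rfl, h₃.side], by rw [r₄.frame 14 rfl, h₃.size],
    fun a ha => by rw [r₄.frame 6 rfl, h₃.entry a ha]⟩
  obtain ⟨m₅, r₅, h₅, h₅'⟩ := outputP_runs hx₄ (h₄.trans hN)
    ((Nat.mul_le_mul_right _ (by decide)).trans hx) (hZa N (by omega)).1 (hZa N (by omega)).2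
  refine ⟨m₅, (r₁.seq (r₂.seq (r₃.seq (r₄.seq r₅)))).mono (Nat.add_le_add_right
    (Nat.add_le_add_right (Nat.mul_le_mul_right _ (hZa r (by omega)).1) _) _), h₅, _,
    ⟨fun hr1 => by omega, fun _ _ => ⟨K, J, x, hK, hJ, hxe.symm, hx.trans hN.ge, rfl⟩⟩,
    fun a ha => by rw [hN]; exact h₅' a ha⟩

/-- A time bound for the program. -/
def mainT (x : ℕ) : ℕ :=
  x * 300 + 300 + (500 * (x + 1) + 100 + (expandT (16 * (x * x ^ degree) * (x + 1)) +
    500 * (16 * (x * x ^ degree) * (x + 1) + 1)))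

theorem mainT_le (a b c d e x : ℕ) (ha : a ≤ x) (hb : b ≤ x) (hc : c ≤ 20) (hd : d ≤ e) :
    a * 300 + 300 + ((V 4).cost + 1 + (500 * (b + 1) + (c + 1 + d))) ≤
      x * 300 + 300 + (500 * (x + 1) + 100 + e) := by
  have : (V 4).cost = 2 := rfl
  omega

theorem mainP_runs {m₀ : Memory} {n r s : ℕ} {len : ℕ → ℕ} {b : ℕ → ℕ → Equiv.Perm (Fin n)}
    (h : Input m₀ n r len b) (hr : 1 ≤ r) (hs : s = (Finset.range r).sup len)
    (hb : ∀ i < r, len i = 0 → b i 0 = 1) :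
    ∃ m', Runs mainP m₀ m' (mainT (n + s + r)) ∧ (0 < s → m' 1 0 = s * r ^ degree) ∧
      (s = 0 → m' 1 = m₀ 1) ∧ ∃ W,
      IsResult r s len b W ∧ ∀ a < s * r ^ degree * n, m' 1 (1 + a) = flat n W a := by
  have hlen : ∀ i < r, len i ≤ s := fun i hi => by
    rw [hs]; exact Finset.le_sup (f := len) (Finset.mem_range.2 hi)
  obtain ⟨m₁, r₁, hp⟩ := paramsP_runs h
  rw [← hs] at hp
  -- If all lists are empty, the program stops at once; the initial zero in bank `1` already encodes
  -- the empty list.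
  rcases Nat.eq_zero_or_pos s with rfl | hs0
  · refine ⟨m₁, (r₁.seq (Runs.branch_false (by rw [eval_V, hp.s]) (Runs.skip m₁))).mono ?_,
      fun h => absurd h (lt_irrefl 0), fun _ => r₁.frame 1 rfl, b 0,
      ⟨fun _ => rfl, fun _ h => absurd h (lt_irrefl 0)⟩, fun a ha => by simp at ha⟩
    have e : (V 4).cost + 1 + 1 ≤ 100 := by decide
    rw [mainT]
    generalize expandT _ = y
    generalize 16 * _ * (n + 0 + r + 1) = z
    omega
  obtain ⟨m₂, r₂, h₂⟩ := mulP_runs (d := 5) (c := 21) (x := V 4) (y := V 2) (m₀ := m₁) s n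
    (by decide) (fun m hm => by rw [eval_V, hm 4 (by decide) (by decide), hp.s])
    (fun m hm => by rw [eval_V, hm 2 (by decide) (by decide), hp.n])
    (by decide) (by decide)
  have hp₂ : Params m₂ n r s := hp.frame (r₂.frame 2 rfl) (r₂.frame 3 rfl) (r₂.frame 4 rfl)
  have hi₂ : Input m₂ n r len b := h.frame (by rw [r₂.frame 0 rfl, r₁.frame 0 rfl])
  have hV : (V 4).eval m₁ ≠ 0 := by rw [eval_V, hp.s]; omega
  obtain ⟨x, hx⟩ : ∃ x, n + s + r = x := ⟨_, rfl⟩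
  rw [hx]
  -- For `r = 1` the prescribed length is `s` itself, so the input list is copied unchanged.
  rcases eq_or_lt_of_le hr with rfl | hr2
  · have hl : len 0 = s := by rw [hs]; simp
    have hsn : s * n ≤ 16 * (x * x ^ degree) * (x + 1) := by
      have h1 : x ≤ x * x ^ degree := Nat.le_mul_of_pos_right x (Nat.pow_pos (by omega))
      exact Nat.mul_le_mul (by omega) (by omega)
    obtain ⟨m₃, r₃, h₃, h₃'⟩ := copyOneP_runs hi₂ hp₂ h₂ hl hsn
    refine ⟨m₃, (r₁.seq (Runs.branch_true hV (r₂.seq (Runs.branch_false ?_ r₃)))).mono ?_, ?_, ?_,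
      b 0, ⟨fun _ => rfl, fun h => by omega⟩, ?_⟩
    · rw [Expr.eval, eval_V, hp₂.r]; rfl
    · refine mainT_le _ _ _ _ _ _ (by omega) (by omega) (by decide) ?_
      have e : 20 ≤ expandT (16 * (x * x ^ degree) * (x + 1)) := by
        rw [expandT]
        generalize squareT _ = y
        generalize 16 * _ * (x + 1) = z
        omega
      omega
    · intro _; rw [h₃, one_pow, mul_one]
    · omega
    · rw [one_pow, mul_one]; exact h₃'
  · obtain ⟨m₃, r₃, h₃, W, hW, h₃'⟩ := expandP_runs hi₂ hp₂ h₂ hr2 hs0 hlen hb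
      (show _ ≤ 16 * (x * x ^ degree) * (x + 1) by
        refine Nat.mul_le_mul (Nat.mul_le_mul_left _ (Nat.mul_le_mul ?_
          (Nat.pow_le_pow_left ?_ _))) ?_ <;> omega)
    refine ⟨m₃, (r₁.seq (Runs.branch_true hV (r₂.seq (Runs.branch_true ?_ r₃)))).mono ?_,
      fun _ => h₃, by omega, W, hW, h₃'⟩
    · rw [Expr.eval, eval_V, hp₂.r]; simp only [Expr.eval]; omega
    · exact mainT_le _ _ _ _ _ _ (by omega) (by omega) (by decide) (Nat.le_add_right _ _)

/-- The bound for the running time is a polynomial. -/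
theorem exists_polynomial_mainT : ∃ P : Polynomial ℕ, ∀ x, P.eval x = mainT x := by
  let Z : Polynomial ℕ := 16 * (.X * .X ^ degree) * (.X + 1)
  let Q : Polynomial ℕ := walkLength * (Z * (1000 * (Z + 1)) + 1000 * (Z + 1) + 200) +
    100000 * (Z + 1) * (Z + 1)
  let E : Polynomial ℕ := Z * (3000 * (Z + 1)) + 300 + (5000 * (Z + 1) + (Z * (4 * Q + 200) + 200 +
    (degree * (1000 * (Z + 1) + 200) + 300 + (2 * (Z * (1000 * (Z + 1))) + 4000 * (Z + 1)))))
  refine ⟨.X * 300 + 300 + (500 * (.X + 1) + 100 + (E + 500 * (Z + 1))), fun x => ?_⟩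
  have hZ : Z.eval x = 16 * (x * x ^ degree) * (x + 1) := by simp [Z]
  have hQ : Q.eval x = squareT (16 * (x * x ^ degree) * (x + 1)) := by
    simp only [Q, Polynomial.eval_add, Polynomial.eval_mul, hZ, squareT, Polynomial.eval_natCast,
      Polynomial.eval_ofNat, Polynomial.eval_one, Nat.cast_id]
  have hE : E.eval x = expandT (16 * (x * x ^ degree) * (x + 1)) := by
    simp only [E, Polynomial.eval_add, Polynomial.eval_mul, hZ, hQ, expandT,
      Polynomial.eval_natCast, Polynomial.eval_ofNat, Polynomial.eval_one, Nat.cast_id]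
  simp only [Polynomial.eval_add, Polynomial.eval_mul, hZ, hE, mainT, Polynomial.eval_X,
    Polynomial.eval_ofNat, Polynomial.eval_one]

end RAM

/-! ### Encodings -/

namespace RAM

theorem length_flatMap_encodePerm {n : ℕ} (L : List (Equiv.Perm (Fin n))) :
    (L.flatMap encodePerm).length = L.length * n := by
  induction L with
  | nil => simp
  | cons σ L ih => rw [List.flatMap_cons, List.length_append, ih, encodePerm]; simp; ring

theorem getD_flatMap_encodePerm {n : ℕ} (L : List (Equiv.Perm (Fin n))) {a : ℕ}
    (ha : a < L.length * n) :
    (L.flatMap encodePerm).getD a 0 = flat n (fun v => L.getD v 1) a := by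
  have hn : 0 < n := Nat.pos_of_ne_zero (by rintro rfl; simp at ha)
  induction L generalizing a with
  | nil => simp at ha
  | cons σ L ih =>
    have hl : (encodePerm σ).length = n := by simp [encodePerm]
    rw [List.flatMap_cons]
    rcases Nat.lt_or_ge a n with h | h
    · rw [List.getD_append _ _ _ _ (by rwa [hl]), List.getD_eq_getElem _ _ (by rwa [hl])]
      simp [encodePerm, flat, hn, Nat.div_eq_of_lt h, Nat.mod_eq_of_lt h]
    · obtain ⟨c, rfl⟩ := Nat.exists_eq_add_of_le h
      rw [List.getD_append_right _ _ _ _ (by omega), hl, Nat.add_sub_cancel_left, ih]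
      · refine flat_congr ?_ (by simp)
        simp [Nat.add_div_left c hn]
      · rw [List.length_cons, add_mul, one_mul] at ha
        omega

theorem getD_flatten_ofFn {r : ℕ} (w : ℕ → List ℕ) {i a : ℕ} (hi : i < r)
    (ha : a < (w i).length) :
    (List.ofFn fun j : Fin r => w j).flatten.getD (∑ j ∈ Finset.range i, (w j).length + a) 0 =
      (w i).getD a 0 := by
  induction r generalizing w i with
  | zero => simp at hi
  | succ r ih =>
    rw [List.ofFn_succ, List.flatten_cons]
    rcases i with _ | i
    · rw [Finset.range_zero, Finset.sum_empty, zero_add]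
      exact List.getD_append _ _ _ _ ha
    · rw [Finset.sum_range_succ', List.getD_append_right _ _ _ _ (by simp; omega)]
      rw [← ih (fun j => w (j + 1)) (by omega) ha]
      congr 1
      simp; omega

/-- A finite sequence of lists, continued by empty lists. -/
def extendLists {α : Type*} {r : ℕ} (L : Fin r → List α) (i : ℕ) : List α :=
  if h : i < r then L ⟨i, h⟩ else []

theorem extendLists_val {α : Type*} {r : ℕ} (L : Fin r → List α) (i : Fin r) :
    extendLists L i = L i := by simp [extendLists]

theorem input_initMemory {n r : ℕ} (L : Fin r → List (Equiv.Perm (Fin n))) :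
    Input (initMemory (encodeInput L)) n r (fun i => (extendLists L i).length)
      (fun i v => (extendLists L i).getD v 1) where
  points := by simp [initMemory, encodeInput]
  factors := by simp [initMemory, encodeInput]
  length := by
    intro i hi
    simp only [initMemory, encodeInput, if_true]
    rw [add_comm 2 i, List.getD_cons_succ, List.getD_cons_succ,
      List.getD_append _ _ _ _ (by simpa using hi), List.getD_eq_getElem _ _ (by simpa using hi)]
    simp [extendLists, hi]
  entry := by
    intro i hi a ha
    rw [← getD_flatMap_encodePerm _ ha]
    have hw : (List.ofFn fun i => (L i).flatMap encodePerm) =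
        List.ofFn fun j : Fin r => (fun i => (extendLists L i).flatMap encodePerm) j := by
      congr 1
      funext j
      simp only [extendLists_val]
    simp only [initMemory, encodeInput, if_true]
    rw [show 2 + r + ∑ j ∈ Finset.range i, (extendLists L j).length * n + a =
      r + (∑ j ∈ Finset.range i, (extendLists L j).length * n + a) + 1 + 1 by ring,
      List.getD_cons_succ, List.getD_cons_succ, List.getD_append_right _ _ _ _ (by simp),
      List.length_ofFn, Nat.add_sub_cancel_left, hw]
    rw [← getD_flatten_ofFn (r := r) (fun i => (extendLists L i).flatMap encodePerm) hi
      (by rwa [length_flatMap_encodePerm])]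
    simp only [length_flatMap_encodePerm]

theorem hasOutput_encodeOutput {n : ℕ} {m : Memory} {L : List (Equiv.Perm (Fin n))}
    (h0 : m 1 0 = L.length)
    (h : ∀ a < L.length * n, m 1 (1 + a) = flat n (fun v => L.getD v 1) a) :
    HasOutput m (encodeOutput L) := by
  intro j hj
  rcases j with _ | a
  · exact h0
  · have ha : a < L.length * n := by
      rw [encodeOutput, List.length_cons, length_flatMap_encodePerm] at hj
      omega
    have h1 := h a ha
    rw [add_comm, ← getD_flatMap_encodePerm L ha, List.getD_eq_getElem _ _
      (by rwa [length_flatMap_encodePerm])] at h1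
    exact h1

end RAM

/-! ### The spectral gap of the output -/

namespace CayleySpectrum

open GabberGalil RAM Finset

variable {Γ : Type*} [Group Γ] [Fintype Γ]

/-- The bound after one derandomized squaring. -/
noncomputable def squareBound (x : ℝ) : ℝ := 15 / 16 * x ^ 2 + 1 / 16

theorem squareBound_nonneg (x : ℝ) : 0 ≤ squareBound x := by unfold squareBound; positivity

theorem squareBound_mono {x y : ℝ} (hx : 0 ≤ x) (h : x ≤ y) : squareBound x ≤ squareBound y := by
  unfold squareBound
  gcongr

theorem squareBound_iterate_mono {x y : ℝ} (hx : 0 ≤ x) (h : x ≤ y) (k : ℕ) :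
    squareBound^[k] x ≤ squareBound^[k] y := by
  induction k generalizing x y with
  | zero => exact h
  | succ k ih => exact ih (squareBound_nonneg x) (squareBound_mono hx h)

/-- Four squarings double the gap, as long as the bound exceeds `1 / 8`. -/
theorem squareBound_iterate_four_le {g : ℝ} (hg : 0 ≤ g) :
    squareBound^[4] (max (1 / 8) (1 - g)) ≤ max (1 / 8) (1 - 2 * g) := by
  rcases le_total g (1 / 3) with h | h
  · rw [max_eq_right (a := 1 / 8) (b := 1 - g) (by linarith)]
    refine le_trans ?_ (le_max_right _ _)
    -- One squaring turns a gap `h` into `15/8 h - 15/16 h²`, at least `45/32 h` while `h ≤ 1/2`.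
    -- Two of them give `2025/1024`, just short of `2`, and the third passes `2`.
    have h1 : squareBound (1 - g) ≤ 1 - 45 / 32 * g := by
      unfold squareBound; nlinarith
    have h2 : squareBound (1 - 45 / 32 * g) ≤ 1 - 2025 / 1024 * g := by
      unfold squareBound; nlinarith
    have h3 : squareBound (1 - 2025 / 1024 * g) ≤ 1 - 2 * g := by
      unfold squareBound; nlinarith
    -- The fourth squaring does no harm, since `squareBound x ≤ x` between the fixed points `1/15`
    -- and `1`. It is needed only to bring `2/3` below `1/8` in the other case.
    have h4 : squareBound (1 - 2 * g) ≤ 1 - 2 * g := by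
      unfold squareBound; nlinarith
    calc squareBound^[4] (1 - g) ≤ squareBound^[3] (1 - 45 / 32 * g) :=
          squareBound_iterate_mono (squareBound_nonneg _) h1 3
      _ ≤ squareBound^[2] (1 - 2025 / 1024 * g) :=
          squareBound_iterate_mono (squareBound_nonneg _) h2 2
      _ ≤ squareBound^[1] (1 - 2 * g) := squareBound_iterate_mono (squareBound_nonneg _) h3 1
      _ ≤ 1 - 2 * g := h4
  · refine le_trans ?_ (le_max_left _ _)
    have h1 : max (1 / 8) (1 - g) ≤ 2 / 3 := max_le (by norm_num) (by linarith)
    refine (squareBound_iterate_mono (le_max_of_le_left (by norm_num)) h1 4).trans ?_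
    norm_num [squareBound]

theorem spectralBound_squareStep {H : Subgroup Γ} {lam : ℝ} (hlam : 0 ≤ lam) {x : ℕ × (ℕ → Γ)}
    (hx : 0 < x.1) (hS : ∀ v < x.1 * x.1, x.2 v ∈ H) (h : SpectralBound H lam x.2 (x.1 * x.1)) :
    0 < (squareStep x).1 ∧ (∀ v < (squareStep x).1 * (squareStep x).1, (squareStep x).2 v ∈ H) ∧
      SpectralBound H (squareBound lam) (squareStep x).2
        ((squareStep x).1 * (squareStep x).1) := by
  rw [squareStep_size]
  refine ⟨Nat.mul_pos hx (by positivity), fun v hv => ?_, h.square hlam hx ?_ hS⟩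
  · exact H.mul_mem (hS _ (Nat.div_lt_of_lt_mul (by rwa [mul_comm]))) (hS _ (walkEnd_lt hx _ _ hv))
  · norm_num [walkLength]

theorem spectralBound_squareStep_iterate {H : Subgroup Γ} (k : ℕ) {lam : ℝ} (hlam : 0 ≤ lam)
    {x : ℕ × (ℕ → Γ)} (hx : 0 < x.1) (hS : ∀ v < x.1 * x.1, x.2 v ∈ H)
    (h : SpectralBound H lam x.2 (x.1 * x.1)) :
    0 < (squareStep^[k] x).1 ∧
      (∀ v < (squareStep^[k] x).1 * (squareStep^[k] x).1, (squareStep^[k] x).2 v ∈ H) ∧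
      SpectralBound H (squareBound^[k] lam) (squareStep^[k] x).2
        ((squareStep^[k] x).1 * (squareStep^[k] x).1) := by
  induction k generalizing lam x with
  | zero => exact ⟨hx, hS, h⟩
  | succ k ih =>
    obtain ⟨h1, h2, h3⟩ := spectralBound_squareStep hlam hx hS h
    exact ih (squareBound_nonneg lam) h1 h2 h3

theorem squareBound_iterate_le {g : ℝ} (hg : 0 ≤ g) (J : ℕ) :
    squareBound^[4 * J] (max (1 / 8) (1 - g)) ≤ max (1 / 8) (1 - 2 ^ J * g) := by
  induction J generalizing g with
  | zero => simp
  | succ J ih =>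
    rw [show 4 * (J + 1) = 4 * J + 4 by ring, Function.iterate_add_apply]
    refine (squareBound_iterate_mono ?_ (squareBound_iterate_four_le hg) _).trans ?_
    · exact squareBound_nonneg _
    · rw [pow_succ, mul_assoc]
      exact ih (by linarith)

/-- The family computed by the program, for a series of length at least two. -/
theorem spectralBound_symmetrized_squareStep_iterate {H : Subgroup Γ} {r s K J N : ℕ}
    {S : ℕ → Γ} (hS : ∀ v, S v ∈ H) (h : SpectralBound H (1 - 3 / (8 * r)) S (r * s))
    (hr : 0 < r) (hs : 0 < s) (hK : r * s ≤ K * K) (hJ : 8 * r ≤ 2 ^ J) {x : ℕ × (ℕ → Γ)}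
    (hx : x = squareStep^[4 * J] (K, fun v => S (v % (r * s)))) (hN : 16 * (x.1 * x.1) ≤ N) :
    (∀ v, symmetrized x.2 (x.1 * x.1) (N / (2 * (x.1 * x.1))) v ∈ H) ∧
      SpectralBound H (1 / 4) (symmetrized x.2 (x.1 * x.1) (N / (2 * (x.1 * x.1)))) N := by
  have hr' : (1 : ℝ) ≤ r := by exact_mod_cast hr
  have hK0 : 0 < K := Nat.pos_of_mul_pos_left ((Nat.mul_pos hr hs).trans_le hK)
  have hg : (0 : ℝ) ≤ 3 / (16 * r) := by positivity
  -- The periodic extension to all `K * K` vertices halves the gap `3/(8r)`.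
  have h1 : SpectralBound H (max (1 / 8) (1 - 3 / (16 * r))) (fun v => S (v % (r * s)))
      (K * K) := by
    refine (h.extend ?_ (Nat.mul_pos hr hs) hK).mono (le_max_of_le_right (le_of_eq ?_))
    · have : (0 : ℝ) ≤ 3 / (8 * r) := by positivity
      linarith
    · field_simp; ring
  obtain ⟨h2, h3, h4⟩ := spectralBound_squareStep_iterate (4 * J)
    (le_max_of_le_left (by norm_num)) (x := (K, fun v => S (v % (r * s)))) hK0
    (fun v _ => hS _) h1
  rw [← hx] at h2 h3 h4
  have hx0 := Nat.mul_pos h2 h2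
  refine ⟨fun v => ?_, (h4.mono ((squareBound_iterate_le hg J).trans (max_le le_rfl ?_))).symmetrized
    h3 hN hx0⟩
  · unfold symmetrized
    have := Nat.mod_lt v (show 0 < 2 * (x.1 * x.1) by omega)
    split_ifs with h5 h6
    · exact h3 _ h6
    · exact H.inv_mem (h3 _ (by omega))
    · exact H.one_mem
  -- After `J` doublings the nominal gap is at least `8r * 3/(16r) = 3/2`, so the maximum is
  -- attained by `1/8`.
  · have hJ' : (8 * r : ℝ) ≤ 2 ^ J := by exact_mod_cast hJ
    have : (8 * r : ℝ) * (3 / (16 * r)) ≤ 2 ^ J * (3 / (16 * r)) :=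
      mul_le_mul_of_nonneg_right hJ' hg
    have e : (8 * r : ℝ) * (3 / (16 * r)) = 3 / 2 := by field_simp; norm_num
    linarith

theorem sum_map_eq_sum_range {α M : Type*} [AddCommMonoid M] (L : List α) (d : α) (F : α → M) :
    (L.map F).sum = ∑ j ∈ range L.length, F (L.getD j d) := by
  induction L with
  | nil => simp
  | cons a L ih =>
    rw [List.map_cons, List.sum_cons, List.length_cons, sum_range_succ', ih, add_comm]
    simp

/-- The inverse of a symmetrized family is a rearrangement of the family. -/
theorem map_inv_symmetrized (S : ℕ → Γ) {m N : ℕ} (hm : 0 < m) :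
    (Multiset.range N).map (fun v => (symmetrized S m (N / (2 * m)) v)⁻¹) =
      (Multiset.range N).map (symmetrized S m (N / (2 * m))) := by
  set q := N / (2 * m) with hq
  have hN : q * (2 * m) ≤ N := Nat.div_mul_le_self N (2 * m)
  -- The involution exchanges the two halves of each complete period, hence each member with its
  -- inverse, and fixes the identity padding.
  let e : ℕ → ℕ := fun v => if v < q * (2 * m) then
    (if v % (2 * m) < m then v + m else v - m) else v
  have hdm : ∀ v, 2 * m * (v / (2 * m)) + v % (2 * m) = v := fun v => Nat.div_add_mod v _
  have hlt : ∀ v, v % (2 * m) < 2 * m := fun v => Nat.mod_lt v (by omega)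
  have key : ∀ v, v < q * (2 * m) → e v < q * (2 * m) ∧ e (e v) = v ∧
      (symmetrized S m q v)⁻¹ = symmetrized S m q (e v) := by
    intro v hv
    have hd : v / (2 * m) < q := Nat.div_lt_of_lt_mul (by rwa [mul_comm])
    have hle : 2 * m * (v / (2 * m)) + 2 * m ≤ q * (2 * m) := by
      have := Nat.mul_le_mul_left (2 * m) (show v / (2 * m) + 1 ≤ q from hd)
      rwa [mul_add, mul_one, mul_comm (2 * m) q] at this
    have h1 := hdm v
    have h2 := hlt v
    generalize v / (2 * m) = c at *
    by_cases h3 : v % (2 * m) < m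
    · have he : e v = v + m := by simp [e, hv, h3]
      have h4 : (v + m) % (2 * m) = v % (2 * m) + m := by
        conv_lhs => rw [← h1, add_assoc, Nat.mul_add_mod]
        exact Nat.mod_eq_of_lt (by omega)
      have h5 : v + m < q * (2 * m) := by omega
      rw [he]
      refine ⟨h5, ?_, ?_⟩
      · simp only [e, h5, h4, if_true]
        rw [if_neg (by omega)]; omega
      · unfold symmetrized
        rw [if_pos hv, if_pos h3, if_pos h5, h4, if_neg (by omega), Nat.add_sub_cancel]
    · have he : e v = v - m := by simp [e, hv, h3]
      have h4 : (v - m) % (2 * m) = v % (2 * m) - m := by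
        have : v - m = 2 * m * c + (v % (2 * m) - m) := by omega
        conv_lhs => rw [this, Nat.mul_add_mod]
        exact Nat.mod_eq_of_lt (by omega)
      have h5 : v - m < q * (2 * m) := by omega
      rw [he]
      refine ⟨h5, ?_, ?_⟩
      · simp only [e, h5, h4, if_true]
        rw [if_pos (by omega)]; omega
      · unfold symmetrized
        rw [if_pos hv, if_neg h3, if_pos h5, h4, if_pos (by omega), inv_inv]
  have hout : ∀ v, ¬ v < q * (2 * m) → e v = v := fun v hv => by simp [e, hv]
  change (Finset.range N).val.map _ = (Finset.range N).val.map _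
  refine Multiset.map_eq_map_of_bij_of_nodup _ _ (Finset.range N).nodup (Finset.range N).nodup
    (fun v _ => e v) ?_ ?_ ?_ ?_
  · intro v hv
    simp only [Finset.mem_val, Finset.mem_range] at hv ⊢
    by_cases h : v < q * (2 * m)
    · exact (key v h).1.trans_le hN
    · rwa [hout v h]
  · intro v _ w _ h
    have hinv : ∀ v, e (e v) = v := fun v => by
      by_cases h : v < q * (2 * m)
      · exact (key v h).2.1
      · rw [hout v h, hout v h]
    rw [← hinv v, ← hinv w, h]
  · intro v hv
    simp only [Finset.mem_val, Finset.mem_range] at hv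
    by_cases h : v < q * (2 * m)
    · exact ⟨e v, by simpa using (key v h).1.trans_le hN, (key v h).2.1⟩
    · exact ⟨v, by simpa using hv, hout v h⟩
  · intro v _
    by_cases h : v < q * (2 * m)
    · exact (key v h).2.2
    · rw [hout v h]; simp [symmetrized, h]

end CayleySpectrum

/-! ### Normal series and the main theorem -/

namespace CayleySpectrum

open RAM Finset

theorem exists_list_isExpandingGenerating {Γ : Type*} [Group Γ] [Fintype Γ] {G : Subgroup Γ}
    {W : ℕ → Γ} {N : ℕ} (hN : 0 < N) (hW : ∀ v, v < N → W v ∈ G)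
    (hsym : (Multiset.range N).map (fun v => (W v)⁻¹) = (Multiset.range N).map W)
    (h : SpectralBound G (1 / 4) W N) :
    ∃ U : List G, U.map Subtype.val = (List.range N).map W ∧
      IsExpandingGenerating (1 / 4) (U : Multiset G) := by
  obtain ⟨U, hU⟩ : ∃ U : List G, U.map Subtype.val = (List.range N).map W :=
    ⟨(List.range N).pmap (fun v hv => ⟨W v, hW v hv⟩) (fun v hv => List.mem_range.1 hv), by
      rw [List.map_pmap, List.pmap_eq_map]⟩
  have hlen : U.length = N := by simpa using congrArg List.length hU
  have := Fintype.ofFinite G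
  have hexp : IsSpectralExpander (1 / 4) (U : Multiset G) := by
    refine isSpectralExpander_of_norm_sum_rho_le U (by norm_num) fun f hf => ?_
    have e : (U.map fun u : G => rho (u : Γ) f) = (List.range N).map fun v => rho (W v) f := by
      have := congrArg (List.map fun g : Γ => rho g f) hU
      rwa [List.map_map, List.map_map] at this
    have e' : ((List.range N).map fun v => rho (W v) f).sum = ∑ v ∈ range N, rho (W v) f := rfl
    rw [e, e', hlen]
    exact h f hf
  refine ⟨U, hU, ?_, IsSpectralExpander.closure_eq_top hexp (by norm_num) (by norm_num) (by simpa [hlen]), hexp⟩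
  refine Multiset.map_injective Subtype.val_injective ?_
  have e : ((U : Multiset G).map Subtype.val) = (Multiset.range N).map W := by
    rw [Multiset.map_coe, hU]; rfl
  have e' := congrArg (Multiset.map fun g : Γ => g⁻¹) e
  rw [Multiset.map_map, Multiset.map_map] at e'
  rw [Multiset.map_map, e, ← hsym]
  exact e'

theorem isExpandingGenerating_nil {Γ : Type*} [Group Γ] [Finite Γ] [Subsingleton Γ] (lam : ℝ)
    (hlam : 0 ≤ lam) : IsExpandingGenerating lam (([] : List Γ) : Multiset Γ) where
  symmetric := rfl
  generates := Subsingleton.elim _ _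
  expander := by
    have := Fintype.ofFinite Γ
    exact isSpectralExpander_of_sum_sq_le hlam fun f _ => by simp

end CayleySpectrum

namespace NormalSeries

open RAM CayleySpectrum Finset

variable {n r : ℕ} {G : Subgroup (Equiv.Perm (Fin n))}

/-- The empty set generates only the trivial group, so the factor is trivial. This justifies loading
an identity in place of an empty list. -/
theorem term_eq_of_length_eq_zero (𝒢 : NormalSeries G r) {i : Fin r}
    {L : List (𝒢.term i.castSucc)} {lam : ℝ} (h : IsExpandingGenerating lam (𝒢.cosets i L))
    (hL : L.length = 0) : 𝒢.term i.castSucc = 𝒢.term i.succ := by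
  refine le_antisymm (fun g hg => ?_) (𝒢.succ_le i)
  have h1 := h.generates
  rw [List.length_eq_zero_iff.1 hL] at h1
  have h2 : (QuotientGroup.mk (⟨g, hg⟩ : 𝒢.term i.castSucc) : 𝒢.Factor i) ∈
      (⊤ : Subgroup (𝒢.Factor i)) := trivial
  rw [← h1] at h2
  have h3 : (QuotientGroup.mk (⟨g, hg⟩ : 𝒢.term i.castSucc) : 𝒢.Factor i) = 1 := by
    simpa [cosets] using h2
  exact Subgroup.mem_subgroupOf.1 ((QuotientGroup.eq_one_iff _).1 h3)

/-- The terms of the series, continued by the trivial group. -/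
def termNat (𝒢 : NormalSeries G r) (i : ℕ) : Subgroup (Equiv.Perm (Fin n)) :=
  if h : i < r + 1 then 𝒢.term ⟨i, h⟩ else ⊥

theorem termNat_castSucc (𝒢 : NormalSeries G r) (i : Fin r) :
    𝒢.termNat i = 𝒢.term i.castSucc := dif_pos (by omega)

theorem termNat_succ (𝒢 : NormalSeries G r) (i : Fin r) :
    𝒢.termNat (i + 1) = 𝒢.term i.succ := dif_pos (by omega)

theorem termNat_zero (𝒢 : NormalSeries G r) : 𝒢.termNat 0 = G := by
  rw [termNat, dif_pos (by omega)]
  exact 𝒢.term_zero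

theorem termNat_last (𝒢 : NormalSeries G r) : 𝒢.termNat r = ⊥ := by
  rw [termNat, dif_pos (by omega)]
  exact 𝒢.term_last

theorem termNat_succ_le (𝒢 : NormalSeries G r) (i : ℕ) : 𝒢.termNat (i + 1) ≤ 𝒢.termNat i := by
  by_cases h : i < r
  · rw [𝒢.termNat_castSucc ⟨i, h⟩, 𝒢.termNat_succ ⟨i, h⟩]
    exact 𝒢.succ_le _
  · rw [termNat, dif_neg (by omega)]
    exact bot_le

theorem conj_mem_termNat (𝒢 : NormalSeries G r) (i : ℕ) {a g : Equiv.Perm (Fin n)} (ha : a ∈ G)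
    (hg : g ∈ 𝒢.termNat i) : a * g * a⁻¹ ∈ 𝒢.termNat i := by
  unfold termNat at hg ⊢
  split_ifs at hg ⊢ with h
  · exact Subgroup.mem_subgroupOf.1 ((𝒢.normal ⟨i, h⟩).conj_mem ⟨g, 𝒢.term_le _ hg⟩
      (Subgroup.mem_subgroupOf.2 hg) ⟨a, ha⟩)
  · rw [Subgroup.mem_bot] at hg ⊢
    rw [hg, mul_one, mul_inv_cancel]

theorem norm_sum_rho_getD_le (𝒢 : NormalSeries G r) {i : Fin r} {L : List (𝒢.term i.castSucc)}
    (h : IsExpandingGenerating (1 / 4) (𝒢.cosets i L))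
    {f : EuclideanSpace ℂ (Equiv.Perm (Fin n))} (hinv : ∀ g ∈ 𝒢.term i.succ, rho g f = f)
    (hf : cosetSum (𝒢.term i.castSucc) f = 0) :
    ‖∑ j ∈ range L.length, rho ((L.map Subtype.val).getD j 1) f‖ ≤ 1 / 4 * L.length * ‖f‖ := by
  have h1 := norm_sum_rho_le_of_factor L h.expander hinv hf
  have e : (L.map fun b : 𝒢.term i.castSucc => rho (b : Equiv.Perm (Fin n)) f) =
      (L.map Subtype.val).map fun b => rho b f := by rw [List.map_map]; rfl
  rwa [e, sum_map_eq_sum_range _ 1, List.length_map] at h1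

theorem spectralBound_blocks_extendLists (𝒢 : NormalSeries G r) (hr : 0 < r)
    {B : ∀ i : Fin r, List (𝒢.term i.castSucc)} {s : ℕ} (hs0 : 0 < s)
    (hs : ∀ i, (B i).length ≤ s)
    (hB : ∀ i, IsExpandingGenerating (1 / 4) (𝒢.cosets i (B i)))
    (hmem : ∀ i v, (extendLists (fun i => (B i).map Subtype.val) i).getD v 1 ∈ G) :
    SpectralBound G (1 - 3 / (8 * r))
      (blocks (fun i => max 1 (extendLists (fun i => (B i).map Subtype.val) i).length)
        (fun i v => (extendLists (fun i => (B i).map Subtype.val) i).getD v 1) s) (r * s) := by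
  have h0 := 𝒢.termNat_zero
  suffices key : SpectralBound (𝒢.termNat 0) (1 - 3 / (8 * r))
      (blocks (fun i => max 1 (extendLists (fun i => (B i).map Subtype.val) i).length)
        (fun i v => (extendLists (fun i => (B i).map Subtype.val) i).getD v 1) s) (r * s) by
    rwa [h0] at key
  refine spectralBound_blocks 𝒢.termNat_last hr 𝒢.termNat_succ_le
    (fun i a ha g hg => 𝒢.conj_mem_termNat i (h0 ▸ ha) hg) (fun i _ => by omega) ?_
    (by rw [h0]; exact hmem) ?_
  · intro i hi
    have := extendLists_val (fun i => (B i).map Subtype.val) ⟨i, hi⟩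
    simp only at this
    rw [this, List.length_map]
    exact max_le hs0 (hs _)
  · intro i hi f hinv hf
    have := extendLists_val (fun i => (B i).map Subtype.val) ⟨i, hi⟩
    simp only at this
    rw [this, List.length_map]
    have e1 := 𝒢.termNat_succ ⟨i, hi⟩
    have e0 := 𝒢.termNat_castSucc ⟨i, hi⟩
    simp only at e1 e0
    -- For an empty list the layer is zero: `f` is invariant under the same subgroup on whose cosets
    -- it sums to zero.
    rcases Nat.eq_zero_or_pos (B ⟨i, hi⟩).length with hl | hl
    · have ht := 𝒢.term_eq_of_length_eq_zero (hB ⟨i, hi⟩) hl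
      have hf0 : f = 0 := by
        rw [e1, ← ht, ← e0] at hinv
        rw [← avg_of_invariant _ hinv, avg, hf, smul_zero]
      simp [hf0]
    · rw [max_eq_right (show 1 ≤ _ from hl)]
      rw [e1] at hinv
      rw [e0] at hf
      exact 𝒢.norm_sum_rho_getD_le (hB ⟨i, hi⟩) hinv hf

theorem subsingleton_of_length_eq_zero (𝒢 : NormalSeries G r)
    {B : ∀ i : Fin r, List (𝒢.term i.castSucc)}
    (hB : ∀ i, IsExpandingGenerating (1 / 4) (𝒢.cosets i (B i)))
    (h : ∀ i, (B i).length = 0) : Subsingleton G := by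
  have h1 : ∀ i, i ≤ r → 𝒢.termNat i = G := by
    intro i
    induction i with
    | zero => exact fun _ => 𝒢.termNat_zero
    | succ i ih =>
      intro hi
      refine Eq.trans ?_ (ih (by omega))
      rw [𝒢.termNat_succ ⟨i, hi⟩, 𝒢.termNat_castSucc ⟨i, hi⟩,
        𝒢.term_eq_of_length_eq_zero (hB ⟨i, hi⟩) (h _)]
  have h2 : G = ⊥ := (h1 r le_rfl).symm.trans 𝒢.termNat_last
  refine ⟨fun a b => Subtype.ext ?_⟩
  rw [Subgroup.mem_bot.1 (h2 ▸ a.2 : (a : Equiv.Perm (Fin n)) ∈ (⊥ : Subgroup _)),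
    Subgroup.mem_bot.1 (h2 ▸ b.2 : (b : Equiv.Perm (Fin n)) ∈ (⊥ : Subgroup _))]

/-- The only factor is `G` modulo the trivial group. The quotient map is injective, so symmetry
lifts, and every function is invariant under the trivial group. -/
theorem spectralBound_of_length_one (𝒢 : NormalSeries G 1)
    {L : List (𝒢.term (0 : Fin 1).castSucc)} (h : IsExpandingGenerating (1 / 4) (𝒢.cosets 0 L)) :
    ((Multiset.range L.length).map (fun v => ((L.map Subtype.val).getD v 1)⁻¹) =
      (Multiset.range L.length).map fun v => (L.map Subtype.val).getD v 1) ∧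
    SpectralBound G (1 / 4) (fun v => (L.map Subtype.val).getD v 1) L.length := by
  have hlast : 𝒢.term (0 : Fin 1).succ = ⊥ := 𝒢.term_last
  have hzero : 𝒢.term (0 : Fin 1).castSucc = G := 𝒢.term_zero
  constructor
  · have e : (Multiset.range L.length).map (fun v => (L.map Subtype.val).getD v 1) =
        (L : Multiset (𝒢.term (0 : Fin 1).castSucc)).map Subtype.val := by
      have : (List.range L.length).map (fun v => (L.map Subtype.val).getD v 1) =
          L.map Subtype.val := by
        refine List.ext_getElem (by simp) fun i h1 h2 => ?_
        simp only [List.getElem_map, List.getElem_range]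
        rw [List.getD_eq_getElem _ _ h2, List.getElem_map]
      exact congrArg _ this
    have hinj : Function.Injective
        (fun b : 𝒢.term (0 : Fin 1).castSucc => (QuotientGroup.mk b : 𝒢.Factor 0)) := by
      intro a b hab
      have := QuotientGroup.eq.1 hab
      rw [Subgroup.mem_subgroupOf, hlast, Subgroup.mem_bot] at this
      exact inv_mul_eq_one.1 (Subtype.ext this)
    have hsym : (L : Multiset (𝒢.term (0 : Fin 1).castSucc)).map (fun b => b⁻¹) = L := by
      refine Multiset.map_injective hinj ?_
      have := h.symmetric
      rw [cosets, ← Multiset.map_coe, Multiset.map_map] at this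
      rw [Multiset.map_map]
      exact this
    have e' := congrArg (Multiset.map fun g : Equiv.Perm (Fin n) => g⁻¹) e
    rw [Multiset.map_map, Multiset.map_map] at e'
    refine e'.trans ?_
    rw [e]
    conv_rhs => rw [← hsym, Multiset.map_map]
    rfl
  · intro f hf
    rw [← hzero] at hf
    refine 𝒢.norm_sum_rho_getD_le h ?_ hf
    intro g hg
    rw [hlast, Subgroup.mem_bot] at hg
    rw [hg, rho_one]

/-- A properly descending series has at most `n ^ 2` terms. -/
theorem IsProper.length_le {𝒢 : NormalSeries G r} (h : 𝒢.IsProper) : r ≤ n ^ 2 := by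
  -- By Lagrange every proper inclusion at least halves the order.
  have h1 : ∀ i, i ≤ r → 2 ^ i * Nat.card (𝒢.termNat i) ≤ Nat.card G := by
    intro i
    induction i with
    | zero => intro _; rw [𝒢.termNat_zero]; simp
    | succ i ih =>
      intro hi
      refine le_trans ?_ (ih (by omega))
      rw [pow_succ, mul_assoc]
      refine Nat.mul_le_mul_left _ ?_
      have hlt : 𝒢.termNat (i + 1) < 𝒢.termNat i := by
        rw [𝒢.termNat_succ ⟨i, hi⟩, 𝒢.termNat_castSucc ⟨i, hi⟩]
        exact h _
      have hpos : 0 < Nat.card (𝒢.termNat (i + 1)) := Nat.card_pos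
      obtain ⟨c, hc⟩ := Subgroup.card_dvd_of_le hlt.le
      have hne : Nat.card (𝒢.termNat (i + 1)) ≠ Nat.card (𝒢.termNat i) := fun he =>
        hlt.ne (Subgroup.eq_of_le_of_card_ge hlt.le he.ge)
      rw [hc, mul_comm]
      refine Nat.mul_le_mul_left _ ?_
      rcases c with _ | _ | c
      · rw [mul_zero] at hc
        exact absurd hc Nat.card_pos.ne'
      · rw [zero_add, mul_one] at hc
        exact absurd hc.symm hne
      · omega
  have h2 := h1 r le_rfl
  have h3 : Nat.card G ≤ n.factorial := by
    have := Subgroup.card_le_card_group G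
    rwa [Nat.card_eq_fintype_card (α := Equiv.Perm (Fin n)), Fintype.card_perm,
      Fintype.card_fin] at this
  -- From `n! ≤ n ^ n` and `n ≤ 2 ^ n`.
  have h4 : n.factorial ≤ 2 ^ (n ^ 2) := by
    rw [sq, pow_mul]
    refine (Nat.factorial_le_pow n).trans (Nat.pow_le_pow_left (Nat.lt_pow_self ?_).le n)
    decide
  have h5 : 2 ^ r ≤ 2 ^ (n ^ 2) :=
    (Nat.le_mul_of_pos_right _ Nat.card_pos).trans (h2.trans (h3.trans h4))
  exact (Nat.pow_le_pow_iff_right (by decide)).1 h5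

end NormalSeries

/-! ### Assembly of the main theorem -/

theorem Polynomial.eval_mono_nat (P : Polynomial ℕ) {x y : ℕ} (h : x ≤ y) :
    P.eval x ≤ P.eval y := by
  rw [Polynomial.eval_eq_sum_range, Polynomial.eval_eq_sum_range]
  gcongr

theorem Real.pow_rpow_logb_two (k : ℕ) {x : ℝ} (hx : 0 < x) :
    ((2 : ℝ) ^ k) ^ Real.logb 2 x = x ^ k := by
  rw [← Real.rpow_natCast, ← Real.rpow_mul (by norm_num), mul_comm, Real.rpow_mul (by norm_num),
    Real.rpow_logb (by norm_num) (by norm_num) hx, Real.rpow_natCast]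

-- Three cases: for `s = 0` the group is trivial and the empty list works, for `r = 1` the input
-- list works, and otherwise the amplified and symmetrized family does.
open RAM CayleySpectrum in
theorem exists_isExpandingGenerating_of_isResult {n r : ℕ} (hr : 1 ≤ r)
    {G : Subgroup (Equiv.Perm (Fin n))} (𝒢 : NormalSeries G r)
    {B : ∀ i : Fin r, List (𝒢.term i.castSucc)} {s : ℕ}
    (hs : s = Finset.univ.sup (fun i => (B i).length))
    (hB : ∀ i, IsExpandingGenerating (1 / 4) (𝒢.cosets i (B i)))
    {W : ℕ → Equiv.Perm (Fin n)}
    (hW : IsResult r s (fun i => (extendLists (fun i => (B i).map Subtype.val) i).length)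
      (fun i v => (extendLists (fun i => (B i).map Subtype.val) i).getD v 1) W) :
    ∃ U : List G, U.map Subtype.val = (List.range (s * r ^ degree)).map W ∧
      IsExpandingGenerating (1 / 4) (U : Multiset G) := by
  have hle : ∀ i, (B i).length ≤ s := fun i => by
    rw [hs]; exact Finset.le_sup (f := fun i => (B i).length) (Finset.mem_univ i)
  have hmem : ∀ i v, (extendLists (fun i => (B i).map Subtype.val) i).getD v 1 ∈ G := by
    intro i v
    rw [List.getD_eq_getElem?_getD]
    rcases hv : (extendLists (fun i => (B i).map Subtype.val) i)[v]? with _ | g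
    · exact G.one_mem
    · have hg := List.mem_of_getElem? hv
      unfold extendLists at hg
      split_ifs at hg with hi
      · obtain ⟨b, -, rfl⟩ := List.mem_map.1 hg
        exact 𝒢.term_le _ b.2
      · simp at hg
  rcases Nat.eq_zero_or_pos s with hs0 | hs0
  · have := 𝒢.subsingleton_of_length_eq_zero hB fun i => Nat.le_zero.1 (hs0 ▸ hle i)
    exact ⟨[], by simp [hs0], isExpandingGenerating_nil _ (by norm_num)⟩
  · have hN : 0 < s * r ^ degree := Nat.mul_pos hs0 (Nat.pow_pos (by omega))
    rcases eq_or_lt_of_le hr with rfl | hr2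
    · have hl : (B 0).length = s := by rw [hs]; simp
      obtain ⟨h1, h2⟩ := 𝒢.spectralBound_of_length_one (hB 0)
      have hW1 := hW.1 rfl
      have e := extendLists_val (fun i => (B i).map Subtype.val) 0
      simp only [Fin.val_zero] at e
      simp only [e] at hW1
      rw [hl] at h1 h2
      refine exists_list_isExpandingGenerating hN (fun v _ => ?_) ?_ ?_
      · have := hmem 0 v
        rw [hW1, ← e]
        exact this
      · rw [one_pow, mul_one, hW1]
        exact h1
      · rw [one_pow, mul_one, hW1]
        exact h2
    · obtain ⟨K, J, x, hK, hJ, hx, hN', rfl⟩ := hW.2 hr2 hs0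
      have hS := 𝒢.spectralBound_blocks_extendLists (by omega) hs0 hle hB hmem
      have hx0 : 0 < x.1 * x.1 := by
        rw [hx, squareStep_iterate_size]
        exact Nat.mul_pos ((Nat.mul_pos (by omega) hs0).trans_le hK) (by positivity)
      obtain ⟨h1, h2⟩ := spectralBound_symmetrized_squareStep_iterate (fun v => hmem _ _) hS
        (by omega) hs0 hK hJ hx hN'
      exact exists_list_isExpandingGenerating hN (fun v _ => h1 v)
        (map_inv_symmetrized _ hx0) h2

open RAM in
theorem mainTheorem7 :
    ∃ (A : RAM.Prog) (P : Polynomial ℕ) (c : ℝ), 0 < c ∧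
      ∀ (n r : ℕ), 1 ≤ r →
      ∀ (G : Subgroup (Equiv.Perm (Fin n))) (𝒢 : NormalSeries G r)
        (B : ∀ i : Fin r, List (𝒢.term i.castSucc)) (s : ℕ),
        s = Finset.univ.sup (fun i => (B i).length) →
        (∀ i, IsExpandingGenerating (1 / 4) (𝒢.cosets i (B i))) →
        ∃ (U : List G) (t : ℕ),
          RAM.Computes A (encodeInput fun i => (B i).map Subtype.val)
            (encodeOutput (U.map Subtype.val)) t ∧
          t ≤ P.eval (n + s + r) ∧
          (𝒢.IsProper → t ≤ P.eval (n + s)) ∧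
          IsExpandingGenerating (1 / 4) (U : Multiset G) ∧
          (U.length : ℝ) = c ^ Real.logb 2 (r : ℝ) * (s : ℝ) := by
  obtain ⟨P, hP⟩ := exists_polynomial_mainT
  -- Here `(2 ^ degree) ^ log₂ r = r ^ degree`. The substitution `X + X ^ 2` makes the same
  -- polynomial serve proper series, where `r ≤ n ^ 2 ≤ (n + s) ^ 2`.
  refine ⟨mainP, P.comp (.X + .X ^ 2), 2 ^ degree, by positivity, ?_⟩
  intro n r hr G 𝒢 B s hs hB
  have hsup : s = (Finset.range r).sup
      fun i => (extendLists (fun i => (B i).map Subtype.val) i).length := by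
    rw [hs]
    refine le_antisymm (Finset.sup_le fun i _ => ?_) (Finset.sup_le fun i hi => ?_)
    · have := Finset.le_sup
        (f := fun i => (extendLists (fun i => (B i).map Subtype.val) i).length)
        (Finset.mem_range.2 i.2)
      simpa only [extendLists_val, List.length_map] using this
    · have := extendLists_val (fun i => (B i).map Subtype.val) ⟨i, Finset.mem_range.1 hi⟩
      simp only at this
      rw [this, List.length_map]
      exact Finset.le_sup (f := fun i => (B i).length) (Finset.mem_univ _)
  obtain ⟨m, hrun, h0, h0', W, hW, hout⟩ := mainP_runs
    (input_initMemory fun i => (B i).map Subtype.val) hr hsup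
    (fun i _ h => by simp only [List.length_eq_zero_iff.1 h, List.getD_nil])
  obtain ⟨U, hU, hexp⟩ := exists_isExpandingGenerating_of_isResult hr 𝒢 hs hB hW
  obtain ⟨t, ht, hrun⟩ := hrun
  rw [← hP] at ht
  have hlen : U.length = s * r ^ degree := by simpa using congrArg List.length hU
  refine ⟨U, t, ⟨m, hrun, hasOutput_encodeOutput ?_ ?_⟩, ?_, fun hproper => ?_, hexp, ?_⟩
  · rw [List.length_map, hlen]
    rcases Nat.eq_zero_or_pos s with rfl | h
    · rw [h0' rfl]; simp [initMemory]
    · exact h0 h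
  · intro a ha
    rw [List.length_map, hlen] at ha
    rw [hout a ha]
    refine flat_congr ?_ rfl
    have hv : a / n < s * r ^ degree := Nat.div_lt_of_lt_mul (by rwa [mul_comm])
    rw [hU, List.getD_eq_getElem _ _ (by simpa using hv)]
    simp
  · refine ht.trans ?_
    rw [Polynomial.eval_comp]
    exact P.eval_mono_nat (by simp)
  · refine ht.trans ?_
    rw [Polynomial.eval_comp]
    refine P.eval_mono_nat ?_
    have h1 := hproper.length_le
    have h2 : n ^ 2 ≤ (n + s) ^ 2 := Nat.pow_le_pow_left (by omega) 2
    simp only [Polynomial.eval_add, Polynomial.eval_pow, Polynomial.eval_X]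
    omega
  · rw [Real.pow_rpow_logb_two _ (by exact_mod_cast hr), hlen]
    push_cast
    ring
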